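/- Let $\sigma\in\{1,-1\}$ and consider charged-particle motion in the slab magnetic field $\mathbf B=(1+y)\,e_z$ in the region $y>-1$, with $x$ being $2\pi$-periodic: $\dot v_x=\sigma v_y(1+y)$, $\dot v_y=-\sigma v_x(1+y)$, $\dot x=\epsilon v_x$, $\dot y=\epsilon v_y$. These equations are Hamiltonian for $H=\tfrac12\epsilon^2(v_x^2+v_y^2)$ and $\omega=-d\vartheta$, $\vartheta=\epsilon(v_x\,dx+v_y\,dy)-\sigma(y+y^2/2)\,dx$. Put $r=\sqrt{v_x^2+v_y^2}$, $Y=-p_x/\sigma$ with $p_x=\epsilon v_x-\sigma(y+y^2/2)$, and $$J_1(r,Y)=\epsilon\,\sigma\,r\,(1+2Y)^{1/2}\,\frac1{2\pi}\int_0^{2\pi}\Bigl(1+\frac{2\sigma\epsilon r}{1+2Y}\cos\zeta\Bigr)^{1/2}\cos\zeta\,d\zeta .$$ (1) For $\epsilon,r>0$ with $2\epsilon r<1+2Y$, the level set of $(r,Y)$ in $y>-1$ is invariant under the motion and equals $\{\Gamma(x,\zeta)\}$, where $\Gamma(x,\zeta)$ is the point with coordinates $x$, $y=-1+(1+2Y)^{1/2}\bigl(1+\frac{2\sigma\epsilon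 r}{1+2Y}\cos\zeta\bigr)^{1/2}$, $v_x=r\cos\zeta$, $v_y=-r\sin\zeta$; and $J_1(r,Y)=\frac1{2\pi}\oint_{\gamma_1}\vartheta$ for the cyclotron cycle $\gamma_1(\zeta)=\Gamma(0,\sigma\zeta)$, $0\le\zeta\le2\pi$. (2) For every $\epsilon>0$, $J_1$ is an exact constant of motion. (3) A roto-rate is a formal power series $\mathcal R=\sum_k\epsilon^k\mathcal R_k$ of smooth vector fields on the region $y>-1$ which commutes with the vector field of the equations of motion to all orders in $\epsilon$, all of whose (formal) integral curves are $2\pi$-periodic to all orders in $\epsilon$, and whose term of order $\epsilon^0$ is $\mathcal R_0=\sigma(v_y\partial_{v_x}-v_x\partial_{v_y})$. Kruskal's adiabatic invariant series is the formal power series $\mu=\sum_k\epsilon^k\mu_k$ whose value at a point is $\frac1{2\pi}\oint\vartheta$ over the closed integral curve of $\mathcal R$ through this point. The roto-rate $\mathcal R$ and the series $\mu$ exist and are unique, all $\mu_k$ are smooth, $\iota_{\mathcal R}\omega=d\mu$ to all orders in $\epsilon$, and the power series of $J_1$ in $\epsilon$ agrees with $\mu$ to all orders: each compact subset of the region $y>-1$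 of the phase space has a $\rho>0$ such that $J_1=\sum_k\epsilon^k\mu_k$ (a convergent series) at all its points for $|\epsilon|<\rho$, where $J_1$ is regarded as a function of $\epsilon$ and the phase space point through $r$ and $Y$. -/

import Mathlib

open scoped Topology ContDiff

namespace Slab

/-- Points `(x, y, v_x, v_y)` of the phase space, with the `2π`-periodic coordinate `x` lifted
to the real line. -/
abbrev Phase : Type := Fin 4 → ℝ

/-- The part `y > -1` of the phase space, where the magnetic field `1 + y` is positive. -/
def region : Set Phase := {z | -1 < z 1}

/-- The Lorentz force vector field in the magnetic field `(1 + y) e_z`, for the sign of charge `σ`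
and the ordering parameter `ε`. -/
def field (σ ε : ℝ) (z : Phase) : Phase :=
  ![ε * z 2, ε * z 3, σ * z 3 * (1 + z 1), -(σ * z 2 * (1 + z 1))]

/-- The Liouville 1-form `ε (v_x dx + v_y dy) - σ (y + y²/2) dx` at `z`, applied to the tangent
vector `u`. -/
noncomputable def liouville (σ ε : ℝ) (z u : Phase) : ℝ :=
  ε * (z 2 * u 0 + z 3 * u 1) - σ * (z 1 + z 1 ^ 2 / 2) * u 0

/-- The 2-form `ω = -dϑ` at `z`, applied to the tangent vectors `u` and `w`, where `ϑ` is the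
Liouville 1-form. -/
noncomputable def omega (σ ε : ℝ) (z u w : Phase) : ℝ :=
  -(fderiv ℝ (fun p => liouville σ ε p w) z u - fderiv ℝ (fun p => liouville σ ε p u) z w)

/-- The canonical `x`-momentum `p_x`. -/
noncomputable def momentum (σ ε : ℝ) (z : Phase) : ℝ :=
  ε * z 2 - σ * (z 1 + z 1 ^ 2 / 2)

/-- The conserved quantity `r`, the speed. -/
noncomputable def speed (z : Phase) : ℝ := Real.sqrt (z 2 ^ 2 + z 3 ^ 2)

/-- The conserved quantity `Y = -p_x / σ`. -/
noncomputable def centerY (σ ε : ℝ) (z : Phase) : ℝ := -momentum σ ε z / σ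

/-- The action variable `J₁` as a function of `(r, Y)`. -/
noncomputable def action (σ ε r Y : ℝ) : ℝ :=
  ε * σ * r * Real.sqrt (1 + 2 * Y) * ((2 * Real.pi)⁻¹ *
    ∫ ζ in (0 : ℝ)..(2 * Real.pi),
      Real.sqrt (1 + 2 * σ * ε * r / (1 + 2 * Y) * Real.cos ζ) * Real.cos ζ)

/-- The action variable `J₁` as a function on phase space. -/
noncomputable def actionAt (σ ε : ℝ) (z : Phase) : ℝ :=
  action σ ε (speed z) (centerY σ ε z)

/-- The level set of the constants of motion `(r, Y)` in the region `y > -1`. -/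
def levelSet (σ ε r Y : ℝ) : Set Phase :=
  {z | z ∈ region ∧ speed z = r ∧ centerY σ ε z = Y}

/-- The parameterization `(x, ζ) ↦ Γ(x, ζ | r, Y)` of the level set, in the coordinates
`(x, y, v_x, v_y)`. -/
noncomputable def torus (σ ε r Y x ζ : ℝ) : Phase :=
  ![x,
    -1 + Real.sqrt (1 + 2 * Y) * Real.sqrt (1 + 2 * σ * ε * r / (1 + 2 * Y) * Real.cos ζ),
    r * Real.cos ζ,
    -(r * Real.sin ζ)]

/-- The cyclotron cycle `γ₁(ζ | r, Y) = Γ(0, σ ζ | r, Y)`. -/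
noncomputable def cycle (σ ε r Y ζ : ℝ) : Phase := torus σ ε r Y 0 (σ * ζ)

/-- The integral of the Liouville 1-form over `γ` restricted to `[0, 2π]`, divided by `2π`. -/
noncomputable def loopAction (σ ε : ℝ) (γ : ℝ → Phase) : ℝ :=
  (2 * Real.pi)⁻¹ * ∫ t in (0 : ℝ)..(2 * Real.pi), liouville σ ε (γ t) (deriv γ t)

/-- `γ` solves the equations of motion on the set of times `s`. -/
def IsMotionOn (σ ε : ℝ) (γ : ℝ → Phase) (s : Set ℝ) : Prop :=
  ∀ t ∈ s, HasDerivWithinAt γ (field σ ε (γ t)) s t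

section FormalSeries

variable {E : Type*} [NormedAddCommGroup E] [NormedSpace ℝ E]

/-- The partial sum `a₀ + ε a₁ + ⋯ + ε^k a_k` of a formal power series in `ε`. -/
noncomputable def partialSum (a : ℕ → E) (k : ℕ) (ε : ℝ) : E :=
  ∑ i ∈ Finset.range (k + 1), ε ^ i • a i

/-- `f` and `g` agree modulo `O(ε^n)` as `ε → 0`. -/
def EqMod (n : ℕ) (f g : ℝ → E) : Prop :=
  (fun ε => f ε - g ε) =O[𝓝 (0 : ℝ)] (fun ε => ε ^ n)

end FormalSeries

/-- The partial sum of order `k` of a formal power series of vector fields. -/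
noncomputable def partialField (R : ℕ → Phase → Phase) (k : ℕ) (ε : ℝ) (z : Phase) : Phase :=
  partialSum (fun i => R i z) k ε

/-- The partial sum of order `k` of a formal power series of curves. -/
noncomputable def partialCurve (c : ℕ → ℝ → Phase) (k : ℕ) (ε t : ℝ) : Phase :=
  partialSum (fun i => c i t) k ε

/-- `c = ∑ ε^k c_k` is an integral curve in `y > -1` of the formal vector field
`R = ∑ ε^k R_k`: the equation `ċ = R(c)` holds to every order in `ε`. -/
structure IsFormalIntegralCurve (R : ℕ → Phase → Phase) (c : ℕ → ℝ → Phase) : Prop where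
  smooth : ∀ k, ContDiff ℝ 1 (c k)
  mem : ∀ t, c 0 t ∈ region
  eqn : ∀ k t, EqMod (k + 1) (fun ε => deriv (partialCurve c k ε) t)
    (fun ε => partialField R k ε (partialCurve c k ε t))

/-- The limiting roto-rate `σ (v_y ∂_{v_x} - v_x ∂_{v_y})`. -/
def limitingRotoRate (σ : ℝ) (z : Phase) : Phase := ![0, 0, σ * z 3, -(σ * z 2)]

/-- `R = ∑ ε^k R_k` is a roto-rate: a formal power series of smooth vector fields
on the region `y > -1` (`2π`-periodic in `x`), which commutes with the Lorentz force vector field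
to every order in `ε`, all of whose integral curves are `2π`-periodic to every order in `ε`, and
which tends to the limiting roto-rate as `ε → 0`. -/
structure IsRotoRate (σ : ℝ) (R : ℕ → Phase → Phase) : Prop where
  smooth : ∀ k, ContDiffOn ℝ ∞ (R k) region
  periodic_x : ∀ k, ∀ z ∈ region, R k (z + ![2 * Real.pi, 0, 0, 0]) = R k z
  commutes : ∀ k, ∀ z ∈ region,
    EqMod (k + 1) (fun ε => VectorField.lieBracket ℝ (partialField R k ε) (field σ ε) z)
      (fun _ => 0)
  periodic : ∀ c, IsFormalIntegralCurve R c → ∀ k t, c k (t + 2 * Real.pi) = c k t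
  limit : ∀ z ∈ region, R 0 z = limitingRotoRate σ z

/-- `μ = ∑ ε^k μ_k` is Kruskal's adiabatic invariant series for the roto-rate `R`: to every order
in `ε`, its value at `z` is the action (the integral of the Liouville 1-form divided by `2π`) of
the closed integral curve of `R` through `z`. -/
def IsKruskalSeries (σ : ℝ) (R : ℕ → Phase → Phase) (μ : ℕ → Phase → ℝ) : Prop :=
  ∀ z ∈ region, ∀ c, IsFormalIntegralCurve R c → c 0 0 = z → (∀ k, c (k + 1) 0 = 0) →
    ∀ k, EqMod (k + 1) (fun ε => loopAction σ ε (partialCurve c k ε))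
      (fun ε => partialSum (fun i => μ i z) k ε)

/-- The formal vector field `R` is Hamiltonian on `y > -1` with the smooth formal Hamiltonian `μ`:
`ω(R, ·) = dμ` to every order in `ε`. -/
def IsHamiltonianSeries (σ : ℝ) (R : ℕ → Phase → Phase) (μ : ℕ → Phase → ℝ) : Prop :=
  (∀ k, ContDiffOn ℝ ∞ (μ k) region) ∧
  ∀ k, ∀ z ∈ region, ∀ w : Phase,
    EqMod (k + 1) (fun ε => omega σ ε z (partialField R k ε z) w)
      (fun ε => partialSum (fun i => fderiv ℝ (μ i) z w) k ε)

end Slab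

/-! Reparametrizing the motion by the mean over the gyro-angle of the reciprocal field strength and
removing the mean drift in `x` gives a vector field that commutes with the motion and is smooth in
`ε` and the phase space point across `ε = 0`. In explicit normal coordinates it is a rigid rotation,
so its orbits are closed, and along them `ϑ` is an exact derivative plus a smooth action; the Taylor
coefficients in `ε` of this vector field and this action are the roto-rate and Kruskal's series.

The roto-rate is unique because the first coefficient in which two of them differ is invariant under
rotation of the velocity, and such a coefficient makes integral curves drift secularly, against
their periodicity. The action is `J₁`, which is constant because `r` and `Y` are, and expanding its
square root by the binomial series gives a power series in `ε` that converges locally uniformly in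
the phase space point. -/

namespace Slab

open Set Filter Asymptotics MeasureTheory

universe u

section ParametricIntegral

theorem exists_eventually_forall_norm_le {X Y E : Type*} [TopologicalSpace X]
    [TopologicalSpace Y] [SeminormedAddCommGroup E] {g : X × Y → E} {K : Set X}
    (hK : IsCompact K) {y₀ : Y} (hg : ∀ x ∈ K, ContinuousAt g (x, y₀)) :
    ∃ M, ∀ᶠ y in 𝓝 y₀, ∀ x ∈ K, ‖g (x, y)‖ ≤ M := by
  obtain ⟨M, hM⟩ := hK.exists_bound_of_continuousOn (f := fun x => g (x, y₀)) fun x hx =>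
    ((hg x hx).comp (f := fun x => (x, y₀)) (by fun_prop)).continuousWithinAt
  refine ⟨M + 1, hK.eventually_forall_of_forall_eventually fun x hx => ?_⟩
  have hlt : ∀ᶠ p in 𝓝 (x, y₀), ‖g p‖ < M + 1 :=
    (hg x hx).norm.eventually_lt_const ((hM x hx).trans_lt (lt_add_one M))
  have hswap : Tendsto Prod.swap (𝓝 (y₀, x)) (𝓝 (x, y₀)) := continuous_swap.tendsto _
  exact (hswap.eventually hlt).mono fun _ => le_of_lt

variable {V E : Type u} [NormedAddCommGroup V] [NormedSpace ℝ V]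
  [NormedAddCommGroup E] [NormedSpace ℝ E] {O : Set (ℝ × V)} {f : ℝ × V → E} {a b : ℝ}

theorem hasFDerivAt_parametricIntegral (hO : IsOpen O) (hf : ContDiffOn ℝ 1 f O) {w₀ : V}
    (h : ∀ s ∈ uIcc a b, (s, w₀) ∈ O) :
    HasFDerivAt (fun w => ∫ s in a..b, f (s, w))
      (∫ s in a..b, (fderiv ℝ f (s, w₀)).comp (ContinuousLinearMap.inr ℝ ℝ V)) w₀ := by
  let f' : ℝ × V → V →L[ℝ] E := fun p => (fderiv ℝ f p).comp (ContinuousLinearMap.inr ℝ ℝ V)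
  have hf' : ContinuousOn f' O :=
    (hf.continuousOn_fderiv_of_isOpen hO le_rfl).clm_comp continuousOn_const
  have slice {G : Type u} [TopologicalSpace G] {g : ℝ × V → G} (hg : ContinuousOn g O) {w : V}
      (hw : ∀ s ∈ uIcc a b, (s, w) ∈ O) : ContinuousOn (fun s => g (s, w)) (uIcc a b) :=
    hg.comp (f := fun s : ℝ => (s, w)) (by fun_prop) hw
  have measurable {G : Type u} [NormedAddCommGroup G] {g : ℝ → G}
      (hg : ContinuousOn g (uIcc a b)) :
      AEStronglyMeasurable g (volume.restrict (uIoc a b)) :=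
    (hg.mono uIoc_subset_uIcc).aestronglyMeasurable measurableSet_uIoc
  obtain ⟨M, hM⟩ := exists_eventually_forall_norm_le (isCompact_uIcc (a := a) (b := b))
    fun s hs => hf'.continuousAt (hO.mem_nhds (h s hs))
  have hmem : ∀ᶠ w in 𝓝 w₀, ∀ s ∈ uIcc a b, (s, w) ∈ O :=
    isCompact_uIcc.eventually_forall_of_forall_eventually fun s hs =>
      (continuous_swap.tendsto (w₀, s)).eventually (hO.mem_nhds (h s hs))
  obtain ⟨S, hS, hSO⟩ := (hmem.and hM).exists_mem
  refine intervalIntegral.hasFDerivAt_integral_of_dominated_of_fderiv_le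
    (F := fun w s => f (s, w)) (F' := fun w s => f' (s, w)) (bound := fun _ => M) hS
    (mem_of_superset hS fun w hw => measurable (slice hf.continuousOn (hSO w hw).1))
    (slice hf.continuousOn h).intervalIntegrable (measurable (slice hf' h))
    (.of_forall fun s hs w hw => (hSO w hw).2 s (uIoc_subset_uIcc hs))
    intervalIntegrable_const (.of_forall fun s hs w hw => ?_)
  have hsw := hO.mem_nhds ((hSO w hw).1 s (uIoc_subset_uIcc hs))
  exact ((hf.contDiffAt hsw).differentiableAt one_ne_zero).hasFDerivAt.comp w
    (hasFDerivAt_prodMk_right s w)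

theorem contDiffOn_parametricIntegral (hO : IsOpen O) (hf : ContDiffOn ℝ ∞ f O)
    {W : Set V} (hW : IsOpen W) (h : ∀ w ∈ W, ∀ s ∈ uIcc a b, (s, w) ∈ O) :
    ContDiffOn ℝ ∞ (fun w => ∫ s in a..b, f (s, w)) W := by
  rw [contDiffOn_infty]
  intro n
  induction n generalizing E with
  | zero =>
    exact contDiffOn_zero.2 fun w hw => (hasFDerivAt_parametricIntegral hO (hf.of_le (by simp))
      (h w hw)).continuousAt.continuousWithinAt
  | succ n ih =>
    have hderiv (w) (hw : w ∈ W) := hasFDerivAt_parametricIntegral hO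
      (hf.of_le (by simp)) (h w hw)
    rw [Nat.cast_succ, contDiffOn_succ_iff_fderiv_of_isOpen hW]
    refine ⟨fun w hw => (hderiv w hw).differentiableAt.differentiableWithinAt, by simp, ?_⟩
    have hf' : ContDiffOn ℝ ∞
        (fun p => (fderiv ℝ f p).comp (ContinuousLinearMap.inr ℝ ℝ V)) O :=
      (hf.fderiv_of_isOpen hO (by simp)).clm_comp contDiffOn_const
    exact (ih hf').congr fun w hw => (hderiv w hw).fderiv

end ParametricIntegral

section EqMod

variable {E : Type*} [NormedAddCommGroup E] {n m : ℕ} {f g f' g' : ℝ → E}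

theorem EqMod.refl (n : ℕ) (f : ℝ → E) : EqMod n f f := by
  simpa only [EqMod, sub_self] using isBigO_zero _ _

theorem EqMod.symm (h : EqMod n f g) : EqMod n g f :=
  h.neg_left.congr_left fun ε => neg_sub (f ε) (g ε)

theorem EqMod.trans {k : ℝ → E} (h : EqMod n f g) (h' : EqMod n g k) : EqMod n f k :=
  (IsBigO.add h h').congr_left fun ε => sub_add_sub_cancel (f ε) (g ε) (k ε)

theorem EqMod.add (h : EqMod n f g) (h' : EqMod n f' g') :
    EqMod n (fun ε => f ε + f' ε) (fun ε => g ε + g' ε) :=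
  (IsBigO.add h h').congr_left fun _ => (add_sub_add_comm _ _ _ _).symm

theorem EqMod.sub (h : EqMod n f g) (h' : EqMod n f' g') :
    EqMod n (fun ε => f ε - f' ε) (fun ε => g ε - g' ε) :=
  (IsBigO.sub h h').congr_left fun _ => sub_sub_sub_comm _ _ _ _

theorem EqMod.of_eventuallyEq (h : f =ᶠ[𝓝 0] g) : EqMod n f g :=
  IsBigO.congr' (EqMod.refl n f) (h.mono fun ε hε => by simp only [hε]) .rfl

theorem EqMod.congr' (h : EqMod n f g) (hf : f =ᶠ[𝓝 0] f') (hg : g =ᶠ[𝓝 0] g') :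
    EqMod n f' g' :=
  (EqMod.of_eventuallyEq hf.symm).trans (h.trans (EqMod.of_eventuallyEq hg))

theorem EqMod.mono (hmn : m ≤ n) (h : EqMod n f g) : EqMod m f g :=
  IsBigO.trans h (.of_bound' (by
    filter_upwards [Metric.ball_mem_nhds (0 : ℝ) one_pos] with ε hε
    rw [norm_pow, norm_pow]
    exact pow_le_pow_of_le_one (norm_nonneg ε) (mem_ball_zero_iff.1 hε).le hmn))

variable [NormedSpace ℝ E]

theorem EqMod.of_smul {r : ℝ → E} (hr : ContinuousAt r 0)
    (h : ∀ᶠ ε in 𝓝 0, f ε = g ε + ε ^ n • r ε) : EqMod n f g := by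
  have hO : (fun ε : ℝ => ε ^ n • r ε) =O[𝓝 0] fun ε : ℝ => ε ^ n := by
    simpa using (isBigO_refl (fun ε : ℝ => ε ^ n) _).smul (hr.isBigO_one ℝ)
  exact hO.congr' (h.mono fun ε hε => by simp only [hε, add_sub_cancel_left]) .rfl

theorem EqMod.of_differentiableAt (hf : DifferentiableAt ℝ f 0) : EqMod 1 f fun _ => f 0 := by
  simpa [EqMod] using hf.isBigO_sub

theorem EqMod.comp_contDiffAt {P : Type*} [NormedAddCommGroup P] [NormedSpace ℝ P]
    {F : ℝ × P → E} {z : P} (hF : ContDiffAt ℝ 1 F (0, z)) {u v : ℝ → P}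
    (hu : Tendsto u (𝓝 0) (𝓝 z)) (hv : Tendsto v (𝓝 0) (𝓝 z)) (h : EqMod n u v) :
    EqMod n (fun ε => F (ε, u ε)) (fun ε => F (ε, v ε)) := by
  have hlip := (hF.hasStrictFDerivAt one_ne_zero).isBigO_sub
  have ht : Tendsto (fun ε : ℝ => ((ε, u ε), (ε, v ε))) (𝓝 0) (𝓝 ((0, z), (0, z))) :=
    (tendsto_id.prodMk_nhds hu).prodMk_nhds (tendsto_id.prodMk_nhds hv)
  refine (hlip.comp_tendsto ht).trans (IsBigO.trans (isBigO_of_le _ fun ε => ?_) h)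
  simp [Prod.norm_def]

theorem EqMod.pow_smul (m : ℕ) (h : EqMod n f g) :
    EqMod (m + n) (fun ε => ε ^ m • f ε) (fun ε => ε ^ m • g ε) := by
  simpa [EqMod, smul_sub, pow_add] using (isBigO_refl (fun ε : ℝ => ε ^ m) (𝓝 0)).smul h

theorem tendsto_zero_of_eqMod_pow_smul {k : ℕ}
    (h : EqMod (k + 1) (fun ε => ε ^ k • f ε) fun _ => 0) : Tendsto f (𝓝[≠] 0) (𝓝 0) := by
  have hdiv : (fun ε : ℝ => (ε ^ k)⁻¹ • ε ^ k • f ε) =O[𝓝[≠] 0]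
      fun ε : ℝ => (ε ^ k)⁻¹ • ε ^ (k + 1) :=
    (isBigO_refl _ _).smul (by simpa [EqMod] using IsBigO.mono h nhdsWithin_le_nhds)
  have hf : f =O[𝓝[≠] 0] fun ε : ℝ => ε := by
    refine hdiv.congr' ?_ ?_ <;> filter_upwards [self_mem_nhdsWithin] with ε hε
    · rw [inv_smul_smul₀ (pow_ne_zero k hε)]
    · rw [pow_succ, smul_eq_mul, inv_mul_cancel_left₀ (pow_ne_zero k hε)]
  exact hf.trans_tendsto (tendsto_id.mono_left nhdsWithin_le_nhds)

end EqMod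

section PartialSum

variable {E : Type*} [NormedAddCommGroup E] [NormedSpace ℝ E] {a b : ℕ → E} {k : ℕ}

theorem partialSum_succ (a : ℕ → E) (k : ℕ) (ε : ℝ) :
    partialSum a (k + 1) ε = partialSum a k ε + ε ^ (k + 1) • a (k + 1) :=
  Finset.sum_range_succ _ _

@[simp] theorem partialSum_zero (a : ℕ → E) (ε : ℝ) : partialSum a 0 ε = a 0 := by
  simp [partialSum]

theorem partialSum_at_zero (a : ℕ → E) (k : ℕ) : partialSum a k 0 = a 0 := by
  simp [partialSum, Finset.sum_range_succ']

theorem partialSum_sub (a b : ℕ → E) (k : ℕ) (ε : ℝ) :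
    partialSum (fun i => a i - b i) k ε = partialSum a k ε - partialSum b k ε := by
  simp [partialSum, smul_sub, Finset.sum_sub_distrib]

theorem partialSum_congr (h : ∀ i ≤ k, a i = b i) (ε : ℝ) :
    partialSum a k ε = partialSum b k ε :=
  Finset.sum_congr rfl fun i hi => by rw [h i (Finset.mem_range_succ_iff.1 hi)]

theorem partialSum_eq_zero (h : ∀ i ≤ k, a i = 0) (ε : ℝ) : partialSum a k ε = 0 := by
  rw [partialSum_congr h]
  simp [partialSum]

theorem continuous_partialSum (a : ℕ → E) (k : ℕ) : Continuous (partialSum a k) := by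
  unfold partialSum
  fun_prop

theorem tendsto_partialSum (a : ℕ → E) (k : ℕ) : Tendsto (partialSum a k) (𝓝 0) (𝓝 (a 0)) :=
  partialSum_at_zero a k ▸ (continuous_partialSum a k).tendsto 0

theorem eqMod_partialSum_succ (a : ℕ → E) (k : ℕ) :
    EqMod (k + 1) (partialSum a (k + 1)) (partialSum a k) :=
  .of_smul continuousAt_const (.of_forall (partialSum_succ a k))

theorem eq_zero_of_eqMod_pow_smul {v : E} (h : EqMod (k + 1) (fun ε => ε ^ k • v) fun _ => 0) :
    v = 0 :=
  tendsto_nhds_unique tendsto_const_nhds (tendsto_zero_of_eqMod_pow_smul h)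

theorem eq_zero_of_eqMod_partialSum (h : EqMod (k + 1) (partialSum a k) fun _ => 0) :
    ∀ i ≤ k, a i = 0 := by
  induction k with
  | zero =>
    have h0 : a 0 = 0 :=
      eq_zero_of_eqMod_pow_smul (h.congr' (.of_forall fun ε => by simp) .rfl)
    simpa using h0
  | succ k ih =>
    have hlt := ih ((eqMod_partialSum_succ a k).symm.trans (h.mono (Nat.le_succ _)))
    have hk : a (k + 1) = 0 := eq_zero_of_eqMod_pow_smul (h.congr' (.of_forall fun ε => by
      rw [partialSum_succ, partialSum_eq_zero hlt, zero_add]) .rfl)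
    exact fun i hi => (Nat.le_succ_iff.1 hi).elim (hlt i) fun h => h ▸ hk

theorem eq_of_eqMod_partialSum (h : EqMod (k + 1) (partialSum a k) (partialSum b k)) :
    ∀ i ≤ k, a i = b i := by
  have hsub : EqMod (k + 1) (partialSum (fun i => a i - b i) k) fun _ => 0 := by
    simpa [EqMod, partialSum_sub] using h
  exact fun i hi => sub_eq_zero.1 (eq_zero_of_eqMod_partialSum hsub i hi)

theorem coeff_eq_add_of_eqMod {f g : ℝ → E} {v : E} (hf : EqMod (k + 1) f (partialSum a k))
    (hg : EqMod (k + 1) g (partialSum b k))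
    (hfg : EqMod (k + 1) f fun ε => g ε + ε ^ k • v) : a k = b k + v := by
  have hsum : EqMod (k + 1) (partialSum a k) (partialSum (b + Pi.single k v) k) := by
    refine hf.symm.trans (hfg.trans ((hg.add (.refl _ _)).congr' .rfl (.of_forall fun ε => ?_)))
    simp [partialSum, smul_add, Finset.sum_add_distrib, Pi.single_apply, smul_ite]
  simpa using eq_of_eqMod_partialSum hsum k le_rfl

end PartialSum

section Expansion

variable {P E : Type u} [NormedAddCommGroup P] [NormedSpace ℝ P]
  [NormedAddCommGroup E] [NormedSpace ℝ E]

/-- The quotient `(g (ε, z) - g (0, z)) / ε` of Hadamard's lemma, written as an integral so that it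
is smooth across `ε = 0`. -/
noncomputable def hadamard (g : ℝ × P → E) (p : ℝ × P) : E :=
  ∫ s in (0 : ℝ)..1, fderiv ℝ g (s * p.1, p.2) (1, 0)

/-- The coefficient of `ε ^ k` in the Taylor expansion of `g (ε, z)` at `ε = 0`. -/
noncomputable def jet (k : ℕ) (g : ℝ × P → E) (z : P) : E := hadamard^[k] g (0, z)

/-- An open set of pairs `(ε, z)` which contains with each point its segment to `(0, z)`: the kind
of domain on which functions are expanded in powers of `ε`. -/
structure IsExpansionDomain {P : Type*} [TopologicalSpace P] (U : Set (ℝ × P)) : Prop where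
  isOpen : IsOpen U
  smul_mem : ∀ p ∈ U, ∀ s ∈ Icc (0 : ℝ) 1, (s * p.1, p.2) ∈ U

variable {U : Set (ℝ × P)} {g : ℝ × P → E} {k : ℕ}

theorem contDiffOn_hadamard (hU : IsExpansionDomain U) (hg : ContDiffOn ℝ ∞ g U) :
    ContDiffOn ℝ ∞ (hadamard g) U := by
  have hscale : ContDiff ℝ ∞ fun q : ℝ × (ℝ × P) => (q.1 * q.2.1, q.2.2) := by fun_prop
  refine contDiffOn_parametricIntegral (hU.isOpen.preimage hscale.continuous)
    (((hg.fderiv_of_isOpen hU.isOpen (by simp)).comp hscale.contDiffOn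
      fun q hq => hq).clm_apply contDiffOn_const) hU.isOpen fun p hp s hs => ?_
  exact hU.smul_mem p hp s (uIcc_of_le (zero_le_one' ℝ) ▸ hs)

theorem eq_add_smul_hadamard [CompleteSpace E] (hU : IsExpansionDomain U)
    (hg : ContDiffOn ℝ ∞ g U) {p : ℝ × P} (hp : p ∈ U) :
    g p = g (0, p.2) + p.1 • hadamard g p := by
  have hmem : ∀ s ∈ uIcc (0 : ℝ) 1, (s * p.1, p.2) ∈ U := fun s hs =>
    hU.smul_mem p hp s (uIcc_of_le (zero_le_one' ℝ) ▸ hs)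
  have hderiv : ∀ s ∈ uIcc (0 : ℝ) 1, HasDerivAt (fun s : ℝ => g (s * p.1, p.2))
      (p.1 • fderiv ℝ g (s * p.1, p.2) (1, 0)) s := fun s hs => by
    have hline : HasDerivAt (fun s : ℝ => (s * p.1, p.2)) (p.1 • ((1 : ℝ), (0 : P))) s := by
      simpa using ((hasDerivAt_id s).mul_const p.1).prodMk (hasDerivAt_const s p.2)
    have hgs := (hg.contDiffAt (hU.isOpen.mem_nhds (hmem s hs))).differentiableAt (by simp)
    simpa only [map_smul, Function.comp_def] using hgs.hasFDerivAt.comp_hasDerivAt s hline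
  have hcont : ContinuousOn (fun s : ℝ => fderiv ℝ g (s * p.1, p.2) (1, 0)) (uIcc (0 : ℝ) 1) :=
    ((hg.continuousOn_fderiv_of_isOpen hU.isOpen (by simp)).clm_apply continuousOn_const).comp
      (f := fun s : ℝ => (s * p.1, p.2)) (by fun_prop) hmem
  have hftc := intervalIntegral.integral_eq_sub_of_hasDerivAt hderiv
    (hcont.const_smul p.1).intervalIntegrable
  simp only [intervalIntegral.integral_smul, one_mul, zero_mul, Prod.mk.eta] at hftc
  rw [hadamard, hftc, add_sub_cancel]

theorem contDiffOn_iterate_hadamard (hU : IsExpansionDomain U) (hg : ContDiffOn ℝ ∞ g U)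
    (k : ℕ) : ContDiffOn ℝ ∞ (hadamard^[k] g) U := by
  induction k with
  | zero => exact hg
  | succ k ih =>
    rw [Function.iterate_succ_apply']
    exact contDiffOn_hadamard hU ih

theorem continuousAt_iterate_hadamard (hU : IsExpansionDomain U) (hg : ContDiffOn ℝ ∞ g U)
    (k : ℕ) {p : ℝ × P} (hp : p ∈ U) : ContinuousAt (hadamard^[k] g) p :=
  (contDiffOn_iterate_hadamard hU hg k).continuousOn.continuousAt (hU.isOpen.mem_nhds hp)

theorem contDiffOn_jet (hU : IsExpansionDomain U) (hg : ContDiffOn ℝ ∞ g U) (k : ℕ) :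
    ContDiffOn ℝ ∞ (jet k g) {z | ((0 : ℝ), z) ∈ U} :=
  (contDiffOn_iterate_hadamard hU hg k).comp
    (contDiff_prodMk_right (0 : ℝ)).contDiffOn fun _ hz => hz

theorem eq_partialSum_jet [CompleteSpace E] (hU : IsExpansionDomain U)
    (hg : ContDiffOn ℝ ∞ g U) (k : ℕ) {p : ℝ × P} (hp : p ∈ U) :
    g p = partialSum (fun i => jet i g p.2) k p.1 + p.1 ^ (k + 1) • hadamard^[k + 1] g p := by
  induction k with
  | zero => simpa [jet] using eq_add_smul_hadamard hU hg hp
  | succ k ih =>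
    have hrem : hadamard^[k + 1] g p = jet (k + 1) g p.2 + p.1 • hadamard^[k + 2] g p := by
      simpa only [jet, Function.iterate_succ_apply' hadamard (k + 1)] using
        eq_add_smul_hadamard hU (contDiffOn_iterate_hadamard hU hg (k + 1)) hp
    rw [ih, partialSum_succ, add_assoc, hrem, smul_add, smul_smul, ← pow_succ]

theorem eqMod_partialSum_jet [CompleteSpace E] (hU : IsExpansionDomain U)
    (hg : ContDiffOn ℝ ∞ g U) (k : ℕ) {z : P} (hz : ((0 : ℝ), z) ∈ U) :
    EqMod (k + 1) (fun ε => g (ε, z)) (partialSum (fun i => jet i g z) k) := by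
  have hline : ContinuousAt (fun ε : ℝ => (ε, z)) 0 := by fun_prop
  exact .of_smul (r := fun ε => hadamard^[k + 1] g (ε, z))
    ((continuousAt_iterate_hadamard hU hg (k + 1) hz).comp (f := fun ε : ℝ => (ε, z)) hline)
    ((hline.eventually (hU.isOpen.mem_nhds hz)).mono fun ε hε => eq_partialSum_jet hU hg k hε)

theorem exists_bound_of_eqMod [CompleteSpace E] (hU : IsExpansionDomain U)
    (hg : ContDiffOn ℝ ∞ g U) {K : Set P} (hK : IsCompact K)
    (hKU : ∀ z ∈ K, ((0 : ℝ), z) ∈ U)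
    (h : ∀ z ∈ K, EqMod (k + 1) (fun ε => g (ε, z)) fun _ => 0) :
    ∃ C : ℝ, ∀ᶠ ε in 𝓝 (0 : ℝ), ∀ z ∈ K, ‖g (ε, z)‖ ≤ C * |ε| ^ (k + 1) := by
  have hjet (z) (hz : z ∈ K) : ∀ i ≤ k, jet i g z = 0 :=
    eq_zero_of_eqMod_partialSum ((eqMod_partialSum_jet hU hg k (hKU z hz)).symm.trans (h z hz))
  obtain ⟨C, hC⟩ := exists_eventually_forall_norm_le
    (g := fun p : P × ℝ => hadamard^[k + 1] g p.swap) hK (y₀ := (0 : ℝ)) fun z hz =>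
      (continuousAt_iterate_hadamard hU hg (k + 1) (hKU z hz)).comp (f := Prod.swap)
        continuous_swap.continuousAt
  have hmem : ∀ᶠ ε in 𝓝 (0 : ℝ), ∀ z ∈ K, (ε, z) ∈ U :=
    hK.eventually_forall_of_forall_eventually fun z hz => hU.isOpen.mem_nhds (hKU z hz)
  refine ⟨C, (hmem.and hC).mono fun ε hε z hz => ?_⟩
  rw [eq_partialSum_jet hU hg k (hε.1 z hz), partialSum_eq_zero (hjet z hz), zero_add, norm_smul,
    norm_pow, Real.norm_eq_abs, mul_comm]
  exact mul_le_mul_of_nonneg_right (hε.2 z hz) (by positivity)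

end Expansion

section StarCore

variable {P : Type*} {O : Set (ℝ × P)}

/-- The points `(ε, z)` whose segment to `(0, z)` lies in `O`: the largest expansion domain inside
an open set `O`. -/
def starCore (O : Set (ℝ × P)) : Set (ℝ × P) :=
  {p | ∀ s ∈ Icc (0 : ℝ) 1, (s * p.1, p.2) ∈ O}

theorem starCore_subset (O : Set (ℝ × P)) : starCore O ⊆ O := fun p hp => by
  simpa using hp 1 (by simp)

theorem zero_mem_starCore {z : P} (hz : ((0 : ℝ), z) ∈ O) :
    ((0 : ℝ), z) ∈ starCore O := fun s _ => by simpa using hz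

theorem isExpansionDomain_starCore [TopologicalSpace P] (hO : IsOpen O) :
    IsExpansionDomain (starCore O) where
  isOpen := isOpen_iff_mem_nhds.2 fun p hp =>
    isCompact_Icc.eventually_forall_of_forall_eventually fun s hs => by
      have hc : Continuous fun q : (ℝ × P) × ℝ => (q.2 * q.1.1, q.1.2) := by fun_prop
      exact hc.continuousAt.eventually (hO.mem_nhds (hp s hs))
  smul_mem p hp s hs r hr := by
    simpa [mul_assoc] using hp (r * s) ⟨mul_nonneg hr.1 hs.1, mul_le_one₀ hr.2 hs.1 hs.2⟩

end StarCore

theorem isOpen_region : IsOpen region := isOpen_lt continuous_const (continuous_apply 1)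

theorem zero_mem_region : (0 : Phase) ∈ region := by simp [region]

theorem abs_eq_one_of_sq_eq_one {σ : ℝ} (hσ : σ ^ 2 = 1) : |σ| = 1 := by
  rwa [← sq_eq_sq₀ (abs_nonneg σ) zero_le_one, sq_abs, one_pow]

section Rotation

variable {σ : ℝ}

/-- The flow of the limiting roto-rate. -/
noncomputable def rot (σ t : ℝ) (z : Phase) : Phase :=
  ![z 0, z 1, Real.cos t * z 2 + σ * Real.sin t * z 3, Real.cos t * z 3 - σ * Real.sin t * z 2]

theorem isLinearMap_limitingRotoRate (σ : ℝ) : IsLinearMap ℝ (limitingRotoRate σ) where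
  map_add z w := by ext i; fin_cases i <;> simp [limitingRotoRate] <;> ring
  map_smul c z := by ext i; fin_cases i <;> simp [limitingRotoRate] <;> ring

theorem continuous_limitingRotoRate (σ : ℝ) : Continuous (limitingRotoRate σ) :=
  (isLinearMap_limitingRotoRate σ).mk'.continuous_of_finiteDimensional

theorem isLinearMap_rot (σ t : ℝ) : IsLinearMap ℝ (rot σ t) where
  map_add z w := by ext i; fin_cases i <;> simp [rot] <;> ring
  map_smul c z := by ext i; fin_cases i <;> simp [rot] <;> ring

@[simp] theorem rot_zero (σ : ℝ) (z : Phase) : rot σ 0 z = z := by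
  ext i; fin_cases i <;> simp [rot]

theorem rot_apply_zero (σ t : ℝ) : rot σ t 0 = 0 := (isLinearMap_rot σ t).map_zero

theorem rot_add_two_pi (σ t : ℝ) (z : Phase) : rot σ (t + 2 * Real.pi) z = rot σ t z := by
  simp [rot]

theorem rot_neg (σ t : ℝ) (z : Phase) : rot σ (-t) z = rot (-σ) t z := by
  simp [rot]

theorem rot_rot_neg (hσ : σ ^ 2 = 1) (t : ℝ) (z : Phase) : rot σ t (rot σ (-t) z) = z := by
  have h := Real.sin_sq_add_cos_sq t
  ext i; fin_cases i <;> simp [rot]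
  · linear_combination (z 2) * h + Real.sin t ^ 2 * z 2 * hσ
  · linear_combination (z 3) * h + Real.sin t ^ 2 * z 3 * hσ

theorem rot_neg_rot (hσ : σ ^ 2 = 1) (t : ℝ) (z : Phase) : rot σ (-t) (rot σ t z) = z := by
  simpa using rot_rot_neg hσ (-t) z

theorem limitingRotoRate_rot (σ t : ℝ) (z : Phase) :
    limitingRotoRate σ (rot σ t z) = rot σ t (limitingRotoRate σ z) := by
  ext i; fin_cases i <;> simp [limitingRotoRate, rot] <;> ring

theorem rot_mem_region {z : Phase} (hz : z ∈ region) (σ t : ℝ) : rot σ t z ∈ region := hz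

theorem contDiff_rot (σ : ℝ) : ContDiff ℝ ∞ (fun p : ℝ × Phase => rot σ p.1 p.2) := by
  rw [contDiff_pi]
  intro i
  fin_cases i <;>
    simp only [rot, Fin.isValue, Fin.zero_eta, Fin.mk_one, Fin.reduceFinMk, Matrix.cons_val] <;>
    fun_prop

theorem hasDerivAt_rot (hσ : σ ^ 2 = 1) {w : ℝ → Phase} {w' : Phase} {t : ℝ}
    (hw : HasDerivAt w w' t) :
    HasDerivAt (fun t => rot σ t (w t)) (limitingRotoRate σ (rot σ t (w t)) + rot σ t w') t := by
  have hw := hasDerivAt_pi.1 hw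
  have hc := Real.hasDerivAt_cos t
  have hs := (Real.hasDerivAt_sin t).const_mul σ
  rw [hasDerivAt_pi]
  intro i
  fin_cases i
  · simpa [rot, limitingRotoRate] using hw 0
  · simpa [rot, limitingRotoRate] using hw 1
  · refine ((hc.mul (hw 2)).add (hs.mul (hw 3))).congr_deriv ?_
    simp only [rot, limitingRotoRate, Pi.add_apply, Matrix.cons_val, Fin.reduceFinMk]
    linear_combination Real.sin t * w t 2 * hσ
  · refine ((hc.mul (hw 3)).sub (hs.mul (hw 2))).congr_deriv ?_
    simp only [rot, limitingRotoRate, Pi.add_apply, Matrix.cons_val, Fin.reduceFinMk]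
    linear_combination Real.sin t * w t 3 * hσ

theorem hasDerivAt_rot_neg (hσ : σ ^ 2 = 1) {w : ℝ → Phase} {w' : Phase} {t : ℝ}
    (hw : HasDerivAt w w' t) :
    HasDerivAt (fun t => rot σ (-t) (w t)) (rot σ (-t) (w' - limitingRotoRate σ (w t))) t := by
  have hneg (z : Phase) : limitingRotoRate (-σ) z = -limitingRotoRate σ z := by
    ext i; fin_cases i <;> simp [limitingRotoRate]
  have h := hasDerivAt_rot (σ := -σ) (by rwa [neg_sq]) hw
  simp only [← rot_neg, hneg, limitingRotoRate_rot] at h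
  rwa [(isLinearMap_rot σ (-t)).map_sub, ← neg_add_eq_sub]

theorem rot_neg_eq_add_integral (hσ : σ ^ 2 = 1) {u f : ℝ → Phase}
    (hu : ∀ t, HasDerivAt u (limitingRotoRate σ (u t) + f t) t) (hf : Continuous f) (t : ℝ) :
    rot σ (-t) (u t) = u 0 + ∫ s in (0 : ℝ)..t, rot σ (-s) (f s) := by
  have hd : ∀ s ∈ uIcc 0 t, HasDerivAt (fun t => rot σ (-t) (u t)) (rot σ (-s) (f s)) s :=
    fun s _ => by simpa only [add_sub_cancel_left] using hasDerivAt_rot_neg hσ (hu s)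
  have hc : Continuous (fun s => rot σ (-s) (f s)) :=
    (contDiff_rot σ).continuous.comp (continuous_neg.prodMk hf)
  rw [intervalIntegral.integral_eq_sub_of_hasDerivAt hd (hc.intervalIntegrable _ _)]
  simp

theorem eq_of_hasDerivAt_limitingRotoRate (hσ : σ ^ 2 = 1) {u v f : ℝ → Phase}
    (hu : ∀ t, HasDerivAt u (limitingRotoRate σ (u t) + f t) t)
    (hv : ∀ t, HasDerivAt v (limitingRotoRate σ (v t) + f t) t) (h0 : u 0 = v 0) : u = v := by
  have hd (t) : HasDerivAt (u - v) (limitingRotoRate σ ((u - v) t) + 0) t :=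
    ((hu t).sub (hv t)).congr_deriv (by
      rw [Pi.sub_apply, (isLinearMap_limitingRotoRate σ).map_sub]; abel)
  funext t
  have hconst : rot σ (-t) ((u - v) t) = 0 := by
    simpa [h0, rot_apply_zero] using rot_neg_eq_add_integral hσ hd continuous_const t
  rw [← sub_eq_zero, ← Pi.sub_apply, ← rot_rot_neg hσ t ((u - v) t), hconst, rot_apply_zero]

end Rotation

section FormalCurves

/-- The partial sum of order `k` of the formal vector field `R` at the polynomial in `ε` with the
`k` coefficients `w.2`, for `ε = w.1`. -/
noncomputable def fieldAtPolynomial (R : ℕ → Phase → Phase) (k : ℕ) (w : ℝ × (Fin k → Phase)) :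
    Phase :=
  partialField R k w.1 (∑ i : Fin k, w.1 ^ (i : ℕ) • w.2 i)

/-- The contribution of the coefficients `b i`, `i < k`, to the equation of order `k` for the
integral curves of `R`. -/
noncomputable def forcing (R : ℕ → Phase → Phase) (k : ℕ) (b : ℕ → Phase) : Phase :=
  jet k (fieldAtPolynomial R k) (fun i => b i)

/-- The expansion domain on which `fieldAtPolynomial R k` is smooth. -/
def polynomialDomain (k : ℕ) : Set (ℝ × (Fin k → Phase)) :=
  starCore {w | (∑ i : Fin k, w.1 ^ (i : ℕ) • w.2 i) ∈ region}

variable {R R' : ℕ → Phase → Phase} {σ : ℝ} {b b' : ℕ → Phase} {c : ℕ → ℝ → Phase} {z : Phase}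

theorem isExpansionDomain_polynomialDomain (k : ℕ) : IsExpansionDomain (polynomialDomain k) :=
  isExpansionDomain_starCore (isOpen_region.preimage (by fun_prop))

theorem sum_fin_eq_partialSum (b : ℕ → Phase) (k : ℕ) (ε : ℝ) :
    ∑ i : Fin (k + 1), ε ^ (i : ℕ) • b i = partialSum b k ε :=
  Fin.sum_univ_eq_sum_range (fun i => ε ^ i • b i) (k + 1)

theorem zero_mem_polynomialDomain (k : ℕ) (hb : b 0 ∈ region) :
    ((0 : ℝ), fun i : Fin k => b i) ∈ polynomialDomain k := by
  refine zero_mem_starCore ?_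
  cases k with
  | zero => simpa using zero_mem_region
  | succ k => rwa [mem_ofPred_eq, sum_fin_eq_partialSum b k 0, partialSum_at_zero]

theorem contDiffOn_partialField (hR : ∀ k, ContDiffOn ℝ ∞ (R k) region) (k : ℕ) :
    ContDiffOn ℝ ∞ (fun p : ℝ × Phase => partialField R k p.1 p.2) {p | p.2 ∈ region} := by
  unfold partialField partialSum
  exact ContDiffOn.sum fun i _ => (contDiff_fst.pow i).contDiffOn.smul
    ((hR i).comp contDiff_snd.contDiffOn fun _ hp => hp)

theorem contDiffAt_partialField (hR : ∀ k, ContDiffOn ℝ ∞ (R k) region) (k : ℕ) (ε : ℝ)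
    (hz : z ∈ region) : ContDiffAt ℝ ∞ (fun p : ℝ × Phase => partialField R k p.1 p.2) (ε, z) :=
  (contDiffOn_partialField hR k).contDiffAt
    ((isOpen_region.preimage continuous_snd).mem_nhds hz)

theorem contDiffOn_fieldAtPolynomial (hR : ∀ k, ContDiffOn ℝ ∞ (R k) region) (k : ℕ) :
    ContDiffOn ℝ ∞ (fieldAtPolynomial R k) (polynomialDomain k) := by
  have h : ContDiff ℝ ∞ (fun w : ℝ × (Fin k → Phase) =>
      (w.1, ∑ i : Fin k, w.1 ^ (i : ℕ) • w.2 i)) := by fun_prop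
  exact (contDiffOn_partialField hR k).comp h.contDiffOn (starCore_subset _)

theorem eqMod_fieldAtPolynomial (hR : ∀ k, ContDiffOn ℝ ∞ (R k) region) (k : ℕ)
    (hb : b 0 ∈ region) :
    EqMod (k + 1) (fun ε => fieldAtPolynomial R k (ε, fun i => b i))
      (partialSum (fun i => jet i (fieldAtPolynomial R k) (fun i => b i)) k) :=
  eqMod_partialSum_jet (isExpansionDomain_polynomialDomain k)
    (contDiffOn_fieldAtPolynomial hR k) k (zero_mem_polynomialDomain k hb)

theorem partialField_succ (R : ℕ → Phase → Phase) (k : ℕ) (ε : ℝ) (z : Phase) :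
    partialField R (k + 1) ε z = partialField R k ε z + ε ^ (k + 1) • R (k + 1) z :=
  partialSum_succ _ _ _

theorem partialField_succ' (R : ℕ → Phase → Phase) (k : ℕ) (ε : ℝ) (z : Phase) :
    partialField R (k + 1) ε z = R 0 z + ε ^ 1 • partialField (fun i => R (i + 1)) k ε z := by
  simp only [partialField, partialSum]
  rw [Finset.sum_range_succ' _ (k + 1), add_comm, Finset.smul_sum]
  simp [pow_succ', mul_smul]

theorem fieldAtPolynomial_succ (R : ℕ → Phase → Phase) (k : ℕ) (ε : ℝ) (b : ℕ → Phase) :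
    fieldAtPolynomial R (k + 1) (ε, fun i => b i) =
      partialField R k ε (partialSum b k ε) + ε ^ (k + 1) • R (k + 1) (partialSum b k ε) := by
  rw [fieldAtPolynomial, sum_fin_eq_partialSum, partialField_succ]

theorem eventually_partialSum_mem (hb : b 0 ∈ region) (k : ℕ) :
    ∀ᶠ ε in 𝓝 (0 : ℝ), partialSum b k ε ∈ region :=
  (tendsto_partialSum b k).eventually (isOpen_region.mem_nhds hb)

theorem forcing_zero (h0 : ∀ z ∈ region, R 0 z = limitingRotoRate σ z) (b : ℕ → Phase) :
    forcing R 0 b = 0 := by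
  simp [forcing, jet, fieldAtPolynomial, partialField, h0 0 zero_mem_region,
    (isLinearMap_limitingRotoRate σ).map_zero]

theorem forcing_congr_prefix {k : ℕ} (h : ∀ i < k, b i = b' i) : forcing R k b = forcing R k b' :=
  congrArg (jet k (fieldAtPolynomial R k)) (funext fun i => h i i.2)

theorem eqMod_coeff_partialSum (hR : ∀ k, ContDiffOn ℝ ∞ (R k) region) (hb : b 0 ∈ region)
    (i k : ℕ) : EqMod 1 (fun ε => R i (partialSum b k ε)) fun _ => R i (b 0) := by
  have hRi : DifferentiableAt ℝ (R i) (partialSum b k 0) :=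
    ((hR i).contDiffAt (isOpen_region.mem_nhds (by rwa [partialSum_at_zero]))).differentiableAt
      (by simp)
  have hsum : DifferentiableAt ℝ (partialSum b k) 0 := by
    unfold partialSum
    fun_prop
  simpa only [Function.comp_def, partialSum_at_zero] using
    EqMod.of_differentiableAt (hRi.comp 0 hsum)

theorem eqMod_fieldAtPolynomial_succ (hR : ∀ k, ContDiffOn ℝ ∞ (R k) region)
    (hb : b 0 ∈ region) (k : ℕ) :
    EqMod (k + 2) (fun ε => fieldAtPolynomial R (k + 1) (ε, fun i => b i))
      (fun ε => partialField R k ε (partialSum b k ε) + ε ^ (k + 1) • R (k + 1) (b 0)) := by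
  simp only [fieldAtPolynomial_succ]
  exact (EqMod.refl _ _).add ((eqMod_coeff_partialSum hR hb (k + 1) k).pow_smul (k + 1))

/- Only the term `R 0` sees the last coefficient of the curve at the top order, because the other
terms carry a factor `ε`. -/
theorem eqMod_partialField_partialSum_succ (hR : ∀ k, ContDiffOn ℝ ∞ (R k) region)
    (h0 : ∀ z ∈ region, R 0 z = limitingRotoRate σ z) (hb : b 0 ∈ region) (k : ℕ) :
    EqMod (k + 2) (fun ε => partialField R (k + 1) ε (partialSum b (k + 1) ε))
      (fun ε => fieldAtPolynomial R (k + 1) (ε, fun i => b i)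
        + ε ^ (k + 1) • limitingRotoRate σ (b (k + 1))) := by
  have hL := isLinearMap_limitingRotoRate σ
  have htail := ((eqMod_partialSum_succ b k).comp_contDiffAt
    ((contDiffAt_partialField (fun i => hR (i + 1)) k 0 hb).of_le (by simp))
    (tendsto_partialSum b _) (tendsto_partialSum b _)).pow_smul 1
  rw [show 1 + (k + 1) = k + 2 by ring] at htail
  refine ((EqMod.refl (k + 2) fun ε => limitingRotoRate σ (partialSum b (k + 1) ε)).add
    htail).congr' ?_ ?_
  · filter_upwards [eventually_partialSum_mem hb (k + 1)] with ε hε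
    rw [partialField_succ', h0 _ hε]
  · filter_upwards [eventually_partialSum_mem hb k] with ε hε
    rw [fieldAtPolynomial_succ, ← partialField_succ, partialField_succ', h0 _ hε,
      partialSum_succ, hL.map_add, hL.map_smul, add_right_comm]

theorem eqMod_partialField_partialSum (hR : ∀ k, ContDiffOn ℝ ∞ (R k) region)
    (h0 : ∀ z ∈ region, R 0 z = limitingRotoRate σ z) (hb : b 0 ∈ region) (k : ℕ) :
    EqMod (k + 1) (fun ε => partialField R k ε (partialSum b k ε))
      (partialSum (fun i => limitingRotoRate σ (b i) + forcing R i b) k) := by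
  induction k with
  | zero => exact .of_eventuallyEq (.of_forall fun ε => by
      simp [partialField, forcing_zero h0, h0 _ hb])
  | succ k ih =>
    let jets := fun i => jet i (fieldAtPolynomial R (k + 1)) fun i => b i
    have hjets : EqMod (k + 2) (fun ε => fieldAtPolynomial R (k + 1) (ε, fun i => b i))
        (partialSum jets (k + 1)) := eqMod_fieldAtPolynomial hR (k + 1) hb
    have hlower : ∀ i ≤ k, jets i = limitingRotoRate σ (b i) + forcing R i b := by
      have hdrop : EqMod (k + 1) (fun ε => fieldAtPolynomial R (k + 1) (ε, fun i => b i))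
          (fun ε => partialField R k ε (partialSum b k ε)) :=
        ((eqMod_fieldAtPolynomial_succ hR hb k).mono (Nat.le_succ _)).trans
          (.of_smul continuousAt_const (.of_forall fun ε => rfl))
      exact eq_of_eqMod_partialSum ((eqMod_partialSum_succ jets k).symm.trans
        ((hjets.symm.mono (Nat.le_succ _)).trans (hdrop.trans ih)))
    refine ((eqMod_partialField_partialSum_succ hR h0 hb k).trans
      (hjets.add (.refl _ _))).trans (.of_eventuallyEq (.of_forall fun ε => ?_))
    dsimp only
    rw [partialSum_succ, partialSum_succ, partialSum_congr hlower, add_assoc, ← smul_add,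
      add_comm (limitingRotoRate σ (b (k + 1)))]
    rfl

theorem forcing_sub_forcing (hR : ∀ k, ContDiffOn ℝ ∞ (R k) region)
    (hR' : ∀ k, ContDiffOn ℝ ∞ (R' k) region) (hb : b 0 ∈ region) {k : ℕ}
    (h : ∀ i ≤ k, ∀ z ∈ region, R' i z = R i z) :
    forcing R' (k + 1) b = forcing R (k + 1) b + (R' (k + 1) (b 0) - R (k + 1) (b 0)) := by
  refine coeff_eq_add_of_eqMod (eqMod_fieldAtPolynomial hR' (k + 1) hb)
    (eqMod_fieldAtPolynomial hR (k + 1) hb) ((eqMod_fieldAtPolynomial_succ hR' hb k).trans ?_)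
  refine (((eqMod_fieldAtPolynomial_succ hR hb k).add (.refl _ fun ε : ℝ =>
    ε ^ (k + 1) • (R' (k + 1) (b 0) - R (k + 1) (b 0)))).congr' .rfl ?_).symm
  filter_upwards [eventually_partialSum_mem hb k] with ε hε
  have hfield : partialField R' k ε (partialSum b k ε) = partialField R k ε (partialSum b k ε) :=
    partialSum_congr (fun i hi => h i hi _ hε) ε
  rw [hfield, smul_sub]
  abel

theorem hasDerivAt_partialCurve (hc : ∀ k, ContDiff ℝ 1 (c k)) (k : ℕ) (ε t : ℝ) :
    HasDerivAt (partialCurve c k ε) (partialSum (fun i => deriv (c i) t) k ε) t := by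
  unfold partialCurve partialSum
  exact HasDerivAt.fun_sum fun i _ =>
    ((hc i).differentiable one_ne_zero).differentiableAt.hasDerivAt.const_smul (ε ^ i)

theorem isFormalIntegralCurve_iff (hR : ∀ k, ContDiffOn ℝ ∞ (R k) region)
    (h0 : ∀ z ∈ region, R 0 z = limitingRotoRate σ z)
    (hc : ∀ k, ContDiff ℝ 1 (c k)) (hm : ∀ t, c 0 t ∈ region) :
    IsFormalIntegralCurve R c ↔ ∀ k t, HasDerivAt (c k)
      (limitingRotoRate σ (c k t) + forcing R k (fun i => c i t)) t := by
  have hexp (k t) : EqMod (k + 1) (fun ε => partialField R k ε (partialCurve c k ε t))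
      (partialSum (fun i => limitingRotoRate σ (c i t) + forcing R i (fun i => c i t)) k) :=
    eqMod_partialField_partialSum hR h0 (b := fun i => c i t) (hm t) k
  have hderiv (k t) : (fun ε => deriv (partialCurve c k ε) t) =
      partialSum (fun i => deriv (c i) t) k :=
    funext fun ε => (hasDerivAt_partialCurve hc k ε t).deriv
  refine ⟨fun h k t => ?_, fun h => ⟨hc, hm, fun k t => ?_⟩⟩
  · have heq := (h.eqn k t).trans (hexp k t)
    rw [hderiv] at heq
    rw [← eq_of_eqMod_partialSum heq k le_rfl]
    exact ((hc k).differentiable one_ne_zero).differentiableAt.hasDerivAt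
  · rw [hderiv]
    simpa only [fun i => (h i t).deriv] using (hexp k t).symm

theorem IsFormalIntegralCurve.apply_zero (hσ : σ ^ 2 = 1)
    (hR : ∀ k, ContDiffOn ℝ ∞ (R k) region)
    (h0 : ∀ z ∈ region, R 0 z = limitingRotoRate σ z)
    (hc : IsFormalIntegralCurve R c) (t : ℝ) : c 0 t = rot σ t (c 0 0) := by
  refine congrFun (eq_of_hasDerivAt_limitingRotoRate (v := fun t => rot σ t (c 0 0)) hσ
    ((isFormalIntegralCurve_iff hR h0 hc.smooth hc.mem).1 hc 0) (fun t => ?_) (by simp)) t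
  simpa only [forcing_zero h0, rot_apply_zero] using
    hasDerivAt_rot hσ (hasDerivAt_const t (c 0 0))

theorem continuous_forcing (hR : ∀ k, ContDiffOn ℝ ∞ (R k) region) (k : ℕ)
    (hc : ∀ i < k, Continuous (c i)) (hm : ∀ t, c 0 t ∈ region) :
    Continuous (fun t => forcing R k (fun i => c i t)) :=
  (contDiffOn_jet (isExpansionDomain_polynomialDomain k)
    (contDiffOn_fieldAtPolynomial hR k) k).continuousOn.comp_continuous
    (continuous_pi fun i : Fin k => hc i i.2) fun t =>
      zero_mem_polynomialDomain k (b := fun i => c i t) (hm t)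

/-- The coefficients of the formal integral curve through `z`, by variation of constants. The
integrand is the `forcing` of order `k`, which depends on the coefficients of lower order only. -/
noncomputable def formalCurve (σ : ℝ) (R : ℕ → Phase → Phase) (z : Phase) (k : ℕ) (t : ℝ) : Phase :=
  rot σ t ((if k = 0 then z else 0) + ∫ s in (0 : ℝ)..t, rot σ (-s)
    (jet k (fieldAtPolynomial R k) (fun i : Fin k => formalCurve σ R z i s)))
termination_by k
decreasing_by exact Fin.is_lt _

theorem formalCurve_eq (σ : ℝ) (R : ℕ → Phase → Phase) (z : Phase) (k : ℕ) :
    formalCurve σ R z k = fun t => rot σ t ((if k = 0 then z else 0) +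
      ∫ s in (0 : ℝ)..t, rot σ (-s) (forcing R k (fun i => formalCurve σ R z i s))) := by
  funext t
  rw [formalCurve]
  rfl

theorem formalCurve_mem (h0 : ∀ z ∈ region, R 0 z = limitingRotoRate σ z) (hz : z ∈ region)
    (t : ℝ) : formalCurve σ R z 0 t ∈ region := by
  rw [formalCurve_eq]
  simpa only [forcing_zero h0, rot_apply_zero, intervalIntegral.integral_zero, add_zero, if_true]
    using rot_mem_region hz σ t

theorem hasDerivAt_formalCurve (hσ : σ ^ 2 = 1) {k : ℕ}
    (hf : Continuous fun t => forcing R k (fun i => formalCurve σ R z i t)) (t : ℝ) :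
    HasDerivAt (formalCurve σ R z k) (limitingRotoRate σ (formalCurve σ R z k t) +
      forcing R k (fun i => formalCurve σ R z i t)) t := by
  have hc : Continuous fun s => rot σ (-s) (forcing R k (fun i => formalCurve σ R z i s)) :=
    (contDiff_rot σ).continuous.comp (continuous_neg.prodMk hf)
  have h := hasDerivAt_rot hσ
    ((hc.integral_hasStrictDerivAt 0 t).hasDerivAt.const_add (if k = 0 then z else 0))
  rw [rot_rot_neg hσ] at h
  rwa [formalCurve_eq]

theorem contDiff_formalCurve (hσ : σ ^ 2 = 1) (hR : ∀ k, ContDiffOn ℝ ∞ (R k) region)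
    (h0 : ∀ z ∈ region, R 0 z = limitingRotoRate σ z) (hz : z ∈ region) (k : ℕ) :
    ContDiff ℝ 1 (formalCurve σ R z k) := by
  induction k using Nat.strong_induction_on with
  | _ k ih =>
    have hf := continuous_forcing hR k (fun i hi => (ih i hi).continuous) (formalCurve_mem h0 hz)
    have hd := hasDerivAt_formalCurve hσ hf
    rw [contDiff_one_iff_deriv, funext fun t => (hd t).deriv]
    have hcont : Continuous (formalCurve σ R z k) :=
      continuous_iff_continuousAt.2 fun t => (hd t).continuousAt
    exact ⟨fun t => (hd t).differentiableAt,
      ((continuous_limitingRotoRate σ).comp hcont).add hf⟩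

theorem exists_formalIntegralCurve (hσ : σ ^ 2 = 1) (hR : ∀ k, ContDiffOn ℝ ∞ (R k) region)
    (h0 : ∀ z ∈ region, R 0 z = limitingRotoRate σ z) (hz : z ∈ region) :
    ∃ c, IsFormalIntegralCurve R c ∧ c 0 0 = z ∧ ∀ k, c (k + 1) 0 = 0 := by
  have hsmooth := contDiff_formalCurve hσ hR h0 hz
  have hmem := formalCurve_mem (R := R) h0 hz
  refine ⟨formalCurve σ R z, (isFormalIntegralCurve_iff hR h0 hsmooth hmem).2 fun k =>
    hasDerivAt_formalCurve hσ (continuous_forcing hR k (fun i _ => (hsmooth i).continuous) hmem),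
    by rw [formalCurve_eq]; simp, fun k => by rw [formalCurve_eq]; simp⟩

end FormalCurves

section Lorentz

theorem fderiv_apply_eq_of_hasDerivAt {V E : Type*} [NormedAddCommGroup V] [NormedSpace ℝ V]
    [NormedAddCommGroup E] [NormedSpace ℝ E] {f : V → E} {z u : V} {d : E}
    (hf : DifferentiableAt ℝ f z) (h : HasDerivAt (fun τ : ℝ => f (z + τ • u)) d 0) :
    fderiv ℝ f z u = d := by
  rw [← hf.lineDeriv_eq_fderiv]
  exact HasLineDerivAt.lineDeriv h

theorem contDiff_field (σ : ℝ) : ContDiff ℝ ∞ (fun p : ℝ × Phase => field σ p.1 p.2) := by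
  rw [contDiff_pi]
  intro i
  fin_cases i <;>
    simp only [field, Fin.isValue, Fin.zero_eta, Fin.mk_one, Fin.reduceFinMk, Matrix.cons_val] <;>
    fun_prop

theorem differentiable_field (σ ε : ℝ) : Differentiable ℝ (field σ ε) :=
  ((contDiff_field σ).comp (contDiff_prodMk_right ε)).differentiable (by simp)

theorem hasDerivAt_line (z u : Phase) (i : Fin 4) (t : ℝ) :
    HasDerivAt (fun τ : ℝ => (z + τ • u) i) (u i) t := by
  simpa using ((hasDerivAt_id t).mul_const (u i)).const_add (z i)

theorem fderiv_field_apply (σ ε : ℝ) (z u : Phase) :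
    fderiv ℝ (field σ ε) z u = ![ε * u 2, ε * u 3, σ * (u 3 * (1 + z 1) + z 3 * u 1),
      -(σ * (u 2 * (1 + z 1) + z 2 * u 1))] := by
  refine fderiv_apply_eq_of_hasDerivAt (differentiable_field σ ε).differentiableAt ?_
  have h := fun i => hasDerivAt_line z u i 0
  rw [hasDerivAt_pi]
  intro i
  fin_cases i
  · exact (h 2).const_mul ε
  · exact (h 3).const_mul ε
  · refine (((h 3).const_mul σ).mul ((h 1).const_add 1)).congr_deriv ?_
    simp; ring
  · refine (((h 2).const_mul σ).mul ((h 1).const_add 1)).neg.congr_deriv ?_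
    simp; ring

theorem field_zero (σ : ℝ) (z : Phase) : field σ 0 z = (1 + z 1) • limitingRotoRate σ z := by
  ext i
  fin_cases i <;> simp [field, limitingRotoRate] <;> ring

theorem lieBracket_field (σ ε : ℝ) (D : Phase → Phase) (z : Phase) :
    VectorField.lieBracket ℝ D (field σ ε) z = VectorField.lieBracket ℝ D (field σ 0) z +
      ε • VectorField.lieBracket ℝ D (fun z => ![z 2, z 3, 0, 0]) z := by
  have hd : Differentiable ℝ (fun z : Phase => (![z 2, z 3, 0, 0] : Phase)) := by
    rw [differentiable_pi]
    intro i
    fin_cases i <;>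
      simp only [Fin.isValue, Fin.zero_eta, Fin.mk_one, Fin.reduceFinMk, Matrix.cons_val] <;>
      fun_prop
  have h : field σ ε = field σ 0 + ε • fun z : Phase => (![z 2, z 3, 0, 0] : Phase) := by
    ext z i
    fin_cases i <;> simp [field]
  rw [h, VectorField.lieBracket_add_right (differentiable_field σ 0).differentiableAt
    (hd.differentiableAt.const_smul ε), VectorField.lieBracket_const_smul_right
    hd.differentiableAt]

end Lorentz

section Commuting

variable {σ : ℝ} {D : Phase → Phase} {z : Phase}

theorem fderiv_limitingRotoRate_of_lieBracket_eq_zero (hz : z ∈ region)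
    (h : VectorField.lieBracket ℝ D (field σ 0) z = 0) :
    fderiv ℝ D z (limitingRotoRate σ z) =
      limitingRotoRate σ (D z) + (D z 1 / (1 + z 1)) • limitingRotoRate σ z := by
  have hpos : 0 < 1 + z 1 := neg_lt_iff_pos_add'.1 hz
  rw [VectorField.lieBracket, sub_eq_zero, field_zero, map_smul, fderiv_field_apply] at h
  rw [← inv_smul_smul₀ hpos.ne' (fderiv ℝ D z (limitingRotoRate σ z)), ← h]
  ext i
  fin_cases i <;> simp [limitingRotoRate] <;> field_simp
  ring

theorem hasDerivAt_rot_apply (hσ : σ ^ 2 = 1) (z : Phase) (t : ℝ) :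
    HasDerivAt (fun t => rot σ t z) (limitingRotoRate σ (rot σ t z)) t := by
  simpa only [rot_apply_zero, add_zero] using hasDerivAt_rot hσ (hasDerivAt_const t z)

theorem continuous_rot_apply (σ : ℝ) (z : Phase) : Continuous (fun t => rot σ t z) :=
  (contDiff_rot σ).continuous.comp (continuous_id.prodMk continuous_const)

theorem rot_neg_apply_rot_of_lieBracket_eq_zero (hσ : σ ^ 2 = 1) (hD : ContDiffOn ℝ ∞ D region)
    (h : ∀ z ∈ region, VectorField.lieBracket ℝ D (field σ 0) z = 0) (hz : z ∈ region) (t : ℝ) :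
    rot σ (-t) (D (rot σ t z)) = D z + t • (D z 1 / (1 + z 1)) • limitingRotoRate σ z := by
  have hd (s) : HasDerivAt (fun s => D (rot σ s z)) (limitingRotoRate σ (D (rot σ s z)) +
      (D (rot σ s z) 1 / (1 + z 1)) • limitingRotoRate σ (rot σ s z)) s := by
    have hm := rot_mem_region hz σ s
    have hDs : DifferentiableAt ℝ D (rot σ s z) :=
      (hD.contDiffAt (isOpen_region.mem_nhds hm)).differentiableAt (by simp)
    exact (hDs.hasFDerivAt.comp_hasDerivAt s (hasDerivAt_rot_apply hσ z s)).congr_deriv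
      (fderiv_limitingRotoRate_of_lieBracket_eq_zero hm (h _ hm))
  have hy (s) : D (rot σ s z) 1 = D z 1 := by
    have hd1 (s) : HasDerivAt (fun s => D (rot σ s z) 1) 0 s := by
      simpa [limitingRotoRate] using hasDerivAt_pi.1 (hd s) 1
    simpa using is_const_of_deriv_eq_zero (fun s => (hd1 s).differentiableAt)
      (fun s => (hd1 s).deriv) s 0
  simp only [hy, limitingRotoRate_rot] at hd
  have hc : Continuous fun s =>
      (D z 1 / (1 + z 1)) • rot σ s (limitingRotoRate σ z) :=
    (continuous_rot_apply σ _).fun_const_smul _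
  rw [rot_neg_eq_add_integral hσ hd hc]
  simp only [(isLinearMap_rot σ _).map_smul, rot_neg_rot hσ, intervalIntegral.integral_const,
    sub_zero, rot_zero]

/- The secular term of the preceding lemma vanishes because the rotation has period `2π`. -/
theorem apply_rot_of_lieBracket_eq_zero (hσ : σ ^ 2 = 1) (hD : ContDiffOn ℝ ∞ D region)
    (h : ∀ z ∈ region, VectorField.lieBracket ℝ D (field σ 0) z = 0) (hz : z ∈ region) (t : ℝ) :
    D (rot σ t z) = rot σ t (D z) := by
  have hrot := rot_neg_apply_rot_of_lieBracket_eq_zero hσ hD h hz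
  have hsecular : (D z 1 / (1 + z 1)) • limitingRotoRate σ z = 0 := by
    have hperiod := hrot (2 * Real.pi)
    have hz2 := rot_add_two_pi σ 0 z
    have hD2 := rot_add_two_pi σ (-(2 * Real.pi)) (D z)
    simp only [neg_add_cancel, rot_zero, zero_add] at hz2 hD2
    rw [hz2, ← hD2, left_eq_add] at hperiod
    exact (smul_eq_zero.1 hperiod).resolve_left Real.two_pi_pos.ne'
  have ht := hrot t
  rw [hsecular, smul_zero, add_zero] at ht
  rw [← ht, rot_rot_neg hσ]

end Commuting

section Uniqueness

variable {σ : ℝ} {R R' : ℕ → Phase → Phase} {k : ℕ} {z : Phase}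

theorem partialField_eq_add_smul (h : ∀ i < k, R' i z = R i z) (ε : ℝ) :
    partialField R' k ε z = partialField R k ε z + ε ^ k • (R' k z - R k z) := by
  simp only [partialField, partialSum, Finset.sum_range_succ, smul_sub]
  rw [Finset.sum_congr rfl fun i hi => by rw [h i (Finset.mem_range.1 hi)]]
  abel

theorem lieBracket_sub_of_forall_lt (hR : IsRotoRate σ R) (hR' : IsRotoRate σ R')
    (h : ∀ i < k, ∀ z ∈ region, R' i z = R i z) (hz : z ∈ region) :
    VectorField.lieBracket ℝ (fun z => R' k z - R k z) (field σ 0) z = 0 := by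
  set D : Phase → Phase := fun z => R' k z - R k z
  have hD : DifferentiableAt ℝ D z :=
    (((hR'.smooth k).sub (hR.smooth k)).contDiffAt (isOpen_region.mem_nhds hz)).differentiableAt
      (by simp)
  have hRz (ε) : DifferentiableAt ℝ (partialField R k ε) z :=
    ((contDiffAt_partialField hR.smooth k ε hz).differentiableAt (by simp)).comp z
      ((differentiableAt_const ε).prodMk differentiableAt_id)
  have hbracket (ε) : VectorField.lieBracket ℝ (partialField R' k ε) (field σ ε) z =
      VectorField.lieBracket ℝ (partialField R k ε) (field σ ε) z +
        ε ^ k • VectorField.lieBracket ℝ D (field σ ε) z := by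
    have he : partialField R' k ε =ᶠ[𝓝 z] partialField R k ε + ε ^ k • D := by
      filter_upwards [isOpen_region.mem_nhds hz] with p hp
      exact partialField_eq_add_smul (fun i hi => h i hi p hp) ε
    rw [← VectorField.lieBracket_const_smul_left hD,
      ← VectorField.lieBracket_add_left (hRz ε) (hD.const_smul _)]
    simp only [VectorField.lieBracket, he.fderiv_eq, he.eq_of_nhds]
  have hzero := (hR'.commutes k z hz).sub (hR.commutes k z hz)
  simp only [hbracket, add_sub_cancel_left, sub_self] at hzero
  refine eq_zero_of_eqMod_pow_smul (k := k) (EqMod.trans (EqMod.symm (.of_smul (n := k + 1)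
    (r := fun _ => VectorField.lieBracket ℝ D (fun z => ![z 2, z 3, 0, 0]) z)
    continuousAt_const (.of_forall fun ε => ?_))) hzero)
  rw [lieBracket_field, smul_add, smul_smul, pow_succ]

variable {c c' : ℕ → ℝ → Phase}

theorem IsFormalIntegralCurve.eq_of_forall_le (hσ : σ ^ 2 = 1)
    (hR : ∀ k, ContDiffOn ℝ ∞ (R k) region) (hR' : ∀ k, ContDiffOn ℝ ∞ (R' k) region)
    (h0 : ∀ z ∈ region, R 0 z = limitingRotoRate σ z)
    (h : ∀ i ≤ k, ∀ z ∈ region, R' i z = R i z) (hc : IsFormalIntegralCurve R c)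
    (hc' : IsFormalIntegralCurve R' c') (hinit : ∀ i ≤ k, c' i 0 = c i 0) :
    ∀ i ≤ k, c' i = c i := by
  have h0' : ∀ z ∈ region, R' 0 z = limitingRotoRate σ z := fun z hz =>
    (h 0 k.zero_le z hz).trans (h0 z hz)
  have e := (isFormalIntegralCurve_iff hR h0 hc.smooth hc.mem).1 hc
  have e' := (isFormalIntegralCurve_iff hR' h0' hc'.smooth hc'.mem).1 hc'
  intro i
  induction i using Nat.strong_induction_on with
  | _ i ih =>
    intro hi
    refine eq_of_hasDerivAt_limitingRotoRate hσ (e' i) (fun t => ?_) (hinit i hi)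
    rw [forcing_congr_prefix (b' := fun j => c j t)
      fun j hj => congrFun (ih j hj (hj.le.trans hi)) t]
    cases i with
    | zero => simpa only [forcing_zero h0, forcing_zero h0'] using e 0 t
    | succ i =>
      rw [forcing_sub_forcing hR hR' (hc.mem t) fun j hj => h j (hj.trans (Nat.le_of_lt hi)),
        h (i + 1) hi _ (hc.mem t), sub_self, add_zero]
      exact e (i + 1) t

theorem IsFormalIntegralCurve.hasDerivAt_sub (hR : ∀ k, ContDiffOn ℝ ∞ (R k) region)
    (hR' : ∀ k, ContDiffOn ℝ ∞ (R' k) region)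
    (h0 : ∀ z ∈ region, R 0 z = limitingRotoRate σ z)
    (h : ∀ i ≤ k, ∀ z ∈ region, R' i z = R i z) (hc : IsFormalIntegralCurve R c)
    (hc' : IsFormalIntegralCurve R' c') (heq : ∀ i ≤ k, c' i = c i) (t : ℝ) :
    HasDerivAt (fun t => c' (k + 1) t - c (k + 1) t)
      (limitingRotoRate σ (c' (k + 1) t - c (k + 1) t) +
        (R' (k + 1) (c 0 t) - R (k + 1) (c 0 t))) t := by
  have h0' : ∀ z ∈ region, R' 0 z = limitingRotoRate σ z := fun z hz =>
    (h 0 k.zero_le z hz).trans (h0 z hz)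
  refine (((isFormalIntegralCurve_iff hR' h0' hc'.smooth hc'.mem).1 hc' (k + 1) t).sub
    ((isFormalIntegralCurve_iff hR h0 hc.smooth hc.mem).1 hc (k + 1) t)).congr_deriv ?_
  rw [forcing_congr_prefix (R := R') (b' := fun j => c j t)
      fun j hj => congrFun (heq j (Nat.le_of_lt_succ hj)) t,
    forcing_sub_forcing hR hR' (hc.mem t) h, (isLinearMap_limitingRotoRate σ).map_sub]
  abel

/- The first coefficients that differ do so by a field invariant under the rotations, so that the
corresponding coefficients of the integral curves drift apart linearly in time. -/
theorem IsRotoRate.unique (hσ : σ ^ 2 = 1) (hR : IsRotoRate σ R) (hR' : IsRotoRate σ R') (k : ℕ) :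
    ∀ z ∈ region, R' k z = R k z := by
  induction k using Nat.strong_induction_on with
  | _ k ih =>
  intro z hz
  obtain _ | k := k
  · rw [hR.limit z hz, hR'.limit z hz]
  have hagree : ∀ i ≤ k, ∀ z ∈ region, R' i z = R i z := fun i hi => ih i (Nat.lt_succ_of_le hi)
  obtain ⟨c, hc, hc0, hc1⟩ := exists_formalIntegralCurve hσ hR.smooth hR.limit hz
  obtain ⟨c', hc', hc0', hc1'⟩ := exists_formalIntegralCurve hσ hR'.smooth hR'.limit hz
  have hinit : ∀ i, c' i 0 = c i 0
    | 0 => by rw [hc0, hc0']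
    | i + 1 => by rw [hc1, hc1']
  have hinvariant (t) : R' (k + 1) (c 0 t) - R (k + 1) (c 0 t) =
      rot σ t (R' (k + 1) z - R (k + 1) z) := by
    rw [hc.apply_zero hσ hR.smooth hR.limit, hc0]
    exact apply_rot_of_lieBracket_eq_zero hσ (D := fun z => R' (k + 1) z - R (k + 1) z)
      ((hR'.smooth _).sub (hR.smooth _)) (fun p hp => lieBracket_sub_of_forall_lt hR hR' ih hp) hz t
  have hderiv := hc.hasDerivAt_sub hR.smooth hR'.smooth hR.limit hagree hc'
    (hc.eq_of_forall_le hσ hR.smooth hR'.smooth hR.limit hagree hc' fun i _ => hinit i)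
  simp only [hinvariant] at hderiv
  have hdrift := rot_neg_eq_add_integral hσ hderiv (continuous_rot_apply σ _) (2 * Real.pi)
  have hperiod : c (k + 1) (2 * Real.pi) = c (k + 1) 0 := by
    simpa using hR.periodic c hc (k + 1) 0
  have hperiod' : c' (k + 1) (2 * Real.pi) = c' (k + 1) 0 := by
    simpa using hR'.periodic c' hc' (k + 1) 0
  simp only [hperiod, hperiod', hinit, sub_self, rot_apply_zero, rot_neg_rot hσ,
    intervalIntegral.integral_const, sub_zero, zero_add] at hdrift
  exact sub_eq_zero.1 ((smul_eq_zero.1 hdrift.symm).resolve_left Real.two_pi_pos.ne')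

theorem IsFormalIntegralCurve.congr (hc : IsFormalIntegralCurve R c)
    (h : ∀ k, ∀ z ∈ region, R' k z = R k z) : IsFormalIntegralCurve R' c := by
  refine ⟨hc.smooth, hc.mem, fun k t => (hc.eqn k t).trans (.of_eventuallyEq ?_)⟩
  filter_upwards [eventually_partialSum_mem (b := fun i => c i t) (hc.mem t) k] with ε hε
  exact (partialSum_congr (fun i _ => h i _ hε) ε).symm

theorem IsKruskalSeries.unique {μ μ' : ℕ → Phase → ℝ} (hσ : σ ^ 2 = 1) (hR : IsRotoRate σ R)
    (hRR' : ∀ k, ∀ z ∈ region, R' k z = R k z) (hμ : IsKruskalSeries σ R μ)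
    (hμ' : IsKruskalSeries σ R' μ') (k : ℕ) : ∀ z ∈ region, μ' k z = μ k z := by
  intro z hz
  obtain ⟨c, hc, hc0, hc1⟩ := exists_formalIntegralCurve hσ hR.smooth hR.limit hz
  exact eq_of_eqMod_partialSum
    ((hμ' z hz c (hc.congr hRR') hc0 hc1 k).symm.trans (hμ z hz c hc hc0 hc1 k)) k le_rfl

end Uniqueness

section Mean

/-- The `x`-component of the velocity, rotated by the angle `s`. -/
noncomputable def vel (z : Phase) (s : ℝ) : ℝ := z 2 * Real.cos s + z 3 * Real.sin s

/-- The `y`-component of the velocity, rotated by the angle `s`. -/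
noncomputable def velPerp (z : Phase) (s : ℝ) : ℝ := z 3 * Real.cos s - z 2 * Real.sin s

/-- The square of the magnetic field at the point with the same constants of motion as `p.2` at
which the velocity is rotated by the angle `s`, where `p.1 = ε`. -/
noncomputable def magneticSq (σ : ℝ) (p : ℝ × Phase) (s : ℝ) : ℝ :=
  (1 + p.2 1) ^ 2 + 2 * σ * p.1 * (vel p.2 s - p.2 2)

/-- The rotated velocity together with the square of the magnetic field: the point of the torus of
`p.2` at the gyro-angle `s`, without its coordinate `x`. -/
noncomputable def orbitPoint (σ : ℝ) (p : ℝ × Phase) (s : ℝ) : ℝ × ℝ × ℝ :=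
  (vel p.2 s, velPerp p.2 s, magneticSq σ p s)

/-- The set of the `(ε, z)` at which the averages over the gyro-angle are smooth: there the bound
`4 |ε| r < (1 + y)²` keeps `magneticSq` positive. -/
def smoothDomain : Set (ℝ × Phase) :=
  {p | -1 < p.2 1 ∧ 16 * p.1 ^ 2 * (p.2 2 ^ 2 + p.2 3 ^ 2) < (1 + p.2 1) ^ 4}

/-- The triples in the range of `orbitPoint` at which the magnetic field does not vanish. -/
def positiveMagneticSq : Set (ℝ × ℝ × ℝ) := {q | 0 < q.2.2}

/-- The average of `f` over the gyro-angle with the weight `w`. -/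
noncomputable def mean (σ : ℝ) (w : ℝ → ℝ) (f : ℝ × ℝ × ℝ → ℝ) (p : ℝ × Phase) : ℝ :=
  (2 * Real.pi)⁻¹ * ∫ s in (0 : ℝ)..(2 * Real.pi), w s * f (orbitPoint σ p s)

variable {σ : ℝ} {w w' : ℝ → ℝ} {f : ℝ × ℝ × ℝ → ℝ} {p : ℝ × Phase}

theorem isExpansionDomain_smoothDomain : IsExpansionDomain smoothDomain where
  isOpen := by
    have hregion : IsOpen {p : ℝ × Phase | -1 < p.2 1} := isOpen_lt (by fun_prop) (by fun_prop)
    have hsmall : IsOpen {p : ℝ × Phase |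
        16 * p.1 ^ 2 * (p.2 2 ^ 2 + p.2 3 ^ 2) < (1 + p.2 1) ^ 4} :=
      isOpen_lt (by fun_prop) (by fun_prop)
    exact hregion.inter hsmall
  smul_mem p hp s hs := by
    refine ⟨hp.1, lt_of_le_of_lt ?_ hp.2⟩
    calc 16 * (s * p.1) ^ 2 * (p.2 2 ^ 2 + p.2 3 ^ 2)
        = s ^ 2 * (16 * p.1 ^ 2 * (p.2 2 ^ 2 + p.2 3 ^ 2)) := by ring
      _ ≤ _ := mul_le_of_le_one_left (by positivity) (pow_le_one₀ hs.1 hs.2)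

theorem isOpen_smoothDomain : IsOpen smoothDomain := isExpansionDomain_smoothDomain.isOpen

theorem zero_mem_smoothDomain {z : Phase} (hz : z ∈ region) : ((0 : ℝ), z) ∈ smoothDomain := by
  have hpos : 0 < 1 + z 1 := neg_lt_iff_pos_add'.1 hz
  refine ⟨hz, ?_⟩
  rw [zero_pow two_ne_zero, mul_zero, zero_mul]
  exact pow_pos hpos 4

theorem isOpen_positiveMagneticSq : IsOpen positiveMagneticSq :=
  isOpen_lt continuous_const (by fun_prop)

theorem vel_mul_vel_add (z u : Phase) (s : ℝ) :
    vel u s * vel z s + velPerp u s * velPerp z s = z 2 * u 2 + z 3 * u 3 := by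
  simp only [vel, velPerp]
  linear_combination (z 2 * u 2 + z 3 * u 3) * Real.sin_sq_add_cos_sq s

theorem vel_sq_add_velPerp_sq (z : Phase) (s : ℝ) :
    vel z s ^ 2 + velPerp z s ^ 2 = z 2 ^ 2 + z 3 ^ 2 := by
  simpa only [sq] using vel_mul_vel_add z z s

theorem abs_magneticSq_sub_lt (hσ : σ ^ 2 = 1) (hp : p ∈ smoothDomain) (s : ℝ) :
    |2 * σ * p.1 * (vel p.2 s - p.2 2)| < (1 + p.2 1) ^ 2 := by
  refine abs_lt_of_sq_lt_sq ?_ (by positivity)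
  have hvel : (vel p.2 s - p.2 2) ^ 2 ≤ 4 * (p.2 2 ^ 2 + p.2 3 ^ 2) := by
    nlinarith [vel_sq_add_velPerp_sq p.2 s, sq_nonneg (vel p.2 s + p.2 2),
      sq_nonneg (velPerp p.2 s), sq_nonneg (p.2 3)]
  calc (2 * σ * p.1 * (vel p.2 s - p.2 2)) ^ 2
      = 4 * p.1 ^ 2 * (vel p.2 s - p.2 2) ^ 2 := by
        linear_combination (4 * p.1 ^ 2 * (vel p.2 s - p.2 2) ^ 2) * hσ
    _ ≤ 4 * p.1 ^ 2 * (4 * (p.2 2 ^ 2 + p.2 3 ^ 2)) := by gcongr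
    _ = 16 * p.1 ^ 2 * (p.2 2 ^ 2 + p.2 3 ^ 2) := by ring
    _ < (1 + p.2 1) ^ 4 := hp.2
    _ = ((1 + p.2 1) ^ 2) ^ 2 := by ring

theorem magneticSq_pos (hσ : σ ^ 2 = 1) (hp : p ∈ smoothDomain) (s : ℝ) :
    0 < magneticSq σ p s := by
  have h := (abs_lt.1 (abs_magneticSq_sub_lt hσ hp s)).1
  unfold magneticSq
  linarith

theorem orbitPoint_mem (hσ : σ ^ 2 = 1) (hp : p ∈ smoothDomain) (s : ℝ) :
    orbitPoint σ p s ∈ positiveMagneticSq := magneticSq_pos hσ hp s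

theorem orbitPoint_zero (σ : ℝ) (p : ℝ × Phase) :
    orbitPoint σ p 0 = (p.2 2, p.2 3, (1 + p.2 1) ^ 2) := by
  simp [orbitPoint, magneticSq, vel, velPerp]

theorem orbitPoint_two_pi (σ : ℝ) (p : ℝ × Phase) :
    orbitPoint σ p (2 * Real.pi) = orbitPoint σ p 0 := by
  simp [orbitPoint, magneticSq, vel, velPerp]

theorem mean_add_x (x : ℝ) (p : ℝ × Phase) :
    mean σ w f (p.1, p.2 + ![x, 0, 0, 0]) = mean σ w f p := by
  simp [mean, orbitPoint, magneticSq, vel, velPerp]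

theorem contDiff_orbitPoint (σ : ℝ) :
    ContDiff ℝ ∞ (fun q : ℝ × (ℝ × Phase) => orbitPoint σ q.2 q.1) := by
  unfold orbitPoint magneticSq vel velPerp
  fun_prop

theorem hasDerivAt_orbitPoint (σ : ℝ) (p : ℝ × Phase) (s : ℝ) :
    HasDerivAt (orbitPoint σ p)
      (velPerp p.2 s, -vel p.2 s, 2 * σ * p.1 * velPerp p.2 s) s := by
  have hv : HasDerivAt (vel p.2) (velPerp p.2 s) s := by
    refine (((Real.hasDerivAt_cos s).const_mul (p.2 2)).add
      ((Real.hasDerivAt_sin s).const_mul (p.2 3))).congr_deriv ?_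
    unfold velPerp; ring
  have hv' : HasDerivAt (velPerp p.2) (-vel p.2 s) s := by
    refine (((Real.hasDerivAt_cos s).const_mul (p.2 3)).sub
      ((Real.hasDerivAt_sin s).const_mul (p.2 2))).congr_deriv ?_
    unfold vel; ring
  exact hv.prodMk (hv'.prodMk (((hv.sub_const _).const_mul _).const_add _))

theorem hasDerivAt_orbitPoint_line (σ : ℝ) (p : ℝ × Phase) (u : Phase) (s : ℝ) :
    HasDerivAt (fun τ : ℝ => orbitPoint σ (p.1, p.2 + τ • u) s)
      (vel u s, velPerp u s, 2 * (1 + p.2 1) * u 1 + 2 * σ * p.1 * (vel u s - u 2)) 0 := by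
  have hl := fun i => hasDerivAt_line p.2 u i 0
  have hv : HasDerivAt (fun τ : ℝ => vel (p.2 + τ • u) s) (vel u s) 0 :=
    ((hl 2).mul_const _).add ((hl 3).mul_const _)
  have hv' : HasDerivAt (fun τ : ℝ => velPerp (p.2 + τ • u) s) (velPerp u s) 0 :=
    ((hl 3).mul_const _).sub ((hl 2).mul_const _)
  refine hv.prodMk (hv'.prodMk (((((hl 1).const_add 1).pow 2).add
    ((hv.sub (hl 2)).const_mul (2 * σ * p.1))).congr_deriv ?_))
  simp

theorem hasFDerivAt_orbitPoint (hσ : σ ^ 2 = 1) (hf : ContDiffOn ℝ ∞ f positiveMagneticSq)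
    (hp : p ∈ smoothDomain) (s : ℝ) :
    HasFDerivAt f (fderiv ℝ f (orbitPoint σ p s)) (orbitPoint σ p s) :=
  ((hf.contDiffAt (isOpen_positiveMagneticSq.mem_nhds (orbitPoint_mem hσ hp s))).differentiableAt
    (by simp)).hasFDerivAt

theorem continuous_comp_orbitPoint {G : Type*} [TopologicalSpace G] {g : ℝ × ℝ × ℝ → G}
    (hσ : σ ^ 2 = 1) (hg : ContinuousOn g positiveMagneticSq) (hp : p ∈ smoothDomain) :
    Continuous (fun s => g (orbitPoint σ p s)) :=
  hg.comp_continuous (continuous_iff_continuousAt.2 fun s =>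
    (hasDerivAt_orbitPoint σ p s).continuousAt) (orbitPoint_mem hσ hp)

theorem contDiffOn_meanIntegrand (hσ : σ ^ 2 = 1) (hw : ContDiff ℝ ∞ w)
    (hf : ContDiffOn ℝ ∞ f positiveMagneticSq) :
    ContDiffOn ℝ ∞ (fun q : ℝ × (ℝ × Phase) => w q.1 * f (orbitPoint σ q.2 q.1))
      {q | q.2 ∈ smoothDomain} :=
  (hw.comp contDiff_fst).contDiffOn.mul
    (hf.comp (contDiff_orbitPoint σ).contDiffOn fun q hq => orbitPoint_mem hσ hq q.1)

theorem isOpen_snd_smoothDomain : IsOpen {q : ℝ × (ℝ × Phase) | q.2 ∈ smoothDomain} :=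
  isOpen_smoothDomain.preimage continuous_snd

theorem contDiffOn_mean (hσ : σ ^ 2 = 1) (hw : ContDiff ℝ ∞ w)
    (hf : ContDiffOn ℝ ∞ f positiveMagneticSq) : ContDiffOn ℝ ∞ (mean σ w f) smoothDomain :=
  contDiffOn_const.mul (contDiffOn_parametricIntegral isOpen_snd_smoothDomain
    (contDiffOn_meanIntegrand hσ hw hf) isOpen_smoothDomain fun _ hp _ _ => hp)

theorem fderiv_parametricIntegral_apply {V E : Type u} [NormedAddCommGroup V]
    [NormedSpace ℝ V] [NormedAddCommGroup E] [NormedSpace ℝ E] {O : Set (ℝ × V)}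
    (hO : IsOpen O) {g : ℝ × V → E} (hg : ContDiffOn ℝ 1 g O) {a b : ℝ} {v : V}
    (h : ∀ s ∈ uIcc a b, (s, v) ∈ O) (u : V) :
    fderiv ℝ (fun v => ∫ s in a..b, g (s, v)) v u = ∫ s in a..b, fderiv ℝ g (s, v) (0, u) := by
  have hg' : ContinuousOn (fun p => (fderiv ℝ g p).comp (ContinuousLinearMap.inr ℝ ℝ V)) O :=
    (hg.continuousOn_fderiv_of_isOpen hO le_rfl).clm_comp continuousOn_const
  have hcont : ContinuousOn (fun s => (fderiv ℝ g (s, v)).comp (ContinuousLinearMap.inr ℝ ℝ V))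
      (uIcc a b) := hg'.comp (f := fun s : ℝ => (s, v)) (by fun_prop) h
  rw [(hasFDerivAt_parametricIntegral hO hg h).fderiv,
    ContinuousLinearMap.intervalIntegral_apply hcont.intervalIntegrable]
  simp

theorem fderiv_mean_apply (hσ : σ ^ 2 = 1) (hw : ContDiff ℝ ∞ w)
    (hf : ContDiffOn ℝ ∞ f positiveMagneticSq) (hp : p ∈ smoothDomain) (u : Phase) :
    fderiv ℝ (mean σ w f) p (0, u) = (2 * Real.pi)⁻¹ * ∫ s in (0 : ℝ)..(2 * Real.pi),
      w s * fderiv ℝ f (orbitPoint σ p s) (vel u s, velPerp u s,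
        2 * (1 + p.2 1) * u 1 + 2 * σ * p.1 * (vel u s - u 2)) := by
  have hg := (contDiffOn_meanIntegrand hσ hw hf).of_le (m := 1) (by simp)
  have hmean : fderiv ℝ (mean σ w f) p = (2 * Real.pi)⁻¹ •
      fderiv ℝ (fun p => ∫ s in (0 : ℝ)..(2 * Real.pi), w s * f (orbitPoint σ p s)) p :=
    fderiv_const_mul (hasFDerivAt_parametricIntegral isOpen_snd_smoothDomain hg
      fun _ _ => hp).differentiableAt _
  rw [hmean, smul_apply, fderiv_parametricIntegral_apply isOpen_snd_smoothDomain hg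
    (fun _ _ => hp), smul_eq_mul]
  congr 1
  refine intervalIntegral.integral_congr fun s _ => fderiv_apply_eq_of_hasDerivAt
    ((hg.contDiffAt (isOpen_snd_smoothDomain.mem_nhds hp)).differentiableAt one_ne_zero) ?_
  have hline : HasDerivAt (fun τ : ℝ => f (orbitPoint σ (p.1, p.2 + τ • u) s))
      (fderiv ℝ f (orbitPoint σ p s) (vel u s, velPerp u s,
        2 * (1 + p.2 1) * u 1 + 2 * σ * p.1 * (vel u s - u 2))) 0 :=
    (hasFDerivAt_orbitPoint hσ hf hp s).comp_hasDerivAt_of_eq 0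
      (hasDerivAt_orbitPoint_line σ p u s) (by rw [zero_smul, add_zero])
  have hp' (τ : ℝ) : p + ((0 : ℝ), τ • u) = (p.1, p.2 + τ • u) := Prod.ext (add_zero _) rfl
  simpa [hp'] using hline.const_mul (w s)

theorem integral_mul_fderiv_orbitPoint (hσ : σ ^ 2 = 1) (hw : ∀ s, HasDerivAt w (w' s) s)
    (hw' : Continuous w') (hf : ContDiffOn ℝ ∞ f positiveMagneticSq) (hp : p ∈ smoothDomain) :
    ∫ s in (0 : ℝ)..(2 * Real.pi), w s * fderiv ℝ f (orbitPoint σ p s)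
      (velPerp p.2 s, -vel p.2 s, 2 * σ * p.1 * velPerp p.2 s) =
    (w (2 * Real.pi) - w 0) * f (orbitPoint σ p 0) -
      ∫ s in (0 : ℝ)..(2 * Real.pi), w' s * f (orbitPoint σ p s) := by
  have hderiv (s) : HasDerivAt (fun s => f (orbitPoint σ p s)) (fderiv ℝ f (orbitPoint σ p s)
      (velPerp p.2 s, -vel p.2 s, 2 * σ * p.1 * velPerp p.2 s)) s :=
    (hasFDerivAt_orbitPoint hσ hf hp s).comp_hasDerivAt s (hasDerivAt_orbitPoint σ p s)
  have hcont : Continuous (fun s => fderiv ℝ f (orbitPoint σ p s)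
      (velPerp p.2 s, -vel p.2 s, 2 * σ * p.1 * velPerp p.2 s)) := by
    refine (continuous_comp_orbitPoint hσ
      (hf.continuousOn_fderiv_of_isOpen isOpen_positiveMagneticSq (by simp)) hp).clm_apply ?_
    unfold vel velPerp
    fun_prop
  rw [intervalIntegral.integral_mul_deriv_eq_deriv_mul (fun s _ => hw s) (fun s _ => hderiv s)
    (hw'.intervalIntegrable _ _) (hcont.intervalIntegrable _ _), orbitPoint_two_pi]
  ring

theorem field_one (σ ε : ℝ) (z : Phase) : field σ ε z 1 = ε * z 3 := rfl

theorem field_two (σ ε : ℝ) (z : Phase) : field σ ε z 2 = σ * z 3 * (1 + z 1) := rfl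

theorem field_three (σ ε : ℝ) (z : Phase) : field σ ε z 3 = -(σ * z 2 * (1 + z 1)) := rfl

/- The motion only shifts the gyro-angle, at the rate `σ (1 + y)`: along it, a mean changes as under
an integration by parts. -/
theorem fderiv_mean_field (hσ : σ ^ 2 = 1) (hw : ContDiff ℝ ∞ w)
    (hww' : ∀ s, HasDerivAt w (w' s) s) (hw' : Continuous w')
    (hf : ContDiffOn ℝ ∞ f positiveMagneticSq) (hp : p ∈ smoothDomain) :
    fderiv ℝ (mean σ w f) p (0, field σ p.1 p.2) = σ * (1 + p.2 1) *
      ((2 * Real.pi)⁻¹ * (w (2 * Real.pi) - w 0) * f (p.2 2, p.2 3, (1 + p.2 1) ^ 2) -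
        mean σ w' f p) := by
  have htangent (s) : (vel (field σ p.1 p.2) s, velPerp (field σ p.1 p.2) s,
      2 * (1 + p.2 1) * field σ p.1 p.2 1 +
        2 * σ * p.1 * (vel (field σ p.1 p.2) s - field σ p.1 p.2 2)) =
      (σ * (1 + p.2 1)) • (velPerp p.2 s, -vel p.2 s, 2 * σ * p.1 * velPerp p.2 s) := by
    simp only [vel, velPerp, field_one, field_two, field_three, Prod.smul_mk, smul_eq_mul,
      Prod.mk.injEq]
    refine ⟨by ring, by ring, ?_⟩
    linear_combination (-2 * p.1 * (1 + p.2 1) * p.2 3) * hσ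
  rw [fderiv_mean_apply hσ hw hf hp]
  simp only [htangent, map_smul, smul_eq_mul, mul_left_comm _ (σ * (1 + p.2 1))]
  rw [intervalIntegral.integral_const_mul, integral_mul_fderiv_orbitPoint hσ hww' hw' hf hp,
    orbitPoint_zero, mean]
  ring

theorem fderiv_mean_one_field (hσ : σ ^ 2 = 1) (hf : ContDiffOn ℝ ∞ f positiveMagneticSq)
    (hp : p ∈ smoothDomain) : fderiv ℝ (mean σ (fun _ => 1) f) p (0, field σ p.1 p.2) = 0 := by
  rw [fderiv_mean_field (w' := fun _ => 0) hσ contDiff_const (fun s => hasDerivAt_const s 1)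
    continuous_const hf hp]
  simp [mean]

theorem fderiv_mean_id_field (hσ : σ ^ 2 = 1) (hf : ContDiffOn ℝ ∞ f positiveMagneticSq)
    (hp : p ∈ smoothDomain) : fderiv ℝ (mean σ (fun s => s) f) p (0, field σ p.1 p.2) =
      σ * (1 + p.2 1) * (f (p.2 2, p.2 3, (1 + p.2 1) ^ 2) - mean σ (fun _ => 1) f p) := by
  rw [fderiv_mean_field (w := fun s => s) (w' := fun _ => 1) hσ contDiff_id hasDerivAt_id
    continuous_const hf hp]
  field_simp
  ring

theorem fderiv_mean_x (hσ : σ ^ 2 = 1) (hw : ContDiff ℝ ∞ w)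
    (hf : ContDiffOn ℝ ∞ f positiveMagneticSq) (hp : p ∈ smoothDomain) :
    fderiv ℝ (mean σ w f) p (0, ![1, 0, 0, 0]) = 0 := by
  rw [fderiv_mean_apply hσ hw hf hp]
  have hzero : ((0 : ℝ), (0 : ℝ), (0 : ℝ)) = 0 := rfl
  simp [vel, velPerp, hzero]

end Mean

section Slice

variable {E : Type*} [NormedAddCommGroup E] [NormedSpace ℝ E] {F : ℝ × Phase → E} {p : ℝ × Phase}
  {ε : ℝ} {z : Phase}

theorem differentiableAt_of_mem_smoothDomain (hF : ContDiffOn ℝ ∞ F smoothDomain)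
    (hp : p ∈ smoothDomain) : DifferentiableAt ℝ F p :=
  (hF.contDiffAt (isOpen_smoothDomain.mem_nhds hp)).differentiableAt (by simp)

theorem hasDerivAt_of_mem_smoothDomain (hF : ContDiffOn ℝ ∞ F smoothDomain)
    (hp : p ∈ smoothDomain) (u : Phase) :
    HasDerivAt (fun τ : ℝ => F (p + τ • ((0 : ℝ), u))) (fderiv ℝ F p (0, u)) 0 :=
  (differentiableAt_of_mem_smoothDomain hF hp).hasFDerivAt.hasLineDerivAt ((0 : ℝ), u)

theorem hasFDerivAt_slice (hF : DifferentiableAt ℝ F (ε, z)) :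
    HasFDerivAt (fun z => F (ε, z))
      ((fderiv ℝ F (ε, z)).comp (ContinuousLinearMap.inr ℝ ℝ Phase)) z :=
  hF.hasFDerivAt.comp z (hasFDerivAt_prodMk_right ε z)

theorem fderiv_slice (hF : DifferentiableAt ℝ F (ε, z)) (u : Phase) :
    fderiv ℝ (fun z => F (ε, z)) z u = fderiv ℝ F (ε, z) (0, u) := by
  rw [(hasFDerivAt_slice hF).fderiv]
  simp

theorem fderiv_fst_mul {c : ℝ → ℝ} {F : ℝ × Phase → ℝ} (hc : DifferentiableAt ℝ c p.1)
    (hF : DifferentiableAt ℝ F p) (u : Phase) :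
    fderiv ℝ (fun p => c p.1 * F p) p (0, u) = c p.1 * fderiv ℝ F p (0, u) := by
  have hc' := hc.hasFDerivAt.comp p (hasFDerivAt_fst (𝕜 := ℝ) (p := p))
  have h : HasFDerivAt (fun p => c p.1 * F p) _ p := hc'.mul hF.hasFDerivAt
  rw [h.fderiv]
  simp

end Slice

section ExactRotoRate

variable {σ : ℝ} {p : ℝ × Phase}

/-- The inverse of the magnetic field, as a function of the points of the form `orbitPoint`. -/
noncomputable def invField (q : ℝ × ℝ × ℝ) : ℝ := (√q.2.2)⁻¹

/-- The velocity `v_x` divided by the magnetic field, as a function of `orbitPoint`. -/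
noncomputable def velInvField (q : ℝ × ℝ × ℝ) : ℝ := q.1 * (√q.2.2)⁻¹

/-- The square `v_y²` divided by the magnetic field, as a function of `orbitPoint`. -/
noncomputable def perpSqInvField (q : ℝ × ℝ × ℝ) : ℝ := q.2.1 ^ 2 * (√q.2.2)⁻¹

/-- The velocity `v_x` times the magnetic field, as a function of `orbitPoint`. -/
noncomputable def velField (q : ℝ × ℝ × ℝ) : ℝ := q.1 * √q.2.2

theorem contDiffOn_sqrt_magneticSq :
    ContDiffOn ℝ ∞ (fun q : ℝ × ℝ × ℝ => √q.2.2) positiveMagneticSq :=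
  (contDiff_snd.snd).contDiffOn.sqrt fun _ hq => (ne_of_gt hq)

theorem contDiffOn_invField : ContDiffOn ℝ ∞ invField positiveMagneticSq :=
  contDiffOn_sqrt_magneticSq.inv fun _ hq => (Real.sqrt_pos.2 hq).ne'

theorem contDiffOn_velInvField : ContDiffOn ℝ ∞ velInvField positiveMagneticSq :=
  contDiff_fst.contDiffOn.mul contDiffOn_invField

theorem contDiffOn_perpSqInvField : ContDiffOn ℝ ∞ perpSqInvField positiveMagneticSq :=
  ((contDiff_snd.fst).pow 2).contDiffOn.mul contDiffOn_invField

theorem contDiffOn_velField : ContDiffOn ℝ ∞ velField positiveMagneticSq :=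
  contDiff_fst.contDiffOn.mul contDiffOn_sqrt_magneticSq

/-- The average over the gyro-angle of the inverse of the magnetic field. -/
noncomputable def meanInvField (σ : ℝ) (p : ℝ × Phase) : ℝ := mean σ (fun _ => 1) invField p

/-- The coefficient of `∂_x` in the roto-rate: it removes the average drift in `x`. -/
noncomputable def driftCoeff (σ : ℝ) (p : ℝ × Phase) : ℝ :=
  -p.1 * mean σ (fun _ => 1) velInvField p

/-- The action variable `J₁` as a function of `(ε, z)` which is smooth also at `ε = 0`: the
gyro-angle is measured from the velocity at `z`, so that neither `r` nor `ζ` occurs. -/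
noncomputable def smoothAction (σ : ℝ) (p : ℝ × Phase) : ℝ :=
  p.1 * σ * mean σ (fun _ => 1) velField p

/-- The roto-rate as a function of `(ε, z)`: the motion, reparametrized and with its drift in `x`
removed. Its expansion in `ε` is the formal roto-rate. -/
noncomputable def exactRotoRate (σ : ℝ) (p : ℝ × Phase) : Phase :=
  meanInvField σ p • field σ p.1 p.2 + driftCoeff σ p • ![1, 0, 0, 0]

theorem contDiffOn_meanInvField (hσ : σ ^ 2 = 1) : ContDiffOn ℝ ∞ (meanInvField σ) smoothDomain :=
  contDiffOn_mean hσ contDiff_const contDiffOn_invField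

theorem contDiffOn_driftCoeff (hσ : σ ^ 2 = 1) : ContDiffOn ℝ ∞ (driftCoeff σ) smoothDomain :=
  contDiff_fst.neg.contDiffOn.mul (contDiffOn_mean hσ contDiff_const contDiffOn_velInvField)

theorem contDiffOn_smoothAction (hσ : σ ^ 2 = 1) : ContDiffOn ℝ ∞ (smoothAction σ) smoothDomain :=
  (contDiff_fst.contDiffOn.mul contDiffOn_const).mul
    (contDiffOn_mean hσ contDiff_const contDiffOn_velField)

theorem contDiffOn_exactRotoRate (hσ : σ ^ 2 = 1) : ContDiffOn ℝ ∞ (exactRotoRate σ) smoothDomain :=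
  ((contDiffOn_meanInvField hσ).smul (contDiff_field σ).contDiffOn).add
    ((contDiffOn_driftCoeff hσ).smul contDiffOn_const)

theorem exactRotoRate_add_x (x : ℝ) (p : ℝ × Phase) :
    exactRotoRate σ (p.1, p.2 + ![x, 0, 0, 0]) = exactRotoRate σ p := by
  have : field σ p.1 (p.2 + ![x, 0, 0, 0]) = field σ p.1 p.2 := by simp [field]
  simp only [exactRotoRate, meanInvField, driftCoeff, mean_add_x, this]

theorem exactRotoRate_apply_zero (σ : ℝ) (p : ℝ × Phase) :
    exactRotoRate σ p 0 = meanInvField σ p * (p.1 * p.2 2) + driftCoeff σ p := by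
  simp [exactRotoRate, field]

theorem exactRotoRate_apply_one (σ : ℝ) (p : ℝ × Phase) :
    exactRotoRate σ p 1 = meanInvField σ p * (p.1 * p.2 3) := by
  simp [exactRotoRate, field]

theorem exactRotoRate_apply_two (σ : ℝ) (p : ℝ × Phase) :
    exactRotoRate σ p 2 = meanInvField σ p * (σ * p.2 3 * (1 + p.2 1)) := by
  simp [exactRotoRate, field]

theorem exactRotoRate_apply_three (σ : ℝ) (p : ℝ × Phase) :
    exactRotoRate σ p 3 = -(meanInvField σ p * (σ * p.2 2 * (1 + p.2 1))) := by
  simp [exactRotoRate, field]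

theorem magneticSq_zero (σ : ℝ) (z : Phase) (s : ℝ) : magneticSq σ (0, z) s = (1 + z 1) ^ 2 := by
  simp [magneticSq]

theorem sqrt_one_add_sq (hp : p ∈ smoothDomain) : √((1 + p.2 1) ^ 2) = 1 + p.2 1 :=
  Real.sqrt_sq (neg_lt_iff_pos_add'.1 hp.1).le

theorem meanInvField_pos (hσ : σ ^ 2 = 1) (hp : p ∈ smoothDomain) : 0 < meanInvField σ p := by
  unfold meanInvField mean
  refine mul_pos (inv_pos.2 Real.two_pi_pos) ?_
  refine intervalIntegral.intervalIntegral_pos_of_pos ?_ (fun s => ?_) Real.two_pi_pos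
  · exact (continuous_const.mul (continuous_comp_orbitPoint hσ contDiffOn_invField.continuousOn
      hp)).intervalIntegrable _ _
  · rw [one_mul]
    exact inv_pos.2 (Real.sqrt_pos.2 (magneticSq_pos hσ hp s))

theorem meanInvField_zero {z : Phase} (hz : z ∈ region) :
    meanInvField σ (0, z) = (1 + z 1)⁻¹ := by
  have h := sqrt_one_add_sq (zero_mem_smoothDomain hz)
  simp only [meanInvField, mean, invField, orbitPoint, magneticSq_zero, h, one_mul,
    intervalIntegral.integral_const, sub_zero, smul_eq_mul]
  exact inv_mul_cancel_left₀ Real.two_pi_pos.ne' _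

theorem exactRotoRate_zero {z : Phase} (hz : z ∈ region) :
    exactRotoRate σ (0, z) = limitingRotoRate σ z := by
  simp only [exactRotoRate, meanInvField_zero hz, driftCoeff, field_zero]
  rw [inv_smul_smul₀ (neg_lt_iff_pos_add'.1 hz).ne']
  simp

theorem fderiv_apply_exactRotoRate {F : ℝ × Phase → ℝ} :
    fderiv ℝ F p (0, exactRotoRate σ p) = meanInvField σ p * fderiv ℝ F p (0, field σ p.1 p.2) +
      driftCoeff σ p * fderiv ℝ F p (0, ![1, 0, 0, 0]) := by
  have : ((0 : ℝ), exactRotoRate σ p) = meanInvField σ p • ((0 : ℝ), field σ p.1 p.2) +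
      driftCoeff σ p • ((0 : ℝ), (![1, 0, 0, 0] : Phase)) := by
    simp [exactRotoRate]
  rw [this, map_add, map_smul, map_smul, smul_eq_mul, smul_eq_mul]

theorem fderiv_mean_one_exactRotoRate (hσ : σ ^ 2 = 1) {f : ℝ × ℝ × ℝ → ℝ}
    (hf : ContDiffOn ℝ ∞ f positiveMagneticSq) (hp : p ∈ smoothDomain) :
    fderiv ℝ (mean σ (fun _ => 1) f) p (0, exactRotoRate σ p) = 0 := by
  rw [fderiv_apply_exactRotoRate, fderiv_mean_one_field hσ hf hp,
    fderiv_mean_x hσ contDiff_const hf hp]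
  simp

theorem fderiv_mean_id_exactRotoRate (hσ : σ ^ 2 = 1) {f : ℝ × ℝ × ℝ → ℝ}
    (hf : ContDiffOn ℝ ∞ f positiveMagneticSq) (hp : p ∈ smoothDomain) :
    fderiv ℝ (mean σ (fun s => s) f) p (0, exactRotoRate σ p) = meanInvField σ p *
      (σ * (1 + p.2 1) * (f (p.2 2, p.2 3, (1 + p.2 1) ^ 2) - mean σ (fun _ => 1) f p)) := by
  rw [fderiv_apply_exactRotoRate, fderiv_mean_id_field hσ hf hp,
    fderiv_mean_x (w := fun s => s) hσ contDiff_id hf hp]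
  simp

theorem fderiv_driftCoeff (hσ : σ ^ 2 = 1) (hp : p ∈ smoothDomain) (u : Phase) :
    fderiv ℝ (driftCoeff σ) p (0, u) =
      -p.1 * fderiv ℝ (mean σ (fun _ => 1) velInvField) p (0, u) :=
  fderiv_fst_mul (c := fun ε => -ε) (by fun_prop) (differentiableAt_of_mem_smoothDomain
    (contDiffOn_mean hσ contDiff_const contDiffOn_velInvField) hp) u

theorem fderiv_smoothAction (hσ : σ ^ 2 = 1) (hp : p ∈ smoothDomain) (u : Phase) :
    fderiv ℝ (smoothAction σ) p (0, u) =
      p.1 * σ * fderiv ℝ (mean σ (fun _ => 1) velField) p (0, u) :=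
  fderiv_fst_mul (c := fun ε => ε * σ) (by fun_prop) (differentiableAt_of_mem_smoothDomain
    (contDiffOn_mean hσ contDiff_const contDiffOn_velField) hp) u

theorem lieBracket_x_field (σ ε : ℝ) (z : Phase) :
    VectorField.lieBracket ℝ (fun _ : Phase => (![1, 0, 0, 0] : Phase)) (field σ ε) z = 0 := by
  rw [VectorField.lieBracket, fderiv_field_apply]
  ext i
  fin_cases i <;> simp

theorem lieBracket_exactRotoRate (hσ : σ ^ 2 = 1) {ε : ℝ} {z : Phase} (hp : (ε, z) ∈ smoothDomain) :
    VectorField.lieBracket ℝ (fun z => exactRotoRate σ (ε, z)) (field σ ε) z = 0 := by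
  have hA := differentiableAt_of_mem_smoothDomain (contDiffOn_meanInvField hσ) hp
  have hB := differentiableAt_of_mem_smoothDomain (contDiffOn_driftCoeff hσ) hp
  have hA' := (hasFDerivAt_slice hA).differentiableAt
  have hB' := (hasFDerivAt_slice hB).differentiableAt
  have hX := (differentiable_field σ ε).differentiableAt (x := z)
  have hsum : (fun z => exactRotoRate σ (ε, z)) =
      (fun z => meanInvField σ (ε, z) • field σ ε z) +
        fun z => driftCoeff σ (ε, z) • (fun _ : Phase => (![1, 0, 0, 0] : Phase)) z := rfl
  rw [hsum, VectorField.lieBracket_add_left (hA'.fun_smul hX)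
    (hB'.fun_smul (differentiableAt_const _)),
    VectorField.lieBracket_smul_left hA' hX,
    VectorField.lieBracket_smul_left hB' (differentiableAt_const _),
    fderiv_slice hA, fderiv_slice hB, fderiv_driftCoeff hσ hp,
    show fderiv ℝ (meanInvField σ) (ε, z) (0, field σ ε z) = 0 from
      fderiv_mean_one_field hσ contDiffOn_invField hp,
    show fderiv ℝ (mean σ (fun _ => 1) velInvField) (ε, z) (0, field σ ε z) = 0 from
      fderiv_mean_one_field hσ contDiffOn_velInvField hp, lieBracket_x_field]
  simp

theorem continuous_vel (u : Phase) : Continuous (vel u) := by unfold vel; fun_prop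

theorem continuous_velPerp (u : Phase) : Continuous (velPerp u) := by unfold velPerp; fun_prop

theorem continuous_sqrt_magneticSq (hσ : σ ^ 2 = 1) (hp : p ∈ smoothDomain) :
    Continuous (fun s => √(magneticSq σ p s)) :=
  continuous_comp_orbitPoint hσ contDiffOn_sqrt_magneticSq.continuousOn hp

theorem continuous_inv_sqrt_magneticSq (hσ : σ ^ 2 = 1) (hp : p ∈ smoothDomain) :
    Continuous (fun s => (√(magneticSq σ p s))⁻¹) :=
  continuous_comp_orbitPoint hσ contDiffOn_invField.continuousOn hp

theorem differentiableAt_sqrt_magneticSq {q : ℝ × ℝ × ℝ} (hq : q ∈ positiveMagneticSq) :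
    DifferentiableAt ℝ (fun q : ℝ × ℝ × ℝ => √q.2.2) q :=
  (contDiffOn_sqrt_magneticSq.contDiffAt (isOpen_positiveMagneticSq.mem_nhds hq)).differentiableAt
    (by simp)

theorem fderiv_sqrt_magneticSq {q : ℝ × ℝ × ℝ} (hq : q ∈ positiveMagneticSq) (v : ℝ × ℝ × ℝ) :
    fderiv ℝ (fun q : ℝ × ℝ × ℝ => √q.2.2) q v = v.2.2 * (√q.2.2)⁻¹ / 2 := by
  refine fderiv_apply_eq_of_hasDerivAt (differentiableAt_sqrt_magneticSq hq) ?_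
  have h1 : HasDerivAt (fun τ : ℝ => (q + τ • v).2.2) v.2.2 0 := by
    simpa using ((hasDerivAt_id (0 : ℝ)).mul_const v.2.2).const_add q.2.2
  have hq' : (q + (0 : ℝ) • v).2.2 ≠ 0 := by simpa using (ne_of_gt hq)
  refine (h1.sqrt hq').congr_deriv ?_
  rw [zero_smul, add_zero]
  have := Real.sqrt_pos.2 hq
  field_simp

theorem fderiv_velField {q : ℝ × ℝ × ℝ} (hq : q ∈ positiveMagneticSq) (v : ℝ × ℝ × ℝ) :
    fderiv ℝ velField q v = v.1 * √q.2.2 + q.1 * (v.2.2 * (√q.2.2)⁻¹ / 2) := by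
  unfold velField
  rw [fderiv_fun_mul differentiableAt_fst (differentiableAt_sqrt_magneticSq hq), add_apply,
    smul_apply, smul_apply, fderiv_sqrt_magneticSq hq, fderiv_fst]
  simp only [smul_eq_mul, ContinuousLinearMap.coe_fst']
  ring

theorem integral_vel_mul_sqrt_magneticSq (hσ : σ ^ 2 = 1) (hp : p ∈ smoothDomain) (u : Phase) :
    ∫ s in (0 : ℝ)..(2 * Real.pi), vel u s * √(magneticSq σ p s) =
      σ * p.1 * ∫ s in (0 : ℝ)..(2 * Real.pi),
        velPerp u s * velPerp p.2 s * (√(magneticSq σ p s))⁻¹ := by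
  have hw : ∀ s, HasDerivAt (fun s => -velPerp u s) (vel u s) s := by
    intro s
    refine (((Real.hasDerivAt_cos s).const_mul (u 3)).sub
      ((Real.hasDerivAt_sin s).const_mul (u 2))).neg.congr_deriv ?_
    unfold vel; ring
  have h := integral_mul_fderiv_orbitPoint hσ hw (continuous_vel u) contDiffOn_sqrt_magneticSq hp
  have h0 : -velPerp u (2 * Real.pi) - -velPerp u 0 = 0 := by simp [velPerp]
  rw [h0, zero_mul, zero_sub, eq_neg_iff_add_eq_zero, add_comm,
    ← eq_neg_iff_add_eq_zero] at h
  refine h.trans ?_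
  rw [← intervalIntegral.integral_neg, ← intervalIntegral.integral_const_mul]
  refine intervalIntegral.integral_congr fun s _ => ?_
  have hs : orbitPoint σ p s ∈ positiveMagneticSq := magneticSq_pos hσ hp s
  simp only [fderiv_sqrt_magneticSq hs]
  simp only [orbitPoint]
  ring

theorem smoothAction_eq (hσ : σ ^ 2 = 1) (hp : p ∈ smoothDomain) :
    smoothAction σ p = p.1 ^ 2 * mean σ (fun _ => 1) perpSqInvField p := by
  have h := integral_vel_mul_sqrt_magneticSq hσ hp p.2
  simp only [smoothAction, mean, velField, perpSqInvField, orbitPoint, one_mul]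
  rw [h]
  simp only [← sq]
  linear_combination (p.1 ^ 2 * ((2 * Real.pi)⁻¹ * ∫ s in (0 : ℝ)..(2 * Real.pi),
    velPerp p.2 s ^ 2 * (√(magneticSq σ p s))⁻¹)) * hσ

theorem omega_eq (σ ε : ℝ) (z u w : Phase) :
    omega σ ε z u w = -(ε * (u 2 * w 0 - w 2 * u 0 + (u 3 * w 1 - w 3 * u 1)) -
      σ * (1 + z 1) * (u 1 * w 0 - w 1 * u 0)) := by
  have h : ∀ u w : Phase, fderiv ℝ (fun p => liouville σ ε p w) z u =
      ε * (u 2 * w 0 + u 3 * w 1) - σ * (1 + z 1) * u 1 * w 0 := by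
    intro u w
    refine fderiv_apply_eq_of_hasDerivAt ?_ ?_
    · unfold liouville; fun_prop
    · have hl := fun i => hasDerivAt_line z u i 0
      refine (((((hl 2).mul_const (w 0)).add ((hl 3).mul_const (w 1))).const_mul ε).sub
        ((((hl 1).add (((hl 1).pow 2).div_const 2)).const_mul σ).mul_const (w 0))).congr_deriv ?_
      simp only [zero_smul, add_zero]
      push_cast
      ring
  rw [omega, h, h]
  ring

theorem integral_vel_mul_vel_add (hσ : σ ^ 2 = 1) (hp : p ∈ smoothDomain) (u : Phase) :
    (∫ s in (0 : ℝ)..(2 * Real.pi), vel u s * vel p.2 s * (√(magneticSq σ p s))⁻¹) +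
      (∫ s in (0 : ℝ)..(2 * Real.pi), velPerp u s * velPerp p.2 s * (√(magneticSq σ p s))⁻¹) =
    (p.2 2 * u 2 + p.2 3 * u 3) * ∫ s in (0 : ℝ)..(2 * Real.pi), (√(magneticSq σ p s))⁻¹ := by
  have hinv := continuous_inv_sqrt_magneticSq hσ hp
  have hv : Continuous fun s => vel u s * vel p.2 s * (√(magneticSq σ p s))⁻¹ :=
    ((continuous_vel u).mul (continuous_vel _)).mul hinv
  have hv' : Continuous fun s => velPerp u s * velPerp p.2 s * (√(magneticSq σ p s))⁻¹ :=
    ((continuous_velPerp u).mul (continuous_velPerp _)).mul hinv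
  rw [← intervalIntegral.integral_add (hv.intervalIntegrable _ _) (hv'.intervalIntegrable _ _),
    ← intervalIntegral.integral_const_mul]
  refine intervalIntegral.integral_congr fun s _ => ?_
  simp only [← vel_mul_vel_add p.2 u s, add_mul]

theorem fderiv_mean_velField (hσ : σ ^ 2 = 1) (hp : p ∈ smoothDomain) (u : Phase) :
    fderiv ℝ (mean σ (fun _ => 1) velField) p (0, u) = (2 * Real.pi)⁻¹ *
      ((∫ s in (0 : ℝ)..(2 * Real.pi), vel u s * √(magneticSq σ p s)) +
      (((1 + p.2 1) * u 1 - σ * p.1 * u 2) *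
        (∫ s in (0 : ℝ)..(2 * Real.pi), vel p.2 s * (√(magneticSq σ p s))⁻¹) +
      σ * p.1 *
        ∫ s in (0 : ℝ)..(2 * Real.pi), vel u s * vel p.2 s * (√(magneticSq σ p s))⁻¹)) := by
  have hinv := continuous_inv_sqrt_magneticSq hσ hp
  have h1 : Continuous fun s => vel u s * √(magneticSq σ p s) :=
    (continuous_vel u).mul (continuous_sqrt_magneticSq hσ hp)
  have h2 : Continuous fun s => ((1 + p.2 1) * u 1 - σ * p.1 * u 2) *
      (vel p.2 s * (√(magneticSq σ p s))⁻¹) :=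
    continuous_const.mul ((continuous_vel _).mul hinv)
  have h3 : Continuous fun s => σ * p.1 * (vel u s * vel p.2 s * (√(magneticSq σ p s))⁻¹) :=
    continuous_const.mul (((continuous_vel u).mul (continuous_vel _)).mul hinv)
  rw [fderiv_mean_apply hσ contDiff_const contDiffOn_velField hp]
  congr 1
  rw [← intervalIntegral.integral_const_mul, ← intervalIntegral.integral_const_mul,
    ← intervalIntegral.integral_add (h2.intervalIntegrable _ _) (h3.intervalIntegrable _ _),
    ← intervalIntegral.integral_add (h1.intervalIntegrable _ _)
      ((h2.fun_add h3).intervalIntegrable _ _)]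
  refine intervalIntegral.integral_congr fun s _ => ?_
  simp only [fderiv_velField (orbitPoint_mem hσ hp s)]
  simp only [orbitPoint]
  ring

theorem omega_exactRotoRate (hσ : σ ^ 2 = 1) (hp : p ∈ smoothDomain) (u : Phase) :
    omega σ p.1 p.2 (exactRotoRate σ p) u = fderiv ℝ (smoothAction σ) p (0, u) := by
  have hInv : meanInvField σ p = (2 * Real.pi)⁻¹ *
      ∫ s in (0 : ℝ)..(2 * Real.pi), (√(magneticSq σ p s))⁻¹ := by
    simp only [meanInvField, mean, invField, orbitPoint, one_mul]
  have hDrift : driftCoeff σ p = -p.1 * ((2 * Real.pi)⁻¹ *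
      ∫ s in (0 : ℝ)..(2 * Real.pi), vel p.2 s * (√(magneticSq σ p s))⁻¹) := by
    simp only [driftCoeff, mean, velInvField, orbitPoint, one_mul]
  have hAdd := integral_vel_mul_vel_add hσ hp u
  rw [fderiv_smoothAction hσ hp, fderiv_mean_velField hσ hp, omega_eq, exactRotoRate_apply_zero,
    exactRotoRate_apply_one, exactRotoRate_apply_two, exactRotoRate_apply_three, hInv, hDrift,
    integral_vel_mul_sqrt_magneticSq hσ hp u]
  set V := ∫ s in (0 : ℝ)..(2 * Real.pi), vel p.2 s * (√(magneticSq σ p s))⁻¹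
  set UV := ∫ s in (0 : ℝ)..(2 * Real.pi), vel u s * vel p.2 s * (√(magneticSq σ p s))⁻¹
  set UV' := ∫ s in (0 : ℝ)..(2 * Real.pi),
    velPerp u s * velPerp p.2 s * (√(magneticSq σ p s))⁻¹
  linear_combination (-p.1 ^ 2 * (2 * Real.pi)⁻¹) * hAdd -
    (p.1 ^ 2 * (2 * Real.pi)⁻¹ * (UV + UV' - u 2 * V)) * hσ

end ExactRotoRate

section NormalForm

variable {σ : ℝ} {p : ℝ × Phase} {z d : Phase}

/-- The angle by which the velocity has to be rotated to make the roto-rate rigid. -/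
noncomputable def angleShift (σ : ℝ) (p : ℝ × Phase) : ℝ :=
  mean σ (fun s => s) invField p / meanInvField σ p

/-- The oscillation of `x` along the orbits of the roto-rate. -/
noncomputable def xShift (σ : ℝ) (p : ℝ × Phase) : ℝ :=
  -σ * (p.1 * mean σ (fun s => s) velInvField p + driftCoeff σ p * angleShift σ p)

/-- A function whose derivative along the roto-rate is the oscillating part of the kinetic term
`ε v_y dy` of the Liouville form. -/
noncomputable def actionShift (σ : ℝ) (p : ℝ × Phase) : ℝ :=
  σ * (p.1 ^ 2 * mean σ (fun s => s) perpSqInvField p - smoothAction σ p * angleShift σ p)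

/-- Coordinates in which the roto-rate is the limiting roto-rate. The second one is
`1 + 2 Y`, hence constant along the roto-rate. -/
noncomputable def normalCoords (σ : ℝ) (p : ℝ × Phase) : Phase :=
  ![p.2 0 + xShift σ p, (1 + p.2 1) ^ 2 - 2 * σ * p.1 * p.2 2, vel p.2 (angleShift σ p),
    velPerp p.2 (angleShift σ p)]

theorem contDiffOn_mean_id (hσ : σ ^ 2 = 1) {f : ℝ × ℝ × ℝ → ℝ}
    (hf : ContDiffOn ℝ ∞ f positiveMagneticSq) :
    ContDiffOn ℝ ∞ (mean σ (fun s => s) f) smoothDomain :=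
  contDiffOn_mean hσ contDiff_id hf

theorem contDiffOn_angleShift (hσ : σ ^ 2 = 1) : ContDiffOn ℝ ∞ (angleShift σ) smoothDomain :=
  (contDiffOn_mean_id hσ contDiffOn_invField).div (contDiffOn_meanInvField hσ)
    fun _ hp => (meanInvField_pos hσ hp).ne'

theorem contDiffOn_xShift (hσ : σ ^ 2 = 1) : ContDiffOn ℝ ∞ (xShift σ) smoothDomain :=
  contDiffOn_const.mul ((contDiff_fst.contDiffOn.mul
    (contDiffOn_mean_id hσ contDiffOn_velInvField)).add
    ((contDiffOn_driftCoeff hσ).mul (contDiffOn_angleShift hσ)))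

theorem contDiffOn_actionShift (hσ : σ ^ 2 = 1) : ContDiffOn ℝ ∞ (actionShift σ) smoothDomain :=
  contDiffOn_const.mul (((contDiff_fst.pow 2).contDiffOn.mul
    (contDiffOn_mean_id hσ contDiffOn_perpSqInvField)).sub
    ((contDiffOn_smoothAction hσ).mul (contDiffOn_angleShift hσ)))

theorem contDiffOn_normalCoords (hσ : σ ^ 2 = 1) :
    ContDiffOn ℝ ∞ (normalCoords σ) smoothDomain := by
  have hx := contDiffOn_xShift hσ
  have hg := contDiffOn_angleShift hσ
  have hc : ∀ i, ContDiffOn ℝ ∞ (fun p : ℝ × Phase => p.2 i) smoothDomain := fun i =>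
    ContDiff.contDiffOn (by fun_prop)
  rw [contDiffOn_pi]
  intro i
  fin_cases i
  · exact (hc 0).add hx
  · exact ContDiff.contDiffOn (f := fun p : ℝ × Phase =>
      (1 + p.2 1) ^ 2 - 2 * σ * p.1 * p.2 2) (by fun_prop)
  · exact ((hc 2).mul hg.cos).add ((hc 3).mul hg.sin)
  · exact ((hc 3).mul hg.cos).sub ((hc 2).mul hg.sin)

theorem hasDerivAt_fst_line (p : ℝ × Phase) (u : Phase) :
    HasDerivAt (fun τ : ℝ => (p + τ • ((0 : ℝ), u)).1) 0 0 := by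
  simpa using hasDerivAt_const (0 : ℝ) p.1

theorem hasDerivAt_snd_line (p : ℝ × Phase) (u : Phase) (i : Fin 4) :
    HasDerivAt (fun τ : ℝ => (p + τ • ((0 : ℝ), u)).2 i) (u i) 0 :=
  hasDerivAt_line p.2 u i 0

theorem fderiv_driftCoeff_exactRotoRate (hσ : σ ^ 2 = 1) (hp : p ∈ smoothDomain) :
    fderiv ℝ (driftCoeff σ) p (0, exactRotoRate σ p) = 0 := by
  rw [fderiv_driftCoeff hσ hp, fderiv_mean_one_exactRotoRate hσ contDiffOn_velInvField hp,
    mul_zero]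

theorem fderiv_smoothAction_exactRotoRate (hσ : σ ^ 2 = 1) (hp : p ∈ smoothDomain) :
    fderiv ℝ (smoothAction σ) p (0, exactRotoRate σ p) = 0 := by
  rw [fderiv_smoothAction hσ hp, fderiv_mean_one_exactRotoRate hσ contDiffOn_velField hp,
    mul_zero]

theorem fderiv_meanInvField_exactRotoRate (hσ : σ ^ 2 = 1) (hp : p ∈ smoothDomain) :
    fderiv ℝ (meanInvField σ) p (0, exactRotoRate σ p) = 0 :=
  fderiv_mean_one_exactRotoRate hσ contDiffOn_invField hp

theorem fderiv_angleShift (hσ : σ ^ 2 = 1) (hp : p ∈ smoothDomain) :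
    fderiv ℝ (angleShift σ) p (0, exactRotoRate σ p) =
      σ * (1 - (1 + p.2 1) * meanInvField σ p) := by
  have hA := (meanInvField_pos hσ hp).ne'
  have hy : 0 < 1 + p.2 1 := neg_lt_iff_pos_add'.1 hp.1
  refine fderiv_apply_eq_of_hasDerivAt
    (differentiableAt_of_mem_smoothDomain (contDiffOn_angleShift hσ) hp) ?_
  have hnum := hasDerivAt_of_mem_smoothDomain (contDiffOn_mean_id hσ contDiffOn_invField) hp
    (exactRotoRate σ p)
  have hden := hasDerivAt_of_mem_smoothDomain (contDiffOn_meanInvField hσ) hp (exactRotoRate σ p)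
  rw [fderiv_mean_id_exactRotoRate hσ contDiffOn_invField hp, invField, sqrt_one_add_sq hp,
    ← meanInvField] at hnum
  rw [fderiv_meanInvField_exactRotoRate hσ hp] at hden
  refine (hnum.div hden (by simpa using hA)).congr_deriv ?_
  simp only [zero_smul, add_zero, mul_zero, sub_zero]
  field_simp

theorem fderiv_xShift (hσ : σ ^ 2 = 1) (hp : p ∈ smoothDomain) :
    fderiv ℝ (xShift σ) p (0, exactRotoRate σ p) =
      -(meanInvField σ p * (p.1 * p.2 2) + driftCoeff σ p) := by
  have hy : 0 < 1 + p.2 1 := neg_lt_iff_pos_add'.1 hp.1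
  refine fderiv_apply_eq_of_hasDerivAt
    (differentiableAt_of_mem_smoothDomain (contDiffOn_xShift hσ) hp) ?_
  have hε := hasDerivAt_fst_line p (exactRotoRate σ p)
  have hvel := hasDerivAt_of_mem_smoothDomain (contDiffOn_mean_id hσ contDiffOn_velInvField) hp
    (exactRotoRate σ p)
  have hdrift := hasDerivAt_of_mem_smoothDomain (contDiffOn_driftCoeff hσ) hp (exactRotoRate σ p)
  have hangle := hasDerivAt_of_mem_smoothDomain (contDiffOn_angleShift hσ) hp (exactRotoRate σ p)
  rw [fderiv_mean_id_exactRotoRate hσ contDiffOn_velInvField hp, velInvField,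
    sqrt_one_add_sq hp] at hvel
  rw [fderiv_driftCoeff_exactRotoRate hσ hp] at hdrift
  rw [fderiv_angleShift hσ hp] at hangle
  refine (((hε.mul hvel).add (hdrift.mul hangle)).const_mul (-σ)).congr_deriv ?_
  simp only [zero_smul, add_zero, zero_mul, zero_add, driftCoeff]
  field_simp
  linear_combination
    (p.1 * mean σ (fun _ => 1) velInvField p - meanInvField σ p * p.1 * p.2 2) * hσ

theorem fderiv_actionShift (hσ : σ ^ 2 = 1) (hp : p ∈ smoothDomain) :
    fderiv ℝ (actionShift σ) p (0, exactRotoRate σ p) =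
      meanInvField σ p * (p.1 * p.2 3) ^ 2 - smoothAction σ p := by
  have hy : 0 < 1 + p.2 1 := neg_lt_iff_pos_add'.1 hp.1
  refine fderiv_apply_eq_of_hasDerivAt
    (differentiableAt_of_mem_smoothDomain (contDiffOn_actionShift hσ) hp) ?_
  have hε := hasDerivAt_fst_line p (exactRotoRate σ p)
  have hperp := hasDerivAt_of_mem_smoothDomain (contDiffOn_mean_id hσ contDiffOn_perpSqInvField)
    hp (exactRotoRate σ p)
  have haction := hasDerivAt_of_mem_smoothDomain (contDiffOn_smoothAction hσ) hp
    (exactRotoRate σ p)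
  have hangle := hasDerivAt_of_mem_smoothDomain (contDiffOn_angleShift hσ) hp (exactRotoRate σ p)
  rw [fderiv_mean_id_exactRotoRate hσ contDiffOn_perpSqInvField hp, perpSqInvField,
    sqrt_one_add_sq hp] at hperp
  rw [fderiv_smoothAction_exactRotoRate hσ hp] at haction
  rw [fderiv_angleShift hσ hp] at hangle
  refine ((((hε.pow 2).mul hperp).sub (haction.mul hangle)).const_mul σ).congr_deriv ?_
  simp only [zero_smul, add_zero, mul_zero, zero_mul, zero_add, Pi.pow_apply]
  rw [smoothAction_eq hσ hp]
  field_simp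
  linear_combination (meanInvField σ p * p.1 ^ 2 * p.2 3 ^ 2 -
    p.1 ^ 2 * mean σ (fun _ => 1) perpSqInvField p) * hσ

theorem fderiv_normalCoords (hσ : σ ^ 2 = 1) (hp : p ∈ smoothDomain) :
    fderiv ℝ (normalCoords σ) p (0, exactRotoRate σ p) =
      limitingRotoRate σ (normalCoords σ p) := by
  refine fderiv_apply_eq_of_hasDerivAt
    (differentiableAt_of_mem_smoothDomain (contDiffOn_normalCoords hσ) hp) ?_
  have hε := hasDerivAt_fst_line p (exactRotoRate σ p)
  have hl := hasDerivAt_snd_line p (exactRotoRate σ p)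
  have hx := hasDerivAt_of_mem_smoothDomain (contDiffOn_xShift hσ) hp (exactRotoRate σ p)
  have hg := hasDerivAt_of_mem_smoothDomain (contDiffOn_angleShift hσ) hp (exactRotoRate σ p)
  rw [fderiv_xShift hσ hp] at hx
  rw [fderiv_angleShift hσ hp] at hg
  rw [hasDerivAt_pi]
  intro i
  fin_cases i
  · refine ((hl 0).add hx).congr_deriv ?_
    simp [limitingRotoRate, exactRotoRate_apply_zero]
  · refine ((((hl 1).const_add 1).pow 2).sub ((hε.const_mul (2 * σ)).mul (hl 2))).congr_deriv ?_
    simp only [zero_smul, add_zero, mul_zero, zero_mul, zero_add, exactRotoRate_apply_one,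
      exactRotoRate_apply_two, limitingRotoRate, Fin.mk_one, Fin.isValue, Matrix.cons_val]
    linear_combination (-2 * p.1 * meanInvField σ p * p.2 3 * (1 + p.2 1)) * hσ
  · refine (((hl 2).mul hg.cos).add ((hl 3).mul hg.sin)).congr_deriv ?_
    simp [limitingRotoRate, exactRotoRate_apply_two, exactRotoRate_apply_three, normalCoords,
      velPerp]
    ring
  · refine (((hl 3).mul hg.cos).sub ((hl 2).mul hg.sin)).congr_deriv ?_
    simp [limitingRotoRate, exactRotoRate_apply_two, exactRotoRate_apply_three, normalCoords, vel]
    ring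

theorem normalCoords_zero (hz : z ∈ region) :
    normalCoords σ (0, z) = ![z 0, (1 + z 1) ^ 2, -z 2, -z 3] := by
  have hy : 0 < 1 + z 1 := neg_lt_iff_pos_add'.1 hz
  have hangle : angleShift σ (0, z) = Real.pi := by
    simp only [angleShift, meanInvField_zero hz, mean, invField, orbitPoint, magneticSq_zero,
      sqrt_one_add_sq (zero_mem_smoothDomain hz)]
    rw [intervalIntegral.integral_mul_const, integral_id]
    field_simp
    ring
  ext i
  fin_cases i <;> simp [normalCoords, hangle, xShift, driftCoeff, vel, velPerp]

theorem fderiv_normalCoords_zero (hσ : σ ^ 2 = 1) (hz : z ∈ region) (d : Phase) :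
    fderiv ℝ (normalCoords σ) (0, z) (0, d) = ![d 0, 2 * (1 + z 1) * d 1, -d 2, -d 3] := by
  have hdiff := differentiableAt_of_mem_smoothDomain (contDiffOn_normalCoords hσ)
    (zero_mem_smoothDomain hz)
  have heq : (fun z => normalCoords σ (0, z)) =ᶠ[𝓝 z]
      fun z : Phase => ![z 0, (1 + z 1) ^ 2, -z 2, -z 3] := by
    filter_upwards [isOpen_region.mem_nhds hz] with w hw using normalCoords_zero hw
  rw [← fderiv_slice hdiff, heq.fderiv_eq]
  refine fderiv_apply_eq_of_hasDerivAt
    (heq.differentiableAt_iff.1 (hasFDerivAt_slice hdiff).differentiableAt) (hasDerivAt_pi.2 ?_)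
  have hline := fun i => hasDerivAt_line z d i 0
  intro i
  fin_cases i
  · exact hline 0
  · exact (((hline 1).const_add 1).pow 2).congr_deriv (by simp)
  · exact (hline 2).neg
  · exact (hline 3).neg

theorem eq_zero_of_fderiv_normalCoords (hσ : σ ^ 2 = 1) (hz : z ∈ region)
    (h : fderiv ℝ (normalCoords σ) (0, z) (0, d) = 0) : d = 0 := by
  have hy : 0 < 1 + z 1 := neg_lt_iff_pos_add'.1 hz
  rw [fderiv_normalCoords_zero hσ hz] at h
  ext i
  have hi := congrFun h i
  fin_cases i <;> simpa [hy.ne'] using hi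

end NormalForm

section Uniform

theorem isBigO_one_nhds_prod_principal {X Y E : Type*} [TopologicalSpace X] [TopologicalSpace Y]
    [SeminormedAddCommGroup E] {g : Y × X → E} {K : Set X} (hK : IsCompact K) {y₀ : Y}
    (hg : ∀ x ∈ K, ContinuousAt g (y₀, x)) : g =O[𝓝 y₀ ×ˢ 𝓟 K] fun _ => (1 : ℝ) := by
  obtain ⟨M, hM⟩ := exists_eventually_forall_norm_le (g := fun q : X × Y => g q.swap) hK
    fun x hx => (hg x hx).comp (f := Prod.swap) continuous_swap.continuousAt
  exact .of_bound M (eventually_prod_principal_iff.2 (by simpa using hM))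

theorem isBigO_sub_of_hasDerivAt {X E : Type*} [NormedAddCommGroup E] [NormedSpace ℝ E]
    {l : Filter X} {a b : ℝ} {f f' : X × ℝ → E} {g : X → ℝ}
    (hf : ∀ᶠ q in l ×ˢ 𝓟 (Icc a b), HasDerivAt (fun t => f (q.1, t)) (f' q) q.2)
    (hf' : f' =O[l ×ˢ 𝓟 (Icc a b)] fun q => g q.1) :
    (fun q => f q - f (q.1, a)) =O[l ×ˢ 𝓟 (Icc a b)] fun q => g q.1 := by
  obtain ⟨C, hC⟩ := hf'.bound
  refine .of_bound (C * (b - a)) (eventually_prod_principal_iff.2 ?_)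
  filter_upwards [eventually_prod_principal_iff.1 (hf.and hC)] with x hx t ht
  have hab : a ≤ b := ht.1.trans ht.2
  have hnonneg : 0 ≤ C * ‖g x‖ := (norm_nonneg _).trans (hx a (left_mem_Icc.2 hab)).2
  calc ‖f (x, t) - f (x, a)‖ ≤ C * ‖g x‖ * ‖t - a‖ :=
        (convex_Icc a b).norm_image_sub_le_of_norm_hasDerivWithin_le
          (fun s hs => (hx s hs).1.hasDerivWithinAt) (fun s hs => (hx s hs).2)
          (left_mem_Icc.2 hab) ht
    _ ≤ C * ‖g x‖ * (b - a) := by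
        rw [Real.norm_of_nonneg (sub_nonneg.2 ht.1)]
        gcongr
        exact ht.2
    _ = C * (b - a) * ‖g x‖ := by ring

/- The coefficients range over a compact set, and the difference of the two sides is smooth in `ε`
and the coefficients. -/
theorem isBigO_partialSum_sub_comp {T : Type*} {E G : Type u} [TopologicalSpace T]
    [NormedAddCommGroup E] [NormedSpace ℝ E] [NormedAddCommGroup G]
    [NormedSpace ℝ G] [CompleteSpace G] {F : ℝ × E → G} {O : Set (ℝ × E)} (hO : IsOpen O)
    (hF : ContDiffOn ℝ ∞ F O) {K : Set T} (hK : IsCompact K) {a : ℕ → T → E} {b : ℕ → T → G}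
    (ha : ∀ i, Continuous (a i)) (hb : ∀ i, Continuous (b i))
    (hmem : ∀ t ∈ K, ((0 : ℝ), a 0 t) ∈ O) {k n : ℕ}
    (h : ∀ t ∈ K, EqMod (n + 1) (partialSum (fun i => b i t) k)
      fun ε => F (ε, partialSum (fun i => a i t) k ε)) :
    (fun q : ℝ × T => partialSum (fun i => b i q.2) k q.1 -
      F (q.1, partialSum (fun i => a i q.2) k q.1)) =O[𝓝 0 ×ˢ 𝓟 K] fun q => q.1 ^ (n + 1) := by
  let evalF : ℝ × (Fin (k + 1) → E) × (Fin (k + 1) → G) → ℝ × E := fun q =>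
    (q.1, ∑ i : Fin (k + 1), q.1 ^ (i : ℕ) • q.2.1 i)
  let defect : ℝ × (Fin (k + 1) → E) × (Fin (k + 1) → G) → G := fun q =>
    ∑ i : Fin (k + 1), q.1 ^ (i : ℕ) • q.2.2 i - F (evalF q)
  let coeff : T → (Fin (k + 1) → E) × (Fin (k + 1) → G) := fun t => (fun i => a i t, fun i => b i t)
  have hevalF : ContDiff ℝ ∞ evalF := by fun_prop
  have hopen : IsOpen (evalF ⁻¹' O) := hO.preimage hevalF.continuous
  have hdefect : ContDiffOn ℝ ∞ defect (starCore (evalF ⁻¹' O)) :=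
    (ContDiff.contDiffOn (by fun_prop)).sub
      (hF.comp hevalF.contDiffOn (starCore_subset _))
  have hevalF_coeff (ε : ℝ) (t : T) :
      evalF (ε, coeff t) = (ε, partialSum (fun i => a i t) k ε) := by
    simp only [evalF, coeff, partialSum,
      Fin.sum_univ_eq_sum_range (fun i => ε ^ i • a i t) (k + 1)]
  have hdefect_coeff (ε : ℝ) (t : T) : defect (ε, coeff t) =
      partialSum (fun i => b i t) k ε - F (ε, partialSum (fun i => a i t) k ε) := by
    simp only [defect, hevalF_coeff]
    simp only [coeff, partialSum, Fin.sum_univ_eq_sum_range (fun i => ε ^ i • b i t) (k + 1)]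
  have hcoeff : Continuous coeff := by fun_prop
  obtain ⟨C, hC⟩ := exists_bound_of_eqMod (k := n) (isExpansionDomain_starCore hopen) hdefect
    (hK.image hcoeff)
    (forall_mem_image.2 fun t ht => zero_mem_starCore (by
      simpa [hevalF_coeff, partialSum_at_zero] using hmem t ht))
    (forall_mem_image.2 fun t ht => by simpa [EqMod, hdefect_coeff] using h t ht)
  refine .of_bound C (eventually_prod_principal_iff.2 (hC.mono fun ε hε t ht => ?_))
  simpa [hdefect_coeff] using hε _ (mem_image_of_mem coeff ht)

theorem isBigO_clm_apply {X E F : Type*} [NormedAddCommGroup E] [NormedSpace ℝ E]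
    [NormedAddCommGroup F] [NormedSpace ℝ F] {l : Filter X} {L : X → E →L[ℝ] F} {v : X → E}
    {g : X → ℝ} (hL : L =O[l] fun _ => (1 : ℝ)) (hv : v =O[l] g) : (fun x => L x (v x)) =O[l] g :=
  (IsBigO.of_norm_le fun x => (L x).le_opNorm (v x)).trans
    (by simpa using hL.norm_left.mul hv.norm_left)

/- Two curves that agree up to order `k` and whose images under `F` agree up to order `k + 1` differ
in order `k + 1` by an element of the kernel of the derivative. -/
theorem apply_eq_zero_of_eqMod {P E : Type*} [NormedAddCommGroup P]
    [NormedSpace ℝ P] [NormedAddCommGroup E] [NormedSpace ℝ E] {F : ℝ × P → E}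
    {L : ℝ × P →L[ℝ] E} {z d : P} {u : ℝ → P} {k : ℕ} (hF : HasStrictFDerivAt F L (0, z))
    (hu : Tendsto u (𝓝 0) (𝓝 z))
    (h : EqMod (k + 2) (fun ε => F (ε, u ε + ε ^ (k + 1) • d)) fun ε => F (ε, u ε)) :
    L (0, d) = 0 := by
  have hpow : (fun ε : ℝ => ε ^ (k + 1) • ((0 : ℝ), d)) =O[𝓝 0] fun ε : ℝ => ε ^ (k + 1) := by
    simpa using (isBigO_refl (fun ε : ℝ => ε ^ (k + 1)) (𝓝 0)).smul
      (isBigO_const_const ((0 : ℝ), d) (one_ne_zero (α := ℝ)) (𝓝 0))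
  have hv : Tendsto (fun ε => u ε + ε ^ (k + 1) • d) (𝓝 0) (𝓝 z) := by
    simpa using hu.add (Continuous.tendsto' (by fun_prop) 0 (0 : P) (by simp) :
      Tendsto (fun ε : ℝ => ε ^ (k + 1) • d) (𝓝 0) (𝓝 0))
  have hlin : (fun ε => F (ε, u ε + ε ^ (k + 1) • d) - F (ε, u ε) - ε ^ (k + 1) • L (0, d))
      =o[𝓝 0] fun ε : ℝ => ε ^ (k + 1) := by
    refine IsLittleO.trans_isBigO ?_ hpow
    simpa only [Function.comp_def, id, Prod.mk_sub_mk, sub_self, add_sub_cancel_left, ← map_smul,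
      Prod.smul_mk, smul_zero] using hF.isLittleO.comp_tendsto
        ((tendsto_id.prodMk_nhds hv).prodMk_nhds (tendsto_id.prodMk_nhds hu))
  have hzero : (fun ε : ℝ => ε ^ (k + 1) • L (0, d)) =o[𝓝[≠] 0] fun ε : ℝ => ε ^ (k + 1) := by
    refine (((h.trans_isLittleO (isLittleO_pow_pow (Nat.lt_succ_self (k + 1)))).sub
      hlin).congr_left fun ε => ?_).mono nhdsWithin_le_nhds
    abel
  have hconst : (fun _ : ℝ => L (0, d)) =o[𝓝[≠] 0] fun _ : ℝ => (1 : ℝ) := by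
    refine ((isBigO_refl (fun ε : ℝ => (ε ^ (k + 1))⁻¹) (𝓝[≠] 0)).smul_isLittleO hzero).congr'
      ?_ ?_ <;>
    · filter_upwards [self_mem_nhdsWithin] with ε hε
      simp [smul_smul, pow_ne_zero (k + 1) hε]
  exact tendsto_const_nhds_iff.1 ((isLittleO_one_iff ℝ).1 hconst)

end Uniform

section AlongCurves

variable {σ : ℝ}

/-- The coefficients of the roto-rate, the Taylor coefficients in `ε` of the exact roto-rate. -/
noncomputable def rotoRate (σ : ℝ) (k : ℕ) (z : Phase) : Phase := jet k (exactRotoRate σ) z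

/-- The coefficients of the adiabatic invariant series, the Taylor coefficients in `ε` of the
smooth action. -/
noncomputable def actionSeries (σ : ℝ) (k : ℕ) (z : Phase) : ℝ := jet k (smoothAction σ) z

theorem contDiffOn_rotoRate (hσ : σ ^ 2 = 1) (k : ℕ) : ContDiffOn ℝ ∞ (rotoRate σ k) region :=
  (contDiffOn_jet isExpansionDomain_smoothDomain (contDiffOn_exactRotoRate hσ) k).mono
    fun _ hz => zero_mem_smoothDomain hz

theorem contDiffOn_actionSeries (hσ : σ ^ 2 = 1) (k : ℕ) :
    ContDiffOn ℝ ∞ (actionSeries σ k) region :=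
  (contDiffOn_jet isExpansionDomain_smoothDomain (contDiffOn_smoothAction hσ) k).mono
    fun _ hz => zero_mem_smoothDomain hz

theorem rotoRate_zero {z : Phase} (hz : z ∈ region) : rotoRate σ 0 z = limitingRotoRate σ z :=
  exactRotoRate_zero hz

theorem exactRotoRate_eq_partialField (hσ : σ ^ 2 = 1) (k : ℕ) {p : ℝ × Phase}
    (hp : p ∈ smoothDomain) : exactRotoRate σ p = partialField (rotoRate σ) k p.1 p.2 +
      p.1 ^ (k + 1) • hadamard^[k + 1] (exactRotoRate σ) p :=
  eq_partialSum_jet isExpansionDomain_smoothDomain (contDiffOn_exactRotoRate hσ) k hp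

theorem smoothAction_eq_partialSum (hσ : σ ^ 2 = 1) (k : ℕ) {p : ℝ × Phase}
    (hp : p ∈ smoothDomain) : smoothAction σ p = partialSum (fun i => actionSeries σ i p.2) k p.1 +
      p.1 ^ (k + 1) • hadamard^[k + 1] (smoothAction σ) p :=
  eq_partialSum_jet isExpansionDomain_smoothDomain (contDiffOn_smoothAction hσ) k hp

theorem eqMod_exactRotoRate_comp (hσ : σ ^ 2 = 1) {u : ℝ → Phase} (h0 : u 0 ∈ region)
    (hu : ContinuousAt u 0) (k : ℕ) :
    EqMod (k + 1) (fun ε => exactRotoRate σ (ε, u ε))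
      fun ε => partialField (rotoRate σ) k ε (u ε) := by
  have hpair : ContinuousAt (fun ε => (ε, u ε)) 0 := continuousAt_id.prodMk hu
  refine .of_smul (r := fun ε => hadamard^[k + 1] (exactRotoRate σ) (ε, u ε))
    ((continuousAt_iterate_hadamard isExpansionDomain_smoothDomain (contDiffOn_exactRotoRate hσ)
      (k + 1) (zero_mem_smoothDomain h0)).comp (f := fun ε => (ε, u ε)) hpair) ?_
  filter_upwards [hpair.eventually (isOpen_smoothDomain.mem_nhds (zero_mem_smoothDomain h0))]
    with ε hε using exactRotoRate_eq_partialField hσ k hε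

variable {c : ℕ → ℝ → Phase} {S : Set ℝ}

theorem partialCurve_zero (c : ℕ → ℝ → Phase) (k : ℕ) (t : ℝ) : partialCurve c k 0 t = c 0 t :=
  partialSum_at_zero (fun i => c i t) k

theorem continuous_partialCurve (hc : ∀ i, Continuous (c i)) (k : ℕ) :
    Continuous (fun q : ℝ × ℝ => partialCurve c k q.1 q.2) := by
  unfold partialCurve partialSum
  fun_prop

theorem IsFormalIntegralCurve.continuous {R : ℕ → Phase → Phase} (hc : IsFormalIntegralCurve R c)
    (i : ℕ) : Continuous (c i) :=
  (hc.smooth i).continuous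

theorem IsFormalIntegralCurve.continuous_deriv {R : ℕ → Phase → Phase}
    (hc : IsFormalIntegralCurve R c) (i : ℕ) : Continuous (deriv (c i)) :=
  (hc.smooth i).continuous_deriv le_rfl

theorem zero_partialCurve_mem_smoothDomain {R : ℕ → Phase → Phase}
    (hc : IsFormalIntegralCurve R c) (k : ℕ) (t : ℝ) :
    ((0 : ℝ), partialCurve c k 0 t) ∈ smoothDomain := by
  rw [partialCurve_zero]
  exact zero_mem_smoothDomain (hc.mem t)

theorem eventually_partialCurve_mem_smoothDomain {R : ℕ → Phase → Phase}
    (hc : IsFormalIntegralCurve R c) (hS : IsCompact S) (k : ℕ) :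
    ∀ᶠ q in 𝓝 0 ×ˢ 𝓟 S, (q.1, partialCurve c k q.1 q.2) ∈ smoothDomain :=
  eventually_prod_principal_iff.2 (hS.eventually_forall_of_forall_eventually fun t _ =>
    (continuous_fst.prodMk (continuous_partialCurve hc.continuous k)).continuousAt.eventually
      (isOpen_smoothDomain.mem_nhds (zero_partialCurve_mem_smoothDomain hc k t)))

theorem isBigO_one_comp_partialCurve {E : Type*} [NormedAddCommGroup E] {F : ℝ × Phase → E}
    {R : ℕ → Phase → Phase} (hc : IsFormalIntegralCurve R c) (hS : IsCompact S) (k : ℕ)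
    (hF : ContinuousOn F smoothDomain) :
    (fun q : ℝ × ℝ => F (q.1, partialCurve c k q.1 q.2)) =O[𝓝 0 ×ˢ 𝓟 S] fun _ => (1 : ℝ) :=
  isBigO_one_nhds_prod_principal hS fun t _ => ContinuousAt.comp (g := F)
    (hF.continuousAt (isOpen_smoothDomain.mem_nhds (zero_partialCurve_mem_smoothDomain hc k t)))
    (continuous_fst.prodMk (continuous_partialCurve hc.continuous k)).continuousAt

theorem isBigO_deriv_partialCurve_sub (hσ : σ ^ 2 = 1) (hc : IsFormalIntegralCurve (rotoRate σ) c)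
    (hS : IsCompact S) (k : ℕ) :
    (fun q : ℝ × ℝ => partialCurve (fun i => deriv (c i)) k q.1 q.2 -
      exactRotoRate σ (q.1, partialCurve c k q.1 q.2)) =O[𝓝 0 ×ˢ 𝓟 S] fun q => q.1 ^ (k + 1) := by
  refine isBigO_partialSum_sub_comp isOpen_smoothDomain (contDiffOn_exactRotoRate hσ) hS
    hc.continuous hc.continuous_deriv (fun t _ => zero_mem_smoothDomain (hc.mem t)) fun t _ => ?_
  have hexact := eqMod_exactRotoRate_comp hσ (u := partialSum (fun i => c i t) k)
    (by simpa only [partialSum_at_zero] using hc.mem t) (continuous_partialSum _ k).continuousAt k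
  have heqn := hc.eqn k t
  simp only [(hasDerivAt_partialCurve hc.smooth k _ t).deriv] at heqn
  exact heqn.trans hexact.symm

section Comp

variable {E : Type*} [NormedAddCommGroup E] [NormedSpace ℝ E] {F : ℝ × Phase → E}

theorem hasDerivAt_comp_partialCurve (hF : ContDiffOn ℝ ∞ F smoothDomain)
    (hc : ∀ i, ContDiff ℝ 1 (c i)) {k : ℕ} {q : ℝ × ℝ}
    (hq : (q.1, partialCurve c k q.1 q.2) ∈ smoothDomain) :
    HasDerivAt (fun t => F (q.1, partialCurve c k q.1 t))
      (fderiv ℝ F (q.1, partialCurve c k q.1 q.2)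
        (0, partialCurve (fun i => deriv (c i)) k q.1 q.2)) q.2 :=
  (differentiableAt_of_mem_smoothDomain hF hq).hasFDerivAt.comp_hasDerivAt q.2
    ((hasDerivAt_const q.2 q.1).prodMk (hasDerivAt_partialCurve hc k q.1 q.2))

theorem isBigO_fderiv_partialCurve_sub (hσ : σ ^ 2 = 1)
    (hc : IsFormalIntegralCurve (rotoRate σ) c) (hS : IsCompact S) (k : ℕ)
    (hF : ContDiffOn ℝ ∞ F smoothDomain) :
    (fun q : ℝ × ℝ =>
      fderiv ℝ F (q.1, partialCurve c k q.1 q.2)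
          (0, partialCurve (fun i => deriv (c i)) k q.1 q.2) -
        fderiv ℝ F (q.1, partialCurve c k q.1 q.2)
          (0, exactRotoRate σ (q.1, partialCurve c k q.1 q.2)))
      =O[𝓝 0 ×ˢ 𝓟 S] fun q => q.1 ^ (k + 1) := by
  have hbound := isBigO_one_comp_partialCurve hc hS k
    (hF.continuousOn_fderiv_of_isOpen isOpen_smoothDomain (by simp))
  refine (isBigO_clm_apply hbound ((isBigO_zero (fun q : ℝ × ℝ => q.1 ^ (k + 1)) _).prod_left
    (isBigO_deriv_partialCurve_sub hσ hc hS k))).congr_left fun q => ?_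
  rw [← map_sub, Prod.mk_sub_mk, sub_zero]

theorem isBigO_partialCurve_sub_of_invariant (hσ : σ ^ 2 = 1)
    (hc : IsFormalIntegralCurve (rotoRate σ) c) (k : ℕ) (T : ℝ)
    (hF : ContDiffOn ℝ ∞ F smoothDomain)
    (h : ∀ p ∈ smoothDomain, fderiv ℝ F p (0, exactRotoRate σ p) = 0) :
    (fun q : ℝ × ℝ => F (q.1, partialCurve c k q.1 q.2) - F (q.1, partialCurve c k q.1 0))
      =O[𝓝 0 ×ˢ 𝓟 (Icc 0 T)] fun q => q.1 ^ (k + 1) := by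
  have hmem := eventually_partialCurve_mem_smoothDomain hc (isCompact_Icc (a := 0) (b := T)) k
  refine isBigO_sub_of_hasDerivAt (f := fun q : ℝ × ℝ => F (q.1, partialCurve c k q.1 q.2))
    (g := fun ε => ε ^ (k + 1))
    (hmem.mono fun q hq => hasDerivAt_comp_partialCurve hF hc.smooth hq) ?_
  refine (isBigO_fderiv_partialCurve_sub hσ hc isCompact_Icc k hF).congr' ?_ .rfl
  filter_upwards [hmem] with q hq
  rw [h _ hq, sub_zero]

end Comp

theorem norm_rot_le (hσ : σ ^ 2 = 1) (t : ℝ) (z : Phase) : ‖rot σ t z‖ ≤ 2 * ‖z‖ := by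
  have hz (i : Fin 4) : |z i| ≤ ‖z‖ := norm_le_pi_norm z i
  have hcos (i : Fin 4) : |Real.cos t * z i| ≤ ‖z‖ := by
    rw [abs_mul]
    exact (mul_le_of_le_one_left (abs_nonneg _) (Real.abs_cos_le_one t)).trans (hz i)
  have hsin (i : Fin 4) : |σ * Real.sin t * z i| ≤ ‖z‖ := by
    rw [abs_mul, abs_mul, abs_eq_one_of_sq_eq_one hσ, one_mul]
    exact (mul_le_of_le_one_left (abs_nonneg _) (Real.abs_sin_le_one t)).trans (hz i)
  refine (pi_norm_le_iff_of_nonneg (by positivity)).2 fun i => ?_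
  rw [two_mul]
  fin_cases i
  · exact (hz 0).trans (le_add_of_nonneg_left (norm_nonneg z))
  · exact (hz 1).trans (le_add_of_nonneg_left (norm_nonneg z))
  · exact (abs_add_le _ _).trans (add_le_add (hcos 2) (hsin 3))
  · exact (abs_sub _ _).trans (add_le_add (hcos 3) (hsin 2))

/- In normal coordinates the exact roto-rate is the limiting one, whose flow `rot` is `2π`-periodic,
so `rot σ (-t)` of the normal coordinates is constant up to the error. -/
theorem eqMod_normalCoords (hσ : σ ^ 2 = 1) (hc : IsFormalIntegralCurve (rotoRate σ) c) (k : ℕ) :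
    EqMod (k + 1) (fun ε => normalCoords σ (ε, partialCurve c k ε (2 * Real.pi)))
      (fun ε => normalCoords σ (ε, partialCurve c k ε 0)) := by
  have hN := contDiffOn_normalCoords hσ
  have hS : IsCompact (Icc 0 (2 * Real.pi)) := isCompact_Icc
  have hmem := eventually_partialCurve_mem_smoothDomain hc hS k
  have hdrift := isBigO_sub_of_hasDerivAt
    (f := fun q : ℝ × ℝ => rot σ (-q.2) (normalCoords σ (q.1, partialCurve c k q.1 q.2)))
    (g := fun ε => ε ^ (k + 1))
    (hmem.mono fun q hq => hasDerivAt_rot_neg hσ (hasDerivAt_comp_partialCurve hN hc.smooth hq))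
    ((IsBigO.of_bound 2 (.of_forall fun q => norm_rot_le hσ _ _)).trans
      ((isBigO_fderiv_partialCurve_sub hσ hc hS k hN).congr'
        (hmem.mono fun q hq => by simp only [fderiv_normalCoords hσ hq]) .rfl))
  have hend : Tendsto (fun ε : ℝ => (ε, 2 * Real.pi)) (𝓝 0)
      (𝓝 0 ×ˢ 𝓟 (Icc 0 (2 * Real.pi))) :=
    tendsto_id.prodMk (tendsto_principal.2 (.of_forall fun _ => right_mem_Icc.2 Real.two_pi_pos.le))
  have hrot (z : Phase) : rot σ (-(2 * Real.pi)) z = z := by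
    rw [← rot_add_two_pi, neg_add_cancel, rot_zero]
  simpa only [EqMod, Function.comp_def, hrot, neg_zero, rot_zero] using hdrift.comp_tendsto hend

theorem apply_two_pi_of_formalIntegralCurve (hσ : σ ^ 2 = 1)
    (hc : IsFormalIntegralCurve (rotoRate σ) c) (k : ℕ) : c k (2 * Real.pi) = c k 0 := by
  induction k using Nat.strong_induction_on with
  | _ k ih =>
  obtain _ | k := k
  · rw [hc.apply_zero hσ (contDiffOn_rotoRate hσ) fun z hz => rotoRate_zero hz,
      ← zero_add (2 * Real.pi), rot_add_two_pi, rot_zero]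
  have hstrict := ((contDiffOn_normalCoords hσ).contDiffAt (isOpen_smoothDomain.mem_nhds
    (zero_mem_smoothDomain (hc.mem 0)))).hasStrictFDerivAt (by simp)
  have hcurve (ε : ℝ) : partialCurve c (k + 1) ε (2 * Real.pi) =
      partialCurve c (k + 1) ε 0 + ε ^ (k + 1) • (c (k + 1) (2 * Real.pi) - c (k + 1) 0) := by
    simp only [partialCurve, partialSum_succ, smul_sub]
    rw [partialSum_congr fun i hi => ih i (Nat.lt_succ_of_le hi)]
    abel
  have hN := eqMod_normalCoords hσ hc (k + 1)
  simp only [hcurve] at hN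
  exact sub_eq_zero.1 (eq_zero_of_fderiv_normalCoords hσ (hc.mem 0)
    (apply_eq_zero_of_eqMod hstrict (tendsto_partialSum (fun i => c i 0) (k + 1)) hN))

theorem IsFormalIntegralCurve.shift {R : ℕ → Phase → Phase} (hc : IsFormalIntegralCurve R c)
    (a : ℝ) : IsFormalIntegralCurve R (fun k t => c k (t + a)) where
  smooth k := (hc.smooth k).comp (contDiff_id.add contDiff_const)
  mem t := hc.mem (t + a)
  eqn k t := by
    have h (ε : ℝ) : deriv (partialCurve (fun k t => c k (t + a)) k ε) t =
        deriv (partialCurve c k ε) (t + a) :=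
      deriv_comp_add_const (f := partialCurve c k ε) a t
    simp only [h]
    exact hc.eqn k (t + a)

theorem periodic_of_formalIntegralCurve (hσ : σ ^ 2 = 1)
    (hc : IsFormalIntegralCurve (rotoRate σ) c) (k : ℕ) (t : ℝ) :
    c k (t + 2 * Real.pi) = c k t := by
  simpa [add_comm] using apply_two_pi_of_formalIntegralCurve hσ (hc.shift t) k

end AlongCurves

section Kruskal

variable {σ : ℝ}

theorem liouville_eq (σ ε : ℝ) (z u : Phase) :
    liouville σ ε z u = momentum σ ε z * u 0 + ε * z 3 * u 1 := by
  unfold liouville momentum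
  ring

theorem contDiff_momentum (σ : ℝ) : ContDiff ℝ ∞ (fun p : ℝ × Phase => momentum σ p.1 p.2) := by
  unfold momentum
  fun_prop

theorem fderiv_momentum_exactRotoRate (p : ℝ × Phase) :
    fderiv ℝ (fun p : ℝ × Phase => momentum σ p.1 p.2) p (0, exactRotoRate σ p) = 0 := by
  refine fderiv_apply_eq_of_hasDerivAt
    ((contDiff_momentum σ).differentiable (by simp)).differentiableAt ?_
  have h0 := hasDerivAt_fst_line p (exactRotoRate σ p)
  have hl := hasDerivAt_snd_line p (exactRotoRate σ p)
  refine ((h0.mul (hl 2)).sub (((hl 1).add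
    (((hl 1).pow 2).div_const 2)).const_mul σ)).congr_deriv ?_
  simp [exactRotoRate_apply_one, exactRotoRate_apply_two]
  ring

section FormalIntegralCurve

variable {c : ℕ → ℝ → Phase}

/- Along the curve `ϑ` is the derivative of `actionShift σ + p_x x` plus the smooth action, since
`p_x` and the smooth action are almost constant and the velocity is almost the exact roto-rate. -/
theorem isBigO_liouville_partialCurve_sub (hσ : σ ^ 2 = 1)
    (hc : IsFormalIntegralCurve (rotoRate σ) c) (k : ℕ) (T : ℝ) :
    (fun q : ℝ × ℝ =>
      liouville σ q.1 (partialCurve c k q.1 q.2) (partialCurve (fun i => deriv (c i)) k q.1 q.2) -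
        smoothAction σ (q.1, partialCurve c k q.1 0) -
        fderiv ℝ (actionShift σ) (q.1, partialCurve c k q.1 q.2)
          (0, partialCurve (fun i => deriv (c i)) k q.1 q.2) -
        momentum σ q.1 (partialCurve c k q.1 0) * partialCurve (fun i => deriv (c i)) k q.1 q.2 0)
      =O[𝓝 0 ×ˢ 𝓟 (Icc 0 T)] fun q => q.1 ^ (k + 1) := by
  have hS : IsCompact (Icc 0 T) := isCompact_Icc
  have hmem := eventually_partialCurve_mem_smoothDomain hc hS k
  have hmomentum := isBigO_partialCurve_sub_of_invariant hσ hc k T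
    (contDiff_momentum σ).contDiffOn fun p _ => fderiv_momentum_exactRotoRate p
  have haction := isBigO_partialCurve_sub_of_invariant hσ hc k T (contDiffOn_smoothAction hσ)
    fun p hp => fderiv_smoothAction_exactRotoRate hσ hp
  have hshift := isBigO_fderiv_partialCurve_sub hσ hc hS k (contDiffOn_actionShift hσ)
  have hvel := isBigO_pi.1 (isBigO_deriv_partialCurve_sub hσ hc hS k) 1
  have hvel_bdd := isBigO_one_nhds_prod_principal (y₀ := (0 : ℝ)) hS fun t _ =>
    ((continuous_apply (0 : Fin 4)).comp
      (continuous_partialCurve (c := fun i => deriv (c i)) hc.continuous_deriv k)).continuousAt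
  have hy_bdd := isBigO_one_comp_partialCurve (F := fun p => p.1 * p.2 3) hc hS k (by fun_prop)
  have hmul := (hmomentum.mul hvel_bdd).congr_right fun q => mul_one _
  have hmul' := (hy_bdd.mul hvel).congr_right fun q => one_mul _
  refine (((hmul.add hmul').add haction).sub hshift).congr' ?_ .rfl
  filter_upwards [hmem] with q hq
  simp only [Function.comp_apply, Pi.sub_apply, exactRotoRate_apply_one, liouville_eq,
    fderiv_actionShift hσ hq]
  ring

theorem partialCurve_two_pi (hσ : σ ^ 2 = 1) (hc : IsFormalIntegralCurve (rotoRate σ) c) (k : ℕ)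
    (ε : ℝ) : partialCurve c k ε (2 * Real.pi) = partialCurve c k ε 0 := by
  simp only [partialCurve, apply_two_pi_of_formalIntegralCurve hσ hc]

theorem continuous_liouville {f g : ℝ → Phase} (hf : Continuous f) (hg : Continuous g)
    (σ ε : ℝ) : Continuous fun t => liouville σ ε (f t) (g t) := by
  unfold liouville
  fun_prop

theorem eqMod_loopAction (hσ : σ ^ 2 = 1) (hc : IsFormalIntegralCurve (rotoRate σ) c) (k : ℕ) :
    EqMod (k + 1) (fun ε => loopAction σ ε (partialCurve c k ε))
      (fun ε => smoothAction σ (ε, partialCurve c k ε 0)) := by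
  have hderiv (ε t : ℝ) : HasDerivAt (partialCurve c k ε)
      (partialCurve (fun i => deriv (c i)) k ε t) t := hasDerivAt_partialCurve hc.smooth k ε t
  have hcont (ε : ℝ) : Continuous fun t => liouville σ ε (partialCurve c k ε t)
      (partialCurve (fun i => deriv (c i)) k ε t) :=
    continuous_liouville
      ((continuous_partialCurve hc.continuous k).comp (Continuous.prodMk_right ε))
      ((continuous_partialCurve (c := fun i => deriv (c i)) hc.continuous_deriv k).comp
        (Continuous.prodMk_right ε)) σ ε
  have hdrift := isBigO_sub_of_hasDerivAt
    (f := fun q : ℝ × ℝ => (∫ s in (0 : ℝ)..q.2, liouville σ q.1 (partialCurve c k q.1 s)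
        (partialCurve (fun i => deriv (c i)) k q.1 s)) -
      q.2 * smoothAction σ (q.1, partialCurve c k q.1 0) -
      actionShift σ (q.1, partialCurve c k q.1 q.2) -
      momentum σ q.1 (partialCurve c k q.1 0) * partialCurve c k q.1 q.2 0)
    (g := fun ε => ε ^ (k + 1))
    ((eventually_partialCurve_mem_smoothDomain hc isCompact_Icc k).mono fun q hq =>
      ((((hcont q.1).integral_hasStrictDerivAt 0 q.2).hasDerivAt.sub
        (hasDerivAt_mul_const (smoothAction σ (q.1, partialCurve c k q.1 0)))).sub
        (hasDerivAt_comp_partialCurve (contDiffOn_actionShift hσ) hc.smooth hq)).sub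
        ((hasDerivAt_pi.1 (hderiv q.1 q.2) 0).const_mul
          (momentum σ q.1 (partialCurve c k q.1 0))))
    (isBigO_liouville_partialCurve_sub hσ hc k (2 * Real.pi))
  have hend : Tendsto (fun ε : ℝ => (ε, 2 * Real.pi)) (𝓝 0)
      (𝓝 0 ×ˢ 𝓟 (Icc 0 (2 * Real.pi))) :=
    tendsto_id.prodMk (tendsto_principal.2 (.of_forall fun _ => right_mem_Icc.2 Real.two_pi_pos.le))
  refine ((hdrift.comp_tendsto hend).const_mul_left (2 * Real.pi)⁻¹).congr_left fun ε => ?_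
  simp only [Function.comp_apply, loopAction, (hderiv _ _).deriv, partialCurve_two_pi hσ hc,
    intervalIntegral.integral_same]
  field_simp
  ring

end FormalIntegralCurve

theorem partialCurve_eq_of_zero {c : ℕ → ℝ → Phase} {t : ℝ} (h : ∀ k, c (k + 1) t = 0) (k : ℕ)
    (ε : ℝ) : partialCurve c k ε t = c 0 t := by
  rw [partialCurve, partialSum, Finset.sum_range_succ']
  simp [h]

theorem eqMod_smoothAction (hσ : σ ^ 2 = 1) {z : Phase} (hz : z ∈ region) (k : ℕ) :
    EqMod (k + 1) (fun ε => smoothAction σ (ε, z))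
      (partialSum (fun i => actionSeries σ i z) k) :=
  eqMod_partialSum_jet isExpansionDomain_smoothDomain (contDiffOn_smoothAction hσ) k
    (zero_mem_smoothDomain hz)

theorem isKruskalSeries_actionSeries (hσ : σ ^ 2 = 1) :
    IsKruskalSeries σ (rotoRate σ) (actionSeries σ) := by
  intro z hz c hc h0 h1 k
  have hloop := eqMod_loopAction hσ hc k
  simp only [partialCurve_eq_of_zero h1, h0] at hloop
  exact hloop.trans (eqMod_smoothAction hσ hz k)

theorem rotoRate_add_x (hσ : σ ^ 2 = 1) (x : ℝ) (k : ℕ) {z : Phase} (hz : z ∈ region) :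
    rotoRate σ k (z + ![x, 0, 0, 0]) = rotoRate σ k z := by
  have hshift : z + ![x, 0, 0, 0] ∈ region := by
    change -1 < z 1 + 0
    rw [add_zero]
    exact hz
  have heq := eqMod_exactRotoRate_comp hσ (u := fun _ => z + ![x, 0, 0, 0]) hshift
    continuousAt_const
  simp only [exactRotoRate_add_x x (_, z)] at heq
  exact eq_of_eqMod_partialSum (k := k) ((heq k).symm.trans
    (eqMod_exactRotoRate_comp hσ (u := fun _ => z) hz continuousAt_const k)) k le_rfl

section Remainder

variable {ε : ℝ} {z : Phase}

theorem continuousAt_slice {E : Type*} [TopologicalSpace E] {F : ℝ × Phase → E}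
    (hF : ContinuousOn F smoothDomain) (hz : z ∈ region) :
    ContinuousAt (fun ε : ℝ => F (ε, z)) 0 :=
  ContinuousAt.comp (g := F) (f := fun ε : ℝ => (ε, z))
    (hF.continuousAt (isOpen_smoothDomain.mem_nhds (zero_mem_smoothDomain hz))) (by fun_prop)

theorem continuousAt_fderiv_slice {E : Type*} [NormedAddCommGroup E] [NormedSpace ℝ E]
    {F : ℝ × Phase → E} (hF : ContDiffOn ℝ ∞ F smoothDomain) (hz : z ∈ region) {u : ℝ → Phase}
    (hu : ContinuousAt u 0) : ContinuousAt (fun ε => fderiv ℝ F (ε, z) (0, u ε)) 0 :=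
  (continuousAt_slice (hF.continuousOn_fderiv_of_isOpen isOpen_smoothDomain (by simp)) hz).clm_apply
    (continuousAt_const.prodMk hu)

theorem continuousAt_fderiv_field_apply {u : ℝ → Phase} {ε₀ : ℝ} (hu : ContinuousAt u ε₀)
    (σ : ℝ) (z : Phase) : ContinuousAt (fun ε => fderiv ℝ (field σ ε) z (u ε)) ε₀ := by
  simp only [fderiv_field_apply]
  have hu (i : Fin 4) : ContinuousAt (fun ε => u ε i) ε₀ := continuousAt_pi.1 hu i
  refine continuousAt_pi.2 fun i => ?_
  fin_cases i
  · exact continuousAt_id.mul (hu 2)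
  · exact continuousAt_id.mul (hu 3)
  · exact continuousAt_const.mul (((hu 3).mul_const _).add (continuousAt_const.mul (hu 1)))
  · exact (continuousAt_const.mul
      (((hu 2).mul_const _).add (continuousAt_const.mul (hu 1)))).neg

theorem continuousAt_omega {u : ℝ → Phase} {ε₀ : ℝ} (hu : ContinuousAt u ε₀) (σ : ℝ)
    (z w : Phase) : ContinuousAt (fun ε => omega σ ε z (u ε) w) ε₀ := by
  simp only [omega_eq]
  have hu₀ := continuousAt_pi.1 hu 0
  have hu₁ := continuousAt_pi.1 hu 1
  have hu₂ := continuousAt_pi.1 hu 2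
  have hu₃ := continuousAt_pi.1 hu 3
  fun_prop

theorem isLinearMap_omega (σ ε : ℝ) (z w : Phase) :
    IsLinearMap ℝ fun u => omega σ ε z u w where
  map_add u v := by
    simp only [omega_eq, Pi.add_apply]
    ring
  map_smul a u := by
    simp only [omega_eq, Pi.smul_apply, smul_eq_mul]
    ring

theorem eventually_prodMk_right_mem_smoothDomain (hz : z ∈ region) :
    ∀ᶠ ε in 𝓝 (0 : ℝ), (ε, z) ∈ smoothDomain :=
  (Continuous.prodMk_left z).continuousAt.eventually
    (isOpen_smoothDomain.mem_nhds (zero_mem_smoothDomain hz))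

theorem eventually_prodMk_left_mem_smoothDomain (h : (ε, z) ∈ smoothDomain) :
    ∀ᶠ w in 𝓝 z, (ε, w) ∈ smoothDomain :=
  (Continuous.prodMk_right ε).continuousAt.eventually (isOpen_smoothDomain.mem_nhds h)

theorem contDiffOn_iterate_hadamard_exactRotoRate (hσ : σ ^ 2 = 1) (k : ℕ) :
    ContDiffOn ℝ ∞ (hadamard^[k] (exactRotoRate σ)) smoothDomain :=
  contDiffOn_iterate_hadamard isExpansionDomain_smoothDomain (contDiffOn_exactRotoRate hσ) k

theorem contDiffOn_iterate_hadamard_smoothAction (hσ : σ ^ 2 = 1) (k : ℕ) :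
    ContDiffOn ℝ ∞ (hadamard^[k] (smoothAction σ)) smoothDomain :=
  contDiffOn_iterate_hadamard isExpansionDomain_smoothDomain (contDiffOn_smoothAction hσ) k

theorem lieBracket_partialField_rotoRate (hσ : σ ^ 2 = 1) (k : ℕ) (hp : (ε, z) ∈ smoothDomain) :
    VectorField.lieBracket ℝ (partialField (rotoRate σ) k ε) (field σ ε) z =
      ε ^ (k + 1) • (fderiv ℝ (hadamard^[k + 1] (exactRotoRate σ)) (ε, z) (0, field σ ε z) -
        fderiv ℝ (field σ ε) z (hadamard^[k + 1] (exactRotoRate σ) (ε, z))) := by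
  set ρ := hadamard^[k + 1] (exactRotoRate σ) with hρ
  have hexact := (hasFDerivAt_slice (differentiableAt_of_mem_smoothDomain
    (contDiffOn_exactRotoRate hσ) hp)).differentiableAt
  have hρp := differentiableAt_of_mem_smoothDomain
    (contDiffOn_iterate_hadamard_exactRotoRate hσ (k + 1)) hp
  have hρz := (hasFDerivAt_slice hρp).differentiableAt
  have heq : partialField (rotoRate σ) k ε =ᶠ[𝓝 z]
      (fun z => exactRotoRate σ (ε, z)) + (-(ε ^ (k + 1))) • fun z => ρ (ε, z) := by
    filter_upwards [eventually_prodMk_left_mem_smoothDomain hp] with w hw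
    rw [Pi.add_apply, Pi.smul_apply, exactRotoRate_eq_partialField hσ k hw, ← hρ, neg_smul,
      add_neg_cancel_right]
  calc VectorField.lieBracket ℝ (partialField (rotoRate σ) k ε) (field σ ε) z
    _ = VectorField.lieBracket ℝ ((fun z => exactRotoRate σ (ε, z)) +
          (-(ε ^ (k + 1))) • fun z => ρ (ε, z)) (field σ ε) z := by
        simp only [VectorField.lieBracket, heq.fderiv_eq, heq.eq_of_nhds]
    _ = ε ^ (k + 1) • (fderiv ℝ ρ (ε, z) (0, field σ ε z) -
          fderiv ℝ (field σ ε) z (ρ (ε, z))) := by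
        rw [VectorField.lieBracket_add_left hexact (hρz.const_smul _),
          lieBracket_exactRotoRate hσ hp, VectorField.lieBracket_const_smul_left hρz,
          VectorField.lieBracket, fderiv_slice hρp, zero_add, neg_smul, ← smul_neg, neg_sub]

theorem isRotoRate_rotoRate (hσ : σ ^ 2 = 1) : IsRotoRate σ (rotoRate σ) where
  smooth := contDiffOn_rotoRate hσ
  periodic_x k _ hz := rotoRate_add_x hσ _ k hz
  commutes k z hz := by
    have hρ := contDiffOn_iterate_hadamard_exactRotoRate hσ (k + 1)
    have hfield : ContinuousAt (fun ε => field σ ε z) 0 :=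
      ((contDiff_field σ).continuous.comp (Continuous.prodMk_left z)).continuousAt
    refine .of_smul ((continuousAt_fderiv_slice hρ hz hfield).sub
      (continuousAt_fderiv_field_apply (continuousAt_slice hρ.continuousOn hz) σ z)) ?_
    filter_upwards [eventually_prodMk_right_mem_smoothDomain hz] with ε hε
    rw [lieBracket_partialField_rotoRate hσ k hε, zero_add, Pi.sub_apply]
  periodic _ hc := periodic_of_formalIntegralCurve hσ hc
  limit _ hz := rotoRate_zero hz

theorem fderiv_smoothAction_eq_partialSum (hσ : σ ^ 2 = 1) (k : ℕ) (hp : (ε, z) ∈ smoothDomain)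
    (w : Phase) : fderiv ℝ (smoothAction σ) (ε, z) (0, w) =
      partialSum (fun i => fderiv ℝ (actionSeries σ i) z w) k ε +
        ε ^ (k + 1) * fderiv ℝ (hadamard^[k + 1] (smoothAction σ)) (ε, z) (0, w) := by
  have heq : (fun z => smoothAction σ (ε, z)) =ᶠ[𝓝 z] fun z =>
      partialSum (fun i => actionSeries σ i z) k ε +
        ε ^ (k + 1) * hadamard^[k + 1] (smoothAction σ) (ε, z) := by
    filter_upwards [eventually_prodMk_left_mem_smoothDomain hp] with v hv using
      smoothAction_eq_partialSum hσ k hv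
  have hcoeff (i : ℕ) : HasFDerivAt (actionSeries σ i) (fderiv ℝ (actionSeries σ i) z) z :=
    (((contDiffOn_actionSeries hσ i).contDiffAt (isOpen_region.mem_nhds hp.1)).differentiableAt
      (by simp)).hasFDerivAt
  have hsum : HasFDerivAt (fun z => partialSum (fun i => actionSeries σ i z) k ε)
      (∑ i ∈ Finset.range (k + 1), ε ^ i • fderiv ℝ (actionSeries σ i) z) z :=
    HasFDerivAt.fun_sum fun i _ => (hcoeff i).const_smul (ε ^ i)
  have hrem := hasFDerivAt_slice (differentiableAt_of_mem_smoothDomain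
    (contDiffOn_iterate_hadamard_smoothAction hσ (k + 1)) hp)
  rw [← fderiv_slice (differentiableAt_of_mem_smoothDomain (contDiffOn_smoothAction hσ) hp),
    heq.fderiv_eq, (hsum.fun_add (hrem.const_mul (ε ^ (k + 1)))).fderiv]
  simp [partialSum]

theorem isHamiltonianSeries_actionSeries (hσ : σ ^ 2 = 1) :
    IsHamiltonianSeries σ (rotoRate σ) (actionSeries σ) := by
  refine ⟨contDiffOn_actionSeries hσ, fun k z hz w => ?_⟩
  have hρ := contDiffOn_iterate_hadamard_exactRotoRate hσ (k + 1)
  have hη := contDiffOn_iterate_hadamard_smoothAction hσ (k + 1)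
  refine .of_smul ((continuousAt_fderiv_slice hη hz (continuousAt_const (y := w))).sub
    (continuousAt_omega (continuousAt_slice hρ.continuousOn hz) σ z w)) ?_
  filter_upwards [eventually_prodMk_right_mem_smoothDomain hz] with ε hε
  have homega := omega_exactRotoRate hσ hε w
  rw [exactRotoRate_eq_partialField hσ k hε, (isLinearMap_omega σ ε z w).map_add,
    (isLinearMap_omega σ ε z w).map_smul, fderiv_smoothAction_eq_partialSum hσ k hε] at homega
  rw [smul_eq_mul] at homega
  rw [Pi.sub_apply, smul_eq_mul]
  linear_combination homega

end Remainder

end Kruskal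

section ConstantsOfMotion

variable {σ ε : ℝ}

theorem eq_of_hasDerivWithinAt_zero {f : ℝ → ℝ} {s : Set ℝ} (hs : s.OrdConnected)
    (hf : ∀ t ∈ s, HasDerivWithinAt f 0 s t) {t₁ t₂ : ℝ} (h₁ : t₁ ∈ s) (h₂ : t₂ ∈ s) :
    f t₁ = f t₂ := by
  have := hs.convex.norm_image_sub_le_of_norm_hasDerivWithin_le (C := 0) hf (by simp) h₂ h₁
  simpa [sub_eq_zero] using this

theorem IsMotionOn.speed_eq {γ : ℝ → Phase} {s : Set ℝ} (hγ : IsMotionOn σ ε γ s)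
    (hs : s.OrdConnected) {t₁ t₂ : ℝ} (h₁ : t₁ ∈ s) (h₂ : t₂ ∈ s) :
    speed (γ t₁) = speed (γ t₂) := by
  have : γ t₁ 2 ^ 2 + γ t₁ 3 ^ 2 = γ t₂ 2 ^ 2 + γ t₂ 3 ^ 2 := by
    refine eq_of_hasDerivWithinAt_zero (f := fun t => γ t 2 ^ 2 + γ t 3 ^ 2) hs
      (fun t ht => ?_) h₁ h₂
    have h := hasDerivWithinAt_pi.1 (hγ t ht)
    refine (((h 2).pow 2).add ((h 3).pow 2)).congr_deriv ?_
    rw [field_two, field_three]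
    push_cast
    ring
  rw [speed, speed, this]

theorem IsMotionOn.centerY_eq {γ : ℝ → Phase} {s : Set ℝ} (hγ : IsMotionOn σ ε γ s)
    (hs : s.OrdConnected) {t₁ t₂ : ℝ} (h₁ : t₁ ∈ s) (h₂ : t₂ ∈ s) :
    centerY σ ε (γ t₁) = centerY σ ε (γ t₂) := by
  have : momentum σ ε (γ t₁) = momentum σ ε (γ t₂) := by
    refine eq_of_hasDerivWithinAt_zero (f := fun t => momentum σ ε (γ t)) hs
      (fun t ht => ?_) h₁ h₂
    have h := hasDerivWithinAt_pi.1 (hγ t ht)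
    refine (((h 2).const_mul ε).sub
      (((h 1).add (((h 1).pow 2).div_const 2)).const_mul σ)).congr_deriv ?_
    rw [field_one, field_two]
    push_cast
    ring
  rw [centerY, centerY, this]

theorem one_add_two_mul_centerY (hσ : σ ^ 2 = 1) (z : Phase) :
    1 + 2 * centerY σ ε z = (1 + z 1) ^ 2 - 2 * σ * ε * z 2 := by
  have h0 : σ ≠ 0 := by rintro rfl; norm_num at hσ
  unfold centerY momentum
  field_simp
  linear_combination (2 * ε * z 2) * hσ

theorem abs_two_mul_le (hσ : σ ^ 2 = 1) {v r : ℝ} (hε : 0 ≤ ε) (hv : |v| ≤ r) :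
    |2 * σ * ε * v| ≤ 2 * ε * r := by
  rw [abs_mul, abs_mul, abs_mul, abs_eq_one_of_sq_eq_one hσ, abs_two, abs_of_nonneg hε, mul_one]
  gcongr

theorem abs_le_speed (z : Phase) : |z 2| ≤ speed z :=
  Real.abs_le_sqrt (by nlinarith [sq_nonneg (z 3)])

theorem IsMotionOn.mem_levelSet (hσ : σ ^ 2 = 1) {r Y : ℝ} (hε : 0 < ε)
    (hrY : 2 * ε * r < 1 + 2 * Y) {γ : ℝ → Phase} {s : Set ℝ} (hγ : IsMotionOn σ ε γ s)
    (hs : s.OrdConnected) {t₀ t : ℝ} (h₀ : t₀ ∈ s) (h : γ t₀ ∈ levelSet σ ε r Y) (ht : t ∈ s) :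
    γ t ∈ levelSet σ ε r Y := by
  obtain ⟨hreg, hr, hY⟩ := h
  have hspeed (τ) (hτ : τ ∈ s) : speed (γ τ) = r := (hγ.speed_eq hs hτ h₀).trans hr
  have hcenter (τ) (hτ : τ ∈ s) : centerY σ ε (γ τ) = Y := (hγ.centerY_eq hs hτ h₀).trans hY
  have hne (τ) (hτ : τ ∈ s) : γ τ 1 ≠ -1 := fun hy => by
    have hB := one_add_two_mul_centerY (ε := ε) hσ (γ τ)
    have hv := (abs_le.1 (abs_two_mul_le hσ hε.le
      ((abs_le_speed (γ τ)).trans_eq (hspeed τ hτ)))).1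
    rw [hcenter τ hτ, hy] at hB
    linarith
  refine ⟨?_, hspeed t ht, hcenter t ht⟩
  by_contra hy
  have hsub : uIcc t t₀ ⊆ s := hs.uIcc_subset ht h₀
  have hcont : ContinuousOn (fun τ => γ τ 1) (uIcc t t₀) := fun τ hτ =>
    (hasDerivWithinAt_pi.1 (hγ τ (hsub hτ)) 1).continuousWithinAt.mono hsub
  obtain ⟨τ, hτ, hyτ⟩ :=
    intermediate_value_uIcc hcont (mem_uIcc.2 (.inl ⟨not_lt.1 hy, le_of_lt hreg⟩))
  exact hne τ (hsub hτ) hyτ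

end ConstantsOfMotion

section Torus

variable {σ ε r Y : ℝ}

theorem exists_angle (a b : ℝ) : ∃ θ, a = √(a ^ 2 + b ^ 2) * Real.cos θ ∧
    b = √(a ^ 2 + b ^ 2) * Real.sin θ := by
  have h : ‖(⟨a, b⟩ : ℂ)‖ = √(a ^ 2 + b ^ 2) := by
    rw [Complex.norm_def, Complex.normSq_mk, sq, sq]
  refine ⟨Complex.arg ⟨a, b⟩, ?_, ?_⟩ <;> rw [← h]
  · rw [Complex.norm_mul_cos_arg]
  · rw [Complex.norm_mul_sin_arg]

theorem sqrt_mul_sqrt_one_add {m : ℝ} (hm : 0 < m) (x c : ℝ) :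
    √m * √(1 + x / m * c) = √(m + x * c) := by
  rw [← Real.sqrt_mul hm.le]
  congr 1
  field_simp

/-- The magnetic field `1 + y` at the angle `ζ` of the torus with the constants of motion `r` and
`Y`. -/
noncomputable def torusField (σ ε r Y ζ : ℝ) : ℝ :=
  √(1 + 2 * Y + 2 * σ * ε * r * Real.cos ζ)

theorem torus_eq (hY : 0 < 1 + 2 * Y) (x ζ : ℝ) :
    torus σ ε r Y x ζ =
      ![x, -1 + torusField σ ε r Y ζ, r * Real.cos ζ, -(r * Real.sin ζ)] := by
  rw [torus, sqrt_mul_sqrt_one_add hY, torusField]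

theorem action_eq (hY : 0 < 1 + 2 * Y) :
    action σ ε r Y = ε * σ * ((2 * Real.pi)⁻¹ *
      ∫ ζ in (0 : ℝ)..(2 * Real.pi), r * Real.cos ζ * torusField σ ε r Y ζ) := by
  have hB (ζ) : r * Real.cos ζ * torusField σ ε r Y ζ = (r * √(1 + 2 * Y)) *
      (√(1 + 2 * σ * ε * r / (1 + 2 * Y) * Real.cos ζ) * Real.cos ζ) := by
    rw [torusField, ← sqrt_mul_sqrt_one_add hY]
    ring
  simp only [hB, intervalIntegral.integral_const_mul, action]
  ring

theorem one_add_two_mul_pos (hε : 0 < ε) (hr : 0 < r) (hrY : 2 * ε * r < 1 + 2 * Y) :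
    0 < 1 + 2 * Y :=
  (by positivity : 0 < 2 * ε * r).trans hrY

theorem torusField_radicand_pos (hσ : σ ^ 2 = 1) (hε : 0 < ε) (hr : 0 < r)
    (hrY : 2 * ε * r < 1 + 2 * Y) (ζ : ℝ) : 0 < 1 + 2 * Y + 2 * σ * ε * r * Real.cos ζ := by
  have hv : |r * Real.cos ζ| ≤ r := by
    rw [abs_mul, abs_of_pos hr]
    exact mul_le_of_le_one_right hr.le (Real.abs_cos_le_one ζ)
  have := (abs_le.1 (abs_two_mul_le hσ hε.le hv)).1
  linarith

theorem torusField_pos (hσ : σ ^ 2 = 1) (hε : 0 < ε) (hr : 0 < r)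
    (hrY : 2 * ε * r < 1 + 2 * Y) (ζ : ℝ) : 0 < torusField σ ε r Y ζ :=
  Real.sqrt_pos.2 (torusField_radicand_pos hσ hε hr hrY ζ)

theorem speed_torus (hr : 0 ≤ r) (x ζ : ℝ) : speed (torus σ ε r Y x ζ) = r := by
  have hsq : (r * Real.cos ζ) ^ 2 + (-(r * Real.sin ζ)) ^ 2 = r ^ 2 := by
    linear_combination r ^ 2 * Real.sin_sq_add_cos_sq ζ
  exact (congrArg Real.sqrt hsq).trans (Real.sqrt_sq hr)

theorem torus_mem_levelSet (hσ : σ ^ 2 = 1) (hε : 0 < ε) (hr : 0 < r)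
    (hrY : 2 * ε * r < 1 + 2 * Y) (x ζ : ℝ) : torus σ ε r Y x ζ ∈ levelSet σ ε r Y := by
  have htorus := torus_eq (σ := σ) (ε := ε) (r := r) (one_add_two_mul_pos hε hr hrY) x ζ
  have hy : 1 + torus σ ε r Y x ζ 1 = torusField σ ε r Y ζ := by
    rw [htorus]
    exact add_neg_cancel_left 1 _
  refine ⟨neg_lt_iff_pos_add'.2 (hy ▸ torusField_pos hσ hε hr hrY ζ), speed_torus hr.le x ζ, ?_⟩
  have hB := one_add_two_mul_centerY (ε := ε) hσ (torus σ ε r Y x ζ)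
  have hv : torus σ ε r Y x ζ 2 = r * Real.cos ζ := rfl
  rw [hy, hv, torusField, Real.sq_sqrt (torusField_radicand_pos hσ hε hr hrY ζ).le] at hB
  linarith

theorem exists_torus_eq (hσ : σ ^ 2 = 1) (hY : 0 < 1 + 2 * Y) {z : Phase}
    (hz : z ∈ levelSet σ ε r Y) : ∃ ζ, torus σ ε r Y (z 0) ζ = z := by
  obtain ⟨hreg, hr, hzY⟩ := hz
  obtain ⟨θ, hcos, hsin⟩ := exists_angle (z 2) (z 3)
  rw [← speed, hr] at hcos hsin
  have hB : torusField σ ε r Y (-θ) = 1 + z 1 := by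
    have hradicand : 1 + 2 * Y + 2 * σ * ε * r * Real.cos (-θ) = (1 + z 1) ^ 2 := by
      have hcenter := one_add_two_mul_centerY (ε := ε) hσ z
      rw [hzY] at hcenter
      rw [hcenter, hcos, Real.cos_neg]
      ring
    rw [torusField, hradicand, Real.sqrt_sq (neg_lt_iff_pos_add'.1 hreg).le]
  refine ⟨-θ, ?_⟩
  rw [torus_eq hY, hB, Real.cos_neg, Real.sin_neg, ← hcos, mul_neg, neg_neg, ← hsin,
    neg_add_cancel_left]
  ext i
  fin_cases i <;> rfl

theorem levelSet_eq_range_torus (hσ : σ ^ 2 = 1) (hε : 0 < ε) (hr : 0 < r)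
    (hrY : 2 * ε * r < 1 + 2 * Y) :
    levelSet σ ε r Y = range (fun p : ℝ × ℝ => torus σ ε r Y p.1 p.2) := by
  refine Subset.antisymm (fun z hz => ?_) ?_
  · obtain ⟨ζ, hζ⟩ := exists_torus_eq hσ (one_add_two_mul_pos hε hr hrY) hz
    exact ⟨(z 0, ζ), hζ⟩
  · rintro _ ⟨⟨x, ζ⟩, rfl⟩
    exact torus_mem_levelSet hσ hε hr hrY x ζ

theorem cycle_eq (hσ : σ ^ 2 = 1) (hY : 0 < 1 + 2 * Y) : cycle σ ε r Y = fun ζ =>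
    ![0, -1 + torusField σ ε r Y ζ, r * Real.cos ζ, -(r * (σ * Real.sin ζ))] := by
  funext ζ
  rw [cycle, torus_eq hY, torusField, torusField]
  rcases sq_eq_one_iff.1 hσ with rfl | rfl <;> simp

/-- The derivative of `torusField` in the angle. -/
noncomputable def torusFieldDeriv (σ ε r Y ζ : ℝ) : ℝ :=
  2 * σ * ε * r * -Real.sin ζ / (2 * torusField σ ε r Y ζ)

theorem hasDerivAt_torusField (hσ : σ ^ 2 = 1) (hε : 0 < ε) (hr : 0 < r)
    (hrY : 2 * ε * r < 1 + 2 * Y) (ζ : ℝ) :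
    HasDerivAt (torusField σ ε r Y) (torusFieldDeriv σ ε r Y ζ) ζ :=
  (((Real.hasDerivAt_cos ζ).const_mul _).const_add _).sqrt
    (torusField_radicand_pos hσ hε hr hrY ζ).ne'

theorem continuous_torusFieldDeriv (hσ : σ ^ 2 = 1) (hε : 0 < ε) (hr : 0 < r)
    (hrY : 2 * ε * r < 1 + 2 * Y) : Continuous (torusFieldDeriv σ ε r Y) := by
  have hB : Continuous (torusField σ ε r Y) := by
    unfold torusField
    fun_prop
  exact .div (by fun_prop) (by fun_prop) fun ζ =>
    mul_ne_zero two_ne_zero (torusField_pos hσ hε hr hrY ζ).ne'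

theorem hasDerivAt_cycle (hσ : σ ^ 2 = 1) (hε : 0 < ε) (hr : 0 < r)
    (hrY : 2 * ε * r < 1 + 2 * Y) (ζ : ℝ) : HasDerivAt (cycle σ ε r Y)
      ![0, torusFieldDeriv σ ε r Y ζ, r * -Real.sin ζ, -(r * (σ * Real.cos ζ))] ζ := by
  rw [cycle_eq hσ (one_add_two_mul_pos hε hr hrY), hasDerivAt_pi]
  intro i
  fin_cases i
  · exact hasDerivAt_const ζ 0
  · exact (hasDerivAt_torusField hσ hε hr hrY ζ).const_add (-1)
  · exact (Real.hasDerivAt_cos ζ).const_mul r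
  · exact (((Real.hasDerivAt_sin ζ).const_mul σ).const_mul r).neg

theorem liouville_cycle (hσ : σ ^ 2 = 1) (hε : 0 < ε) (hr : 0 < r)
    (hrY : 2 * ε * r < 1 + 2 * Y) (ζ : ℝ) :
    liouville σ ε (cycle σ ε r Y ζ) (deriv (cycle σ ε r Y) ζ) =
      -(ε * σ * r) * (Real.sin ζ * torusFieldDeriv σ ε r Y ζ) := by
  rw [(hasDerivAt_cycle hσ hε hr hrY ζ).deriv, cycle_eq hσ (one_add_two_mul_pos hε hr hrY),
    liouville]
  simp only [Matrix.cons_val]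
  ring

theorem action_eq_loopAction_cycle (hσ : σ ^ 2 = 1) (hε : 0 < ε) (hr : 0 < r)
    (hrY : 2 * ε * r < 1 + 2 * Y) : action σ ε r Y = loopAction σ ε (cycle σ ε r Y) := by
  have hparts : ∫ ζ in (0 : ℝ)..(2 * Real.pi), Real.sin ζ * torusFieldDeriv σ ε r Y ζ =
      -∫ ζ in (0 : ℝ)..(2 * Real.pi), Real.cos ζ * torusField σ ε r Y ζ := by
    rw [intervalIntegral.integral_mul_deriv_eq_deriv_mul (fun ζ _ => Real.hasDerivAt_sin ζ)
      (fun ζ _ => hasDerivAt_torusField hσ hε hr hrY ζ)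
      (Real.continuous_cos.intervalIntegrable _ _)
      ((continuous_torusFieldDeriv hσ hε hr hrY).intervalIntegrable _ _)]
    simp
  rw [action_eq (one_add_two_mul_pos hε hr hrY), loopAction]
  simp only [liouville_cycle hσ hε hr hrY, mul_assoc r, intervalIntegral.integral_const_mul,
    hparts]
  ring

end Torus

section PowerSeries

variable {σ ε : ℝ} {z : Phase}

theorem intervalIntegral_comp_sub_of_periodic {E : Type*} [NormedAddCommGroup E]
    [NormedSpace ℝ E] {f : ℝ → E} {T : ℝ} (hf : Function.Periodic f T) (θ : ℝ) :
    ∫ s in (0 : ℝ)..T, f (s - θ) = ∫ s in (0 : ℝ)..T, f s := by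
  rw [intervalIntegral.integral_comp_sub_right]
  simpa [sub_eq_neg_add] using hf.intervalIntegral_add_eq (0 - θ) 0

theorem vel_eq_speed_mul_cos (z : Phase) :
    ∃ θ, ∀ s, vel z s = speed z * Real.cos (s - θ) := by
  obtain ⟨θ, hcos, hsin⟩ := exists_angle (z 2) (z 3)
  rw [← speed] at hcos hsin
  refine ⟨θ, fun s => ?_⟩
  rw [vel, Real.cos_sub]
  linear_combination Real.cos s * hcos + Real.sin s * hsin

theorem actionAt_eq_smoothAction (hσ : σ ^ 2 = 1) (hp : (ε, z) ∈ smoothDomain) :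
    actionAt σ ε z = smoothAction σ (ε, z) := by
  obtain ⟨θ, hvel⟩ := vel_eq_speed_mul_cos z
  have hsq (s : ℝ) : magneticSq σ (ε, z) s =
      1 + 2 * centerY σ ε z + 2 * σ * ε * speed z * Real.cos (s - θ) := by
    rw [magneticSq, hvel, one_add_two_mul_centerY hσ]
    ring
  have hpos : 0 < 1 + 2 * centerY σ ε z := by
    have h := magneticSq_pos hσ hp (Real.pi / 2 + θ)
    rwa [hsq, add_sub_cancel_right, Real.cos_pi_div_two, mul_zero, add_zero] at h
  have hper : Function.Periodic (fun ζ => speed z * Real.cos ζ *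
      torusField σ ε (speed z) (centerY σ ε z) ζ) (2 * Real.pi) := fun ζ => by
    simp only [torusField, Real.cos_add_two_pi]
  rw [actionAt, action_eq hpos, ← intervalIntegral_comp_sub_of_periodic hper θ, smoothAction, mean]
  simp only [velField, orbitPoint, torusField, hvel, hsq, one_mul]

/-- The coefficient of `ε` in `magneticSq` relative to its value at `ε = 0`. -/
noncomputable def magneticSlope (σ : ℝ) (z : Phase) (s : ℝ) : ℝ :=
  2 * σ * (vel z s - z 2) / (1 + z 1) ^ 2

theorem continuous_magneticSlope (σ : ℝ) (z : Phase) : Continuous (magneticSlope σ z) := by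
  have := continuous_vel z
  unfold magneticSlope
  fun_prop

theorem abs_vel_le (z : Phase) (s : ℝ) : |vel z s| ≤ speed z :=
  Real.abs_le_sqrt (by nlinarith [vel_sq_add_velPerp_sq z s, sq_nonneg (velPerp z s)])

theorem abs_mul_magneticSlope_lt_one (hσ : σ ^ 2 = 1) (hp : (ε, z) ∈ smoothDomain) (s : ℝ) :
    |ε * magneticSlope σ z s| < 1 := by
  have hy : 0 < (1 + z 1) ^ 2 := pow_pos (neg_lt_iff_pos_add'.1 hp.1) 2
  have hslope : ε * magneticSlope σ z s = 2 * σ * ε * (vel z s - z 2) / (1 + z 1) ^ 2 := by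
    unfold magneticSlope
    ring
  rw [hslope, abs_div, abs_of_pos hy, div_lt_one hy]
  exact abs_magneticSq_sub_lt hσ hp s

theorem exists_abs_mul_magneticSlope_le (hσ : σ ^ 2 = 1) (hp : (ε, z) ∈ smoothDomain) :
    ∃ q : ℝ, 0 ≤ q ∧ q < 1 ∧ ∀ s, |ε * magneticSlope σ z s| ≤ q := by
  have hcont : Continuous fun s => |ε * magneticSlope σ z s| :=
    ((continuous_magneticSlope σ z).const_mul ε).abs
  have hper : Function.Periodic (fun s => |ε * magneticSlope σ z s|) (2 * Real.pi) := fun s => by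
    simp [magneticSlope, vel]
  obtain ⟨s₀, -, hs₀⟩ := isCompact_Icc.exists_isMaxOn
    (nonempty_Icc.2 Real.two_pi_pos.le) hcont.continuousOn
  refine ⟨_, abs_nonneg _, abs_mul_magneticSlope_lt_one hσ hp s₀, fun s => ?_⟩
  obtain ⟨t, ht, hst⟩ := hper.exists_mem_Ico₀ Real.two_pi_pos s
  exact hst.trans_le (hs₀ (Ico_subset_Icc_self ht))

theorem sqrt_magneticSq_eq (hz : z ∈ region) (s : ℝ) :
    √(magneticSq σ (ε, z) s) = (1 + z 1) * √(1 + ε * magneticSlope σ z s) := by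
  have hy : 0 < 1 + z 1 := neg_lt_iff_pos_add'.1 hz
  have hfactor : magneticSq σ (ε, z) s = (1 + z 1) ^ 2 * (1 + ε * magneticSlope σ z s) := by
    unfold magneticSq magneticSlope
    field_simp
  rw [hfactor, Real.sqrt_mul (by positivity), Real.sqrt_sq hy.le]

theorem hasSum_sqrt_one_add {u : ℝ} (hu : |u| < 1) :
    HasSum (fun k : ℕ => Ring.choose (1 / 2 : ℝ) k * u ^ k) (√(1 + u)) := by
  have hmem : u ∈ Metric.eball (0 : ℝ) 1 := by
    rwa [← ENNReal.ofReal_one, Metric.eball_ofReal, mem_ball_zero_iff, Real.norm_eq_abs]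
  have := (Real.one_add_rpow_hasFPowerSeriesOnBall_zero (a := 1 / 2)).hasSum hmem
  rw [zero_add, ← Real.sqrt_eq_rpow] at this
  simpa [binomialSeries, FormalMultilinearSeries.coeff_ofScalars, mul_comm] using this

theorem summable_abs_choose {q : ℝ} (hq : 0 ≤ q) (hq1 : q < 1) :
    Summable (fun k : ℕ => |Ring.choose (1 / 2 : ℝ) k| * q ^ k) :=
  (hasSum_sqrt_one_add (abs_lt.2 ⟨by linarith, hq1⟩)).summable.abs.congr fun k => by
    rw [abs_mul, abs_of_nonneg (pow_nonneg hq k)]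

theorem hasSum_integral_mul_sqrt_one_add {w u : ℝ → ℝ} (hw : Continuous w) (hu : Continuous u)
    {C q : ℝ} (hC : ∀ s, |w s| ≤ C) (hq1 : q < 1) (huq : ∀ s, |u s| ≤ q) (a b : ℝ) :
    HasSum (fun k : ℕ => ∫ s in a..b, w s * (Ring.choose (1 / 2 : ℝ) k * u s ^ k))
      (∫ s in a..b, w s * √(1 + u s)) := by
  have hq : 0 ≤ q := (abs_nonneg _).trans (huq 0)
  refine intervalIntegral.hasSum_integral_of_dominated_convergence
    (fun k _ => C * (|Ring.choose (1 / 2 : ℝ) k| * q ^ k))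
    (fun k => (hw.mul (continuous_const.mul (hu.pow k))).aestronglyMeasurable)
    (fun k => .of_forall fun s _ => ?_)
    (.of_forall fun s _ => (summable_abs_choose hq hq1).mul_left _) intervalIntegrable_const
    (.of_forall fun s _ => (hasSum_sqrt_one_add ((huq s).trans_lt hq1)).mul_left _)
  rw [Real.norm_eq_abs, abs_mul, abs_mul, abs_pow]
  exact mul_le_mul (hC s) (by gcongr; exact huq s) (by positivity) ((abs_nonneg _).trans (hC s))

/-- The coefficients of the power series of the action variable in `ε`, divided by `ε`. -/
noncomputable def actionCoeff (σ : ℝ) (z : Phase) (k : ℕ) : ℝ :=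
  σ * ((2 * Real.pi)⁻¹ * ∫ s in (0 : ℝ)..(2 * Real.pi),
    vel z s * (1 + z 1) * (Ring.choose (1 / 2 : ℝ) k * magneticSlope σ z s ^ k))

theorem hasSum_actionCoeff (hσ : σ ^ 2 = 1) (hp : (ε, z) ∈ smoothDomain) :
    HasSum (fun k : ℕ => ε ^ k * actionCoeff σ z k) (σ * mean σ (fun _ => 1) velField (ε, z)) := by
  have hy : 0 < 1 + z 1 := neg_lt_iff_pos_add'.1 hp.1
  obtain ⟨q, -, hq1, hslope⟩ := exists_abs_mul_magneticSlope_le hσ hp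
  have hbound (s : ℝ) : |vel z s * (1 + z 1)| ≤ speed z * (1 + z 1) := by
    rw [abs_mul, abs_of_pos hy]
    exact mul_le_mul_of_nonneg_right (abs_vel_le z s) hy.le
  have hsum := (hasSum_integral_mul_sqrt_one_add ((continuous_vel z).mul_const (1 + z 1))
    ((continuous_magneticSlope σ z).const_mul ε) hbound hq1 hslope 0
    (2 * Real.pi)).mul_left (σ * (2 * Real.pi)⁻¹)
  convert! hsum using 1
  · funext k
    have hpow (s : ℝ) :
        vel z s * (1 + z 1) * (Ring.choose (1 / 2 : ℝ) k * (ε * magneticSlope σ z s) ^ k) =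
        ε ^ k * (vel z s * (1 + z 1) * (Ring.choose (1 / 2 : ℝ) k * magneticSlope σ z s ^ k)) := by
      ring
    simp only [actionCoeff, hpow, intervalIntegral.integral_const_mul]
    ring
  · simp only [mean, velField, orbitPoint, sqrt_magneticSq_eq hp.1, one_mul, mul_assoc]

theorem eqMod_of_hasSum {b : ℕ → ℝ} {f : ℝ → ℝ}
    (h : ∀ᶠ ε in 𝓝 (0 : ℝ), HasSum (fun k : ℕ => ε ^ k * b k) (f ε)) (k : ℕ) :
    EqMod (k + 1) f (partialSum b k) := by
  have hps : HasFPowerSeriesAt f (FormalMultilinearSeries.ofScalars ℝ b) 0 := by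
    rw [hasFPowerSeriesAt_iff]
    filter_upwards [h] with ε hε
    simpa [FormalMultilinearSeries.coeff_ofScalars] using hε
  have := hps.isBigO_sub_partialSum_pow (k + 1)
  simp only [zero_add] at this
  refine (this.congr_left fun ε => ?_).trans (isBigO_of_le _ fun ε => by simp)
  simp [FormalMultilinearSeries.partialSum, Slab.partialSum, mul_comm]

theorem hasSum_smoothAction (hσ : σ ^ 2 = 1) (hp : (ε, z) ∈ smoothDomain) :
    HasSum (fun k : ℕ => ε ^ k * actionSeries σ k z) (smoothAction σ (ε, z)) := by
  let b : ℕ → ℝ := fun k => Nat.casesOn k 0 (actionCoeff σ z)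
  have hb (δ : ℝ) (hδ : (δ, z) ∈ smoothDomain) :
      HasSum (fun k : ℕ => δ ^ k * b k) (smoothAction σ (δ, z)) := by
    rw [← hasSum_nat_add_iff' 1]
    convert! (hasSum_actionCoeff hσ hδ).mul_left δ using 1
    · funext k
      simp only [b, pow_succ]
      ring
    · simp [b, smoothAction, mul_assoc]
  have hz : z ∈ region := hp.1
  have hexpansion := eqMod_of_hasSum ((eventually_prodMk_right_mem_smoothDomain hz).mono hb)
  have hseries (k : ℕ) : actionSeries σ k z = b k :=
    eq_of_eqMod_partialSum (a := fun i => actionSeries σ i z)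
      ((eqMod_smoothAction hσ hz k).symm.trans (hexpansion k)) k le_rfl
  simpa only [hseries] using hb ε hp

theorem exists_hasSum_actionAt (hσ : σ ^ 2 = 1) {K : Set Phase} (hK : IsCompact K)
    (hKr : K ⊆ region) : ∃ ρ : ℝ, 0 < ρ ∧ ∀ z ∈ K, ∀ ε : ℝ, |ε| < ρ →
      HasSum (fun k : ℕ => ε ^ k * actionSeries σ k z) (actionAt σ ε z) := by
  have h : ∀ᶠ ε in 𝓝 (0 : ℝ), ∀ z ∈ K, (ε, z) ∈ smoothDomain :=
    hK.eventually_forall_of_forall_eventually fun z hz =>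
      isOpen_smoothDomain.mem_nhds (zero_mem_smoothDomain (hKr hz))
  obtain ⟨ρ, hρ, h⟩ := Metric.eventually_nhds_iff.1 h
  refine ⟨ρ, hρ, fun z hz ε hε => ?_⟩
  have hp := h (by simpa using hε) z hz
  rw [actionAt_eq_smoothAction hσ hp]
  exact hasSum_smoothAction hσ hp

end PowerSeries

theorem IsHamiltonianSeries.congr {σ : ℝ} {R R' : ℕ → Phase → Phase} {μ μ' : ℕ → Phase → ℝ}
    (h : IsHamiltonianSeries σ R μ) (hR : ∀ k, ∀ z ∈ region, R' k z = R k z)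
    (hμ : ∀ k, ∀ z ∈ region, μ' k z = μ k z) : IsHamiltonianSeries σ R' μ' := by
  refine ⟨fun k => (h.1 k).congr (hμ k), fun k z hz w => ?_⟩
  have hfderiv (i : ℕ) : fderiv ℝ (μ' i) z = fderiv ℝ (μ i) z :=
    Filter.EventuallyEq.fderiv_eq
      (eventually_of_mem (isOpen_region.mem_nhds hz) fun w hw => hμ i w hw)
  simpa only [hfderiv, partialField, partialSum_congr fun i _ => hR i z hz] using h.2 k z hz w

end Slab

theorem proposition1 (σ : ℝ) (hσ : σ = 1 ∨ σ = -1) :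
    -- the level sets are invariant tori, and `J₁` is the action of their cyclotron cycle
    (∀ ε r Y : ℝ, 0 < ε → 0 < r → 2 * ε * r < 1 + 2 * Y →
      Slab.levelSet σ ε r Y
          = Set.range (fun p : ℝ × ℝ => Slab.torus σ ε r Y p.1 p.2) ∧
      (∀ (γ : ℝ → Slab.Phase) (s : Set ℝ), s.OrdConnected → Slab.IsMotionOn σ ε γ s →
        ∀ t₀ ∈ s, γ t₀ ∈ Slab.levelSet σ ε r Y → ∀ t ∈ s, γ t ∈ Slab.levelSet σ ε r Y) ∧
      Slab.action σ ε r Y = Slab.loopAction σ ε (Slab.cycle σ ε r Y)) ∧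
    -- `J₁` is an exact constant of motion
    (∀ ε : ℝ, 0 < ε → ∀ (γ : ℝ → Slab.Phase) (s : Set ℝ), s.OrdConnected →
      Slab.IsMotionOn σ ε γ s →
        ∀ t₁ ∈ s, ∀ t₂ ∈ s, Slab.actionAt σ ε (γ t₁) = Slab.actionAt σ ε (γ t₂)) ∧
    -- the roto-rate and Kruskal's adiabatic invariant series exist
    (∃ (R : ℕ → Slab.Phase → Slab.Phase) (μ : ℕ → Slab.Phase → ℝ),
      Slab.IsRotoRate σ R ∧ Slab.IsKruskalSeries σ R μ) ∧
    -- the roto-rate is unique, Kruskal's series is its Hamiltonian, and the power series of `J₁`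
    -- in `ε` is Kruskal's series
    (∀ (R : ℕ → Slab.Phase → Slab.Phase) (μ : ℕ → Slab.Phase → ℝ),
      Slab.IsRotoRate σ R → Slab.IsKruskalSeries σ R μ →
        (∀ R', Slab.IsRotoRate σ R' → ∀ k, ∀ z ∈ Slab.region, R' k z = R k z) ∧
        Slab.IsHamiltonianSeries σ R μ ∧
        ∀ K : Set Slab.Phase, IsCompact K → K ⊆ Slab.region →
          ∃ ρ : ℝ, 0 < ρ ∧ ∀ z ∈ K, ∀ ε : ℝ, |ε| < ρ →
            HasSum (fun k : ℕ => ε ^ k * μ k z) (Slab.actionAt σ ε z)) := by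
  have hσ2 : σ ^ 2 = 1 := by rcases hσ with rfl | rfl <;> norm_num
  refine ⟨fun ε r Y hε hr hrY => ⟨Slab.levelSet_eq_range_torus hσ2 hε hr hrY,
    fun γ s hs hγ t₀ h₀ h t ht => hγ.mem_levelSet hσ2 hε hrY hs h₀ h ht,
    Slab.action_eq_loopAction_cycle hσ2 hε hr hrY⟩, fun ε _ γ s hs hγ t₁ h₁ t₂ h₂ => ?_,
    ⟨_, _, Slab.isRotoRate_rotoRate hσ2, Slab.isKruskalSeries_actionSeries hσ2⟩,
    fun R μ hR hμ => ?_⟩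
  · rw [Slab.actionAt, Slab.actionAt, hγ.speed_eq hs h₁ h₂, hγ.centerY_eq hs h₁ h₂]
  · have hR' := fun R' (h : Slab.IsRotoRate σ R') => Slab.IsRotoRate.unique hσ2 hR h
    have hRR := Slab.IsRotoRate.unique hσ2 (Slab.isRotoRate_rotoRate hσ2) hR
    have hμμ := Slab.IsKruskalSeries.unique hσ2 (Slab.isRotoRate_rotoRate hσ2) hRR
      (Slab.isKruskalSeries_actionSeries hσ2) hμ
    refine ⟨hR', (Slab.isHamiltonianSeries_actionSeries hσ2).congr hRR hμμ,
      fun K hK hKr => ?_⟩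
    obtain ⟨ρ, hρ, h⟩ := Slab.exists_hasSum_actionAt hσ2 hK hKr
    refine ⟨ρ, hρ, fun z hz ε hε => ?_⟩
    simpa only [hμμ _ z (hKr hz)] using h z hz ε hε
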